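/- Let $1<p<\infty$, $N>p$, $s\in(0,1)$ and $p^*=\frac{Np}{N-p}$. Let $$\mathcal W_p=\Big\{u\in L^{p^*}(\mathbb R^N):\ \nabla u\in L^p(\mathbb R^N;\mathbb R^N)\text{ (weak gradient)},\ [u]_{s,p}<\infty\Big\},\qquad [u]_{s,p}^p=\iint_{\mathbb R^{2N}}\frac{|u(x)-u(y)|^p}{|x-y|^{N+sp}}\,dx\,dy,$$ normed by $\rho_p(u)=\|\nabla u\|_p+[u]_{s,p}$, and write $|D^su|^p(x)=\int_{\mathbb R^N}\frac{|u(x+h)-u(x)|^p}{|h|^{N+sp}}\,dh$. Let $S_p$ be the largest constant $C$ with $C\|u\|_{p^*}^p\le\|\nabla u\|_p^p+[u]_{s,p}^p$ for all $u\in\mathcal W_p$. For $f\in\mathcal W_p^*$ put $$J_f(u)=\tfrac1p\big(\|\nabla u\|_p^p+[u]_{s,p}^p\big)-\tfrac1{p^*}\|u\|_{p^*}^{p^*}-\langle f,u\rangle,\qquad u\in\mathcal W_p .$$ Let $c\in\mathbb R$ and let $(u_n)$ be a bounded sequence in $\mathcal W_p$ with $J_f(u_n)\to c$ and $J_f'(u_n)\to0$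 in $\mathcal W_p^*$ (Fréchet derivative), and assume $u_n\rightharpoonup u_0$ weakly in $\mathcal W_p$. Then: (i) Let $\mu_0,\nu_0$ be finite Borel measures on $\mathbb R^N$ such that, along some subsequence, $(|\nabla u_n|^p+|D^su_n|^p)\,dx\to\mu_0$ and $|u_n|^{p^*}dx\to\nu_0$ vaguely, that is, against all functions in $C_c(\mathbb R^N)$. Then there exist an at most countable index set $J$, distinct points $x_j\in\mathbb R^N$ and numbers $\mu_j,\nu_j>0$ $(j\in J)$ such that $$\mu_0\ge(|\nabla u_0|^p+|D^su_0|^p)\,dx+\sum_{j\in J}\mu_j\delta_{x_j},\quad \mu_j=\mu_0(\{x_j\}),$$ $$\nu_0=|u_0|^{p^*}dx+\sum_{j\in J}\nu_j\delta_{x_j},\quad \nu_j=\nu_0(\{x_j\}),\qquad S_p\,\nu_j^{p/p^*}\le\mu_j ,$$ and for every such family the set $J$ is finite. (ii) There is a subsequence along which $\nabla u_n\to\nabla u_0$ almost everywhere in $\mathbb R^N$. (iii) $|\nabla u_n|^{p-2}\nabla u_n\rightharpoonup|\nabla u_0|^{p-2}\nabla u_0$ weakly in $\big(L^p(\mathbb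 R^N;\mathbb R^N)\big)^*=L^{p'}(\mathbb R^N;\mathbb R^N)$, $p'=\frac p{p-1}$, for the whole sequence. -/

import Mathlib

open MeasureTheory Filter Topology
open scoped ENNReal ContDiff

noncomputable section

namespace MixedPLaplace

/-- Admissible parameters: a dimension `N` and exponents with `1 < p < N` and `0 < s < 1`. -/
structure Params where
  N : ℕ
  p : ℝ
  s : ℝ
  one_lt_p : 1 < p
  p_lt_N : p < N
  s_pos : 0 < s
  s_lt_one : s < 1

namespace Params

variable (P : Params)

/-- The domain `ℝᴺ` with its Euclidean norm. -/
abbrev E : Type := EuclideanSpace ℝ (Fin P.N)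

/-- The critical Sobolev exponent `p* = N p / (N - p)`. -/
def pstar : ℝ := P.N * P.p / (P.N - P.p)

/-- `p` as an extended nonnegative real. -/
abbrev pE : ℝ≥0∞ := ENNReal.ofReal P.p

/-- `p*` as an extended nonnegative real. -/
abbrev pstarE : ℝ≥0∞ := ENNReal.ofReal P.pstar

/-- The conjugate exponent `p' = p / (p - 1)` as an extended nonnegative real. -/
abbrev pconjE : ℝ≥0∞ := ENNReal.ofReal (P.p / (P.p - 1))

lemma p_pos : 0 < P.p := zero_lt_one.trans P.one_lt_p

lemma N_pos : 0 < P.N := by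
  have h := P.p_pos.trans P.p_lt_N
  exact_mod_cast h

lemma p_le_pstar : P.p ≤ P.pstar := by
  have h1 := P.p_lt_N
  have h0 := P.p_pos
  rw [pstar, le_div_iff₀ (by linarith)]
  nlinarith

lemma pstar_pos : 0 < P.pstar := P.p_pos.trans_le P.p_le_pstar

instance fact_one_le_pE : Fact (1 ≤ P.pE) :=
  ⟨by simpa using P.one_lt_p.le⟩

instance fact_one_le_pstarE : Fact (1 ≤ P.pstarE) :=
  ⟨by simpa using P.one_lt_p.le.trans P.p_le_pstar⟩

lemma pE_ne_zero : P.pE ≠ 0 := by simpa using P.p_pos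

lemma pstarE_ne_zero : P.pstarE ≠ 0 := by simpa using P.pstar_pos

instance nonempty_fin : Nonempty (Fin P.N) := ⟨⟨0, P.N_pos⟩⟩

end Params

open Params

variable {P : Params}

/-- `g` is the weak (distributional) gradient of `u` on `ℝᴺ`:
`∫ u ∂ᵥφ = - ∫ ⟪g, v⟫ φ` for every `φ ∈ C_c^∞(ℝᴺ)` and every direction `v`. -/
def IsWeakGradient (u : P.E → ℝ) (g : P.E → P.E) : Prop :=
  ∀ φ : P.E → ℝ, ContDiff ℝ ∞ φ → HasCompactSupport φ → ∀ v : P.E,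
    ∫ x, u x * fderiv ℝ φ x v = - ∫ x, inner ℝ (g x) v * φ x

/-- `|Dˢu|ᵖ(x) = ∫ |u(x+h) - u(x)|ᵖ / |h|^(N+sp) dh`. -/
def fracDerivPow (u : P.E → ℝ) (x : P.E) : ℝ≥0∞ :=
  ∫⁻ h, ENNReal.ofReal (|u (x + h) - u x| ^ P.p / ‖h‖ ^ (P.N + P.s * P.p))

/-- The `p`-th power of the Gagliardo seminorm,
`[u]_{s,p}ᵖ = ∬ |u(x) - u(y)|ᵖ / |x - y|^(N+sp) dx dy`. -/
def gagliardoPow (u : P.E → ℝ) : ℝ≥0∞ :=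
  ∫⁻ x, ∫⁻ y, ENNReal.ofReal (|u x - u y| ^ P.p / ‖x - y‖ ^ (P.N + P.s * P.p))

/-- The difference quotient whose `Lᵖ(ℝᴺ × ℝᴺ)` norm is `[u]_{s,p}`. -/
def diffQuot (u : P.E → ℝ) (z : P.E × P.E) : ℝ :=
  (u z.1 - u z.2) / ‖z.1 - z.2‖ ^ ((P.N + P.s * P.p) / P.p)

lemma aestronglyMeasurable_diffQuot {u : P.E → ℝ} (hu : AEStronglyMeasurable u volume) :
    AEStronglyMeasurable (diffQuot u) ((volume : Measure P.E).prod (volume : Measure P.E)) := by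
  unfold diffQuot
  have hm : Measurable (fun z : P.E × P.E =>
      (‖z.1 - z.2‖ ^ ((P.N + P.s * P.p) / P.p) : ℝ)) := by fun_prop
  exact (hu.comp_fst.sub hu.comp_snd).aemeasurable.div hm.aemeasurable |>.aestronglyMeasurable

lemma enorm_diffQuot_rpow (u : P.E → ℝ) (x y : P.E) :
    ‖diffQuot u (x, y)‖ₑ ^ P.p =
      ENNReal.ofReal (|u x - u y| ^ P.p / ‖x - y‖ ^ (P.N + P.s * P.p)) := by
  have hp := P.p_pos
  rw [← ofReal_norm, ENNReal.ofReal_rpow_of_nonneg (norm_nonneg _) hp.le]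
  congr 1
  simp only [diffQuot, Real.norm_eq_abs, abs_div]
  rw [Real.div_rpow (abs_nonneg _) (abs_nonneg _),
    abs_of_nonneg (Real.rpow_nonneg (norm_nonneg _) _), ← Real.rpow_mul (norm_nonneg _),
    div_mul_cancel₀ _ hp.ne']

lemma eLpNorm_diffQuot {u : P.E → ℝ} (hu : AEStronglyMeasurable u volume) :
    eLpNorm (diffQuot u) P.pE ((volume : Measure P.E).prod (volume : Measure P.E)) =
      gagliardoPow u ^ (1 / P.p) := by
  rw [eLpNorm_eq_lintegral_rpow_enorm_toReal P.pE_ne_zero ENNReal.ofReal_ne_top,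
    ENNReal.toReal_ofReal P.p_pos.le,
    lintegral_prod _ ((aestronglyMeasurable_diffQuot hu).enorm.pow_const _)]
  simp only [enorm_diffQuot_rpow, gagliardoPow]

lemma memLp_diffQuot_iff {u : P.E → ℝ} (hu : AEStronglyMeasurable u volume) :
    MemLp (diffQuot u) P.pE ((volume : Measure P.E).prod (volume : Measure P.E)) ↔ gagliardoPow u < ⊤ := by
  have hp := P.p_pos
  rw [MemLp, eLpNorm_diffQuot hu, ENNReal.rpow_lt_top_iff_of_pos (by positivity)]
  exact ⟨fun h => h.2, fun h => ⟨aestronglyMeasurable_diffQuot hu, h⟩⟩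

lemma diffQuot_congr {u v : P.E → ℝ} (h : u =ᵐ[volume] v) :
    diffQuot u =ᵐ[(volume : Measure P.E).prod (volume : Measure P.E)] diffQuot v := by
  have h1 := Measure.quasiMeasurePreserving_fst (μ := (volume : Measure P.E))
    (ν := (volume : Measure P.E)) |>.ae_eq_comp h
  have h2 := Measure.quasiMeasurePreserving_snd (μ := (volume : Measure P.E))
    (ν := (volume : Measure P.E)) |>.ae_eq_comp h
  filter_upwards [h1, h2] with z hz1 hz2
  simp only [Function.comp_apply] at hz1 hz2
  simp only [diffQuot, hz1, hz2]

lemma diffQuot_add (u v : P.E → ℝ) : diffQuot (u + v) = diffQuot u + diffQuot v := by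
  funext z; simp only [diffQuot, Pi.add_apply]; ring

lemma diffQuot_smul (c : ℝ) (u : P.E → ℝ) : diffQuot (c • u) = c • diffQuot u := by
  funext z; simp only [diffQuot, Pi.smul_apply, smul_eq_mul]; ring

lemma IsWeakGradient.congr {u u' : P.E → ℝ} {g g' : P.E → P.E} (h : IsWeakGradient u g)
    (hu : u =ᵐ[volume] u') (hg : g =ᵐ[volume] g') : IsWeakGradient u' g' := by
  intro φ hφ hc v
  have e1 : ∫ x, u' x * fderiv ℝ φ x v = ∫ x, u x * fderiv ℝ φ x v :=
    integral_congr_ae (by filter_upwards [hu] with x hx; rw [hx])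
  have e2 : ∫ x, inner ℝ (g' x) v * φ x = ∫ x, inner ℝ (g x) v * φ x :=
    integral_congr_ae (by filter_upwards [hg] with x hx; rw [hx])
  rw [e1, e2, h φ hφ hc v]

lemma integrable_mul_fderiv {q : ℝ≥0∞} [hq : Fact (1 ≤ q)] (u : Lp ℝ q (volume : Measure P.E))
    {φ : P.E → ℝ} (hφ : ContDiff ℝ ∞ φ) (hc : HasCompactSupport φ) (v : P.E) :
    Integrable (fun x => u x * fderiv ℝ φ x v) := by
  have hl : LocallyIntegrable (u : P.E → ℝ) := (Lp.memLp u).locallyIntegrable hq.out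
  have hcont : Continuous (fun x => fderiv ℝ φ x v) :=
    (hφ.continuous_fderiv (by simp)).clm_apply continuous_const
  have hcs : HasCompactSupport (fun x => fderiv ℝ φ x v) := hc.fderiv_apply ℝ v
  simpa [mul_comm, smul_eq_mul] using hl.integrable_smul_left_of_hasCompactSupport hcont hcs

lemma integrable_inner_mul (g : Lp P.E P.pE (volume : Measure P.E))
    {φ : P.E → ℝ} (hφ : ContDiff ℝ ∞ φ) (hc : HasCompactSupport φ) (v : P.E) :
    Integrable (fun x => inner ℝ (g x) v * φ x) := by
  have hl : LocallyIntegrable (fun x => φ x • g x) :=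
    ((Lp.memLp g).locallyIntegrable (Fact.out)).integrable_smul_left_of_hasCompactSupport
      hφ.continuous hc |>.locallyIntegrable
  have h := (((Lp.memLp g).locallyIntegrable
    (Fact.out : 1 ≤ P.pE)).integrable_smul_left_of_hasCompactSupport hφ.continuous hc).inner_const
      (𝕜 := ℝ) v
  refine h.congr (Eventually.of_forall fun x => ?_)
  simp only [real_inner_smul_left]; ring

lemma IsWeakGradient.add {u v : Lp ℝ P.pstarE (volume : Measure P.E)}
    {g k : Lp P.E P.pE (volume : Measure P.E)}
    (hu : IsWeakGradient u g) (hv : IsWeakGradient v k) :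
    IsWeakGradient (u + v : Lp ℝ P.pstarE (volume : Measure P.E))
      (g + k : Lp P.E P.pE (volume : Measure P.E)) := by
  refine IsWeakGradient.congr (u := fun x => u x + v x) (g := fun x => g x + k x) ?_
    (Lp.coeFn_add u v).symm (Lp.coeFn_add g k).symm
  intro φ hφ hc w
  simp only [add_mul, inner_add_left]
  rw [integral_add (integrable_mul_fderiv u hφ hc w) (integrable_mul_fderiv v hφ hc w),
    integral_add (integrable_inner_mul g hφ hc w) (integrable_inner_mul k hφ hc w),
    hu φ hφ hc w, hv φ hφ hc w]
  ring

lemma IsWeakGradient.smul (c : ℝ) {u : Lp ℝ P.pstarE (volume : Measure P.E)}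
    {g : Lp P.E P.pE (volume : Measure P.E)} (hu : IsWeakGradient u g) :
    IsWeakGradient (c • u : Lp ℝ P.pstarE (volume : Measure P.E))
      (c • g : Lp P.E P.pE (volume : Measure P.E)) := by
  refine IsWeakGradient.congr (u := fun x => c * u x) (g := fun x => c • g x) ?_
    (Lp.coeFn_smul c u).symm (Lp.coeFn_smul c g).symm
  intro φ hφ hc w
  simp only [real_inner_smul_left, mul_assoc, integral_const_mul, hu φ hφ hc w, mul_neg]

/-- The weak gradient is unique. -/
lemma IsWeakGradient.unique {u : P.E → ℝ} {g k : Lp P.E P.pE (volume : Measure P.E)}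
    (hg : IsWeakGradient u g) (hk : IsWeakGradient u k) : g = k := by
  have hl : LocallyIntegrable (fun x => g x - k x) :=
    ((Lp.memLp g).locallyIntegrable Fact.out).sub ((Lp.memLp k).locallyIntegrable Fact.out)
  have key : ∀ᵐ x, g x - k x = 0 := by
    refine ae_eq_zero_of_integral_contDiff_smul_eq_zero hl fun φ hφ hc => ?_
    have hi : Integrable (fun x => φ x • (g x - k x)) :=
      hl.integrable_smul_left_of_hasCompactSupport hφ.continuous hc
    refine ext_inner_right ℝ fun v => ?_
    rw [inner_zero_left, real_inner_comm, ← integral_inner hi]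
    have e : ∀ x, inner ℝ v (φ x • (g x - k x)) =
        inner ℝ (g x) v * φ x - inner ℝ (k x) v * φ x := fun x => by
      rw [real_inner_comm, real_inner_smul_left, inner_sub_left]; ring
    simp only [e]
    rw [integral_sub (integrable_inner_mul g hφ hc v) (integrable_inner_mul k hφ hc v)]
    have h1 := hg φ hφ hc v
    have h2 := hk φ hφ hc v
    linarith
  refine Lp.ext ?_
  filter_upwards [key] with x hx
  exact sub_eq_zero.mp hx

variable (P) in
/-- The functions `u ∈ L^{p*}(ℝᴺ)` with weak gradient in `Lᵖ` and `[u]_{s,p} < ∞`. -/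
def wSubmodule : Submodule ℝ (Lp ℝ P.pstarE (volume : Measure P.E)) where
  carrier := {u | (∃ g : Lp P.E P.pE (volume : Measure P.E), IsWeakGradient u g) ∧
    gagliardoPow u < ⊤}
  zero_mem' := by
    refine ⟨⟨0, ?_⟩, ?_⟩
    · refine IsWeakGradient.congr (u := 0) (g := 0) ?_ (Lp.coeFn_zero ..).symm
        (Lp.coeFn_zero ..).symm
      intro φ _ _ v
      simp
    · rw [← memLp_diffQuot_iff (Lp.aestronglyMeasurable _)]
      refine (memLp_congr_ae (diffQuot_congr (Lp.coeFn_zero ..))).mpr ?_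
      have : diffQuot (0 : P.E → ℝ) = 0 := by funext z; simp [diffQuot]
      rw [this]
      exact MemLp.zero
  add_mem' := by
    rintro u v ⟨⟨g, hg⟩, hu⟩ ⟨⟨k, hk⟩, hv⟩
    refine ⟨⟨g + k, hg.add hk⟩, ?_⟩
    rw [← memLp_diffQuot_iff (Lp.aestronglyMeasurable _)] at hu hv ⊢
    refine (memLp_congr_ae (diffQuot_congr (Lp.coeFn_add ..))).mpr ?_
    rw [diffQuot_add]
    exact hu.add hv
  smul_mem' := by
    rintro c u ⟨⟨g, hg⟩, hu⟩
    refine ⟨⟨c • g, hg.smul c⟩, ?_⟩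
    rw [← memLp_diffQuot_iff (Lp.aestronglyMeasurable _)] at hu ⊢
    refine (memLp_congr_ae (diffQuot_congr (Lp.coeFn_smul ..))).mpr ?_
    rw [diffQuot_smul]
    exact hu.const_smul c

variable (P) in
/-- The solution space `𝒲_p`, i.e. the functions `u ∈ L^{p*}(ℝᴺ)` with weak gradient in `Lᵖ` and
`[u]_{s,p} < ∞`. It is a separate type because its norm, given below, is
`ρ_p(u) = ‖∇u‖_p + [u]_{s,p}` and not the one of `L^{p*}`. -/
def W : Type := ↥(wSubmodule P)

namespace W

instance : AddCommGroup (W P) := inferInstanceAs (AddCommGroup ↥(wSubmodule P))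

instance : Module ℝ (W P) := inferInstanceAs (Module ℝ ↥(wSubmodule P))

/-- The element of `L^{p*}(ℝᴺ)` underlying an element of `𝒲_p`. -/
def val : W P →ₗ[ℝ] Lp ℝ P.pstarE (volume : Measure P.E) := (wSubmodule P).subtype

instance : CoeFun (W P) (fun _ => P.E → ℝ) := ⟨fun u => (val u : P.E → ℝ)⟩

lemma val_injective : Function.Injective (val : W P → _) := Subtype.val_injective

lemma exists_grad (u : W P) :
    ∃ g : Lp P.E P.pE (volume : Measure P.E), IsWeakGradient (u : P.E → ℝ) g := u.2.1

lemma gagliardoPow_lt_top (u : W P) : gagliardoPow (u : P.E → ℝ) < ⊤ := u.2.2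

/-- The weak gradient `∇u ∈ Lᵖ(ℝᴺ; ℝᴺ)`, as a linear map. -/
def grad : W P →ₗ[ℝ] Lp P.E P.pE (volume : Measure P.E) where
  toFun u := (exists_grad u).choose
  map_add' u v := (exists_grad (u + v)).choose_spec.unique <| by
    rw [map_add]; exact (exists_grad u).choose_spec.add (exists_grad v).choose_spec
  map_smul' c u := (exists_grad (c • u)).choose_spec.unique <| by
    rw [map_smul]; exact (exists_grad u).choose_spec.smul c

lemma isWeakGradient_grad (u : W P) : IsWeakGradient (u : P.E → ℝ) (grad u) :=
  (exists_grad u).choose_spec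

lemma memLp_diffQuot (u : W P) :
    MemLp (diffQuot (u : P.E → ℝ)) P.pE ((volume : Measure P.E).prod (volume : Measure P.E)) :=
  (memLp_diffQuot_iff (Lp.aestronglyMeasurable _)).mpr (gagliardoPow_lt_top u)

/-- The difference quotient of `u`, as a linear map into `Lᵖ(ℝᴺ × ℝᴺ)`. -/
def quot : W P →ₗ[ℝ] Lp ℝ P.pE ((volume : Measure P.E).prod (volume : Measure P.E)) where
  toFun u := (memLp_diffQuot u).toLp _
  map_add' u v := by
    rw [← MemLp.toLp_add, MemLp.toLp_eq_toLp_iff, ← diffQuot_add]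
    refine diffQuot_congr ?_
    rw [map_add]
    exact Lp.coeFn_add ..
  map_smul' c u := by
    rw [RingHom.id_apply, ← MemLp.toLp_const_smul, MemLp.toLp_eq_toLp_iff, ← diffQuot_smul]
    refine diffQuot_congr ?_
    rw [map_smul]
    exact Lp.coeFn_smul ..

lemma quot_injective : Function.Injective (quot : W P → _) := by
  rw [injective_iff_map_eq_zero]
  intro u hu
  have hp := P.p_pos
  have h0 : diffQuot (u : P.E → ℝ) =ᵐ[(volume : Measure P.E).prod (volume : Measure P.E)] 0 := by
    have := (memLp_diffQuot u).coeFn_toLp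
    have h2 : (quot u : P.E × P.E → ℝ) =ᵐ[(volume : Measure P.E).prod (volume : Measure P.E)] 0 := by
      rw [hu]; exact Lp.coeFn_zero ..
    exact this.symm.trans h2
  have h1 : ∀ᵐ x : P.E, ∀ᵐ y : P.E, diffQuot (u : P.E → ℝ) (x, y) = 0 :=
    Measure.ae_ae_of_ae_prod h0
  obtain ⟨x, hx⟩ := h1.exists
  have hconst : (u : P.E → ℝ) =ᵐ[volume] fun _ => u x := by
    filter_upwards [hx] with y hy
    by_cases hxy : x = y
    · rw [hxy]
    · have hn : ‖x - y‖ ^ ((P.N + P.s * P.p) / P.p) ≠ 0 :=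
        (Real.rpow_pos_of_pos (norm_pos_iff.mpr (sub_ne_zero.mpr hxy)) _).ne'
      simp only [diffQuot, div_eq_zero_iff, hn, or_false] at hy
      linarith
  have hm : MemLp (fun _ : P.E => u x) P.pstarE volume :=
    (memLp_congr_ae hconst).mp (Lp.memLp (val u))
  rw [memLp_const_iff P.pstarE_ne_zero ENNReal.ofReal_ne_top] at hm
  have hz : u x = 0 := by
    rcases hm with h | h
    · exact h
    · exact absurd h (by simp)
  apply val_injective
  rw [map_zero]
  refine Lp.ext (hconst.trans ?_)
  rw [hz]
  exact (Lp.coeFn_zero ..).symm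

/-- The pair `(∇u, Dₛu)`; the norm of `𝒲_p` is the sum of the two `Lᵖ` norms. -/
def pair : W P →ₗ[ℝ] WithLp 1 (Lp P.E P.pE (volume : Measure P.E) ×
    Lp ℝ P.pE ((volume : Measure P.E).prod (volume : Measure P.E))) :=
  (WithLp.linearEquiv 1 ℝ _).symm.toLinearMap ∘ₗ grad.prod quot

lemma pair_injective : Function.Injective (pair : W P → _) := by
  intro u v h
  apply quot_injective
  have := congrArg (fun z => (WithLp.linearEquiv 1 ℝ _ z).2) h
  simpa [pair] using this

instance : NormedAddCommGroup (W P) := NormedAddCommGroup.induced _ _ pair pair_injective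

instance : NormedSpace ℝ (W P) := NormedSpace.induced ℝ _ _ pair

/-- The seminorm `[u]_{s,p}`. -/
def gagliardo (u : W P) : ℝ := (gagliardoPow (u : P.E → ℝ)).toReal ^ (1 / P.p)

lemma norm_quot (u : W P) : ‖quot u‖ = gagliardo u := by
  have : ‖quot u‖ = (eLpNorm (diffQuot (u : P.E → ℝ)) P.pE
      ((volume : Measure P.E).prod (volume : Measure P.E))).toReal := Lp.norm_toLp _ (memLp_diffQuot u)
  rw [this, eLpNorm_diffQuot (Lp.aestronglyMeasurable _), ← ENNReal.toReal_rpow]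
  rfl

/-- The norm of `𝒲_p` is `ρ_p(u) = ‖∇u‖_p + [u]_{s,p}`. -/
lemma norm_eq (u : W P) : ‖u‖ = ‖grad u‖ + gagliardo u := by
  have : ‖u‖ = ‖pair u‖ := rfl
  rw [this, WithLp.prod_norm_eq_of_L1, ← norm_quot]
  rfl

end W

open W

/-- `J_f(u) = (1/p) (‖∇u‖_pᵖ + [u]_{s,p}ᵖ) - (1/p*) ‖u‖_{p*}^{p*} - ⟨f, u⟩`. -/
def energy (f : W P →L[ℝ] ℝ) (u : W P) : ℝ :=
  1 / P.p * (‖grad u‖ ^ P.p + gagliardo u ^ P.p) - 1 / P.pstar * ‖val u‖ ^ P.pstar - f u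

/-- `(u_n)` is a Palais–Smale sequence of `J_f` at level `c`: `J_f(u_n) → c`, and the Fréchet
derivatives of `J_f` at `u_n` tend to `0` in the dual norm of `𝒲_p`. -/
def IsPalaisSmale (f : W P →L[ℝ] ℝ) (c : ℝ) (u : ℕ → W P) : Prop :=
  Tendsto (fun n => energy f (u n)) atTop (𝓝 c) ∧
    ∃ A : ℕ → (W P →L[ℝ] ℝ),
      (∀ n, HasFDerivAt (energy f) (A n) (u n)) ∧ Tendsto A atTop (𝓝 0)

/-- Weak convergence `u_n ⇀ u₀` in `𝒲_p`. -/
def WeaklyConverges (u : ℕ → W P) (u₀ : W P) : Prop :=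
  ∀ l : W P →L[ℝ] ℝ, Tendsto (fun n => l (u n)) atTop (𝓝 (l u₀))

/-- The measure `(|∇u|ᵖ + |Dˢu|ᵖ) dx`. -/
def energyMeasure (u : W P) : Measure P.E :=
  volume.withDensity fun x => ENNReal.ofReal (‖grad u x‖ ^ P.p) + fracDerivPow (u : P.E → ℝ) x

/-- The measure `|u|^{p*} dx`. -/
def critMeasure (u : W P) : Measure P.E :=
  volume.withDensity fun x => ENNReal.ofReal (|u x| ^ P.pstar)

/-- Vague convergence of measures on `ℝᴺ`, i.e. tested against `C_c(ℝᴺ)`. -/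
def VaguelyConverges (m : ℕ → Measure P.E) (m₀ : Measure P.E) : Prop :=
  ∀ φ : P.E → ℝ, Continuous φ → HasCompactSupport φ →
    Tendsto (fun n => ∫ x, φ x ∂(m n)) atTop (𝓝 (∫ x, φ x ∂m₀))

variable (P) in
/-- `S_p`, the largest `C` with `C ‖u‖_{p*}ᵖ ≤ ‖∇u‖_pᵖ + [u]_{s,p}ᵖ` for all `u ∈ 𝒲_p`. -/
def sobolevConst : ℝ :=
  sSup {C : ℝ | ∀ u : W P, C * ‖val u‖ ^ P.p ≤ ‖grad u‖ ^ P.p + gagliardo u ^ P.p}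

/-- The conclusion of the concentration compactness principle for the limit measures `μ₀`, `ν₀`
and the weak limit `u₀`: `J` is an at most countable index set, the `x j` are distinct points, and
`μ j`, `ν j` are the positive masses of `μ₀`, `ν₀` at these points, with
`μ₀ ≥ (|∇u₀|ᵖ + |Dˢu₀|ᵖ) dx + ∑ μ_j δ_{x_j}`, `ν₀ = |u₀|^{p*} dx + ∑ ν_j δ_{x_j}` and
`S_p ν_j^{p/p*} ≤ μ_j`. -/
structure IsConcentrationFamily (u₀ : W P) (μ₀ ν₀ : Measure P.E) (J : Type)
    (x : J → P.E) (μ ν : J → ℝ) : Prop where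
  countable : Countable J
  injective : Function.Injective x
  μ_pos : ∀ j, 0 < μ j
  ν_pos : ∀ j, 0 < ν j
  μ_atom : ∀ j, μ₀ {x j} = ENNReal.ofReal (μ j)
  ν_atom : ∀ j, ν₀ {x j} = ENNReal.ofReal (ν j)
  μ_ge : energyMeasure u₀ + Measure.sum (fun j => ENNReal.ofReal (μ j) • Measure.dirac (x j)) ≤ μ₀
  ν_eq : ν₀ = critMeasure u₀ + Measure.sum (fun j => ENNReal.ofReal (ν j) • Measure.dirac (x j))
  sobolev_le : ∀ j, sobolevConst P * ν j ^ (P.p / P.pstar) ≤ μ j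

/-- The field `|∇u|^{p-2} ∇u`. -/
def pFlux (u : W P) (x : P.E) : P.E := ‖grad u x‖ ^ (P.p - 2) • grad u x

/-- Weak convergence `F_n ⇀ F₀` in `(Lᵖ(ℝᴺ; ℝᴺ))*`: the fields lie in `L^{p'}(ℝᴺ; ℝᴺ)`, the dual of
`Lᵖ(ℝᴺ; ℝᴺ)` under the pairing `(F, G) ↦ ∫ F · G`, and they converge against every
`G ∈ Lᵖ(ℝᴺ; ℝᴺ)`. -/
def FluxWeaklyConverges (F : ℕ → P.E → P.E) (F₀ : P.E → P.E) : Prop :=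
  (∀ n, MemLp (F n) P.pconjE volume) ∧ MemLp F₀ P.pconjE volume ∧
    ∀ G : Lp P.E P.pE (volume : Measure P.E),
      Tendsto (fun n => ∫ x, inner ℝ (F n x) (G x)) atTop (𝓝 (∫ x, inner ℝ (F₀ x) (G x)))

end MixedPLaplace

end

open MeasureTheory Filter Topology
open scoped ENNReal ContDiff

noncomputable section

/-! Two obstacles have to be overcome. The exponent `p*` is critical, so mass may concentrate, and
the equation is nonlinear in the gradient, so weak convergence alone does not identify the limit of
the fluxes. Both are handled by testing `J_f'(u_n) → 0` with a suitable function of `w_n = u_n -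
u₀`.

Truncated test function. A bounded weakly convergent sequence has a subsequence converging almost
everywhere (`WeaklyConverges.exists_subseq_tendsto_ae`): the Gagliardo bound makes mollification
accurate uniformly in `n`, and at a fixed scale mollifications converge pointwise. Test with `φ
θ(w_n)`, where `φ` is a cutoff and `θ` an increasing `C¹` truncation with `|θ| ≤ 2k`. The critical
term is `O(k)`, the `f`-term vanishes in the limit, and the nonlocal flux contributes a nonnegative
amount because `θ` is monotone. What remains bounds `∫ φ θ'(w_n) ⟪|∇u_n|^{p-2}∇u_n - |∇u₀|^{p-2}∇u₀,
∇w_n⟫` by `K k + δ` for large `n` (`exists_integral_fluxDefect_le`). Letting `k → 0`, the inner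
product tends to zero in measure on balls, hence almost everywhere along a subsequence, and strict
monotonicity of `ξ ↦ |ξ|^{p-2} ξ` (`tendsto_of_inner_flux_sub`) gives (ii). For (iii), the fluxes
are bounded in `L^{p'}`, and every subsequence has a further one along which they converge almost
everywhere to the same limit.

Untruncated test function. Once gradients converge almost everywhere, the Brezis–Lieb lemma applies
to `∇u_n`, to the difference quotients and to `u_n`. Testing with `φ w_n` then shows that the energy
lost in the limit equals the critical mass lost: `μ₀` and `ν₀` exceed the measures of `u₀` by one
and the same measure `m` (`exists_defect_measure`). The Sobolev inequality for `φ w_n`, in which the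
commutators with `φ` disappear in the limit, yields `S_p m(K)^{p/p*} ≤ m(K)` for compact `K`. As `p
< p*`, each `m(K)` is zero or bounded below by a fixed positive number, so `m` is a finite sum of
Dirac masses (`eq_sum_dirac_of_reverse_holder`). The measures of `u₀` have no atoms, so the points
of any admissible family are atoms of `m`, and there are finitely many. -/

namespace MixedPLaplace

/-! ### Weak convergence in Lebesgue spaces from boundedness and almost everywhere convergence. -/

section LebesgueSpaces

variable {α : Type*} [MeasurableSpace α] {m : Measure α}

/-- An `Lᵖ`-bounded sequence tending to zero almost everywhere tends weakly to zero. -/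
lemma tendsto_lintegral_mul_zero {p q : ℝ} (hpq : p.HolderConjugate q) {f : ℕ → α → ℝ≥0∞}
    {g : α → ℝ≥0∞} (hf : ∀ n, AEMeasurable (f n) m) (hg : AEMeasurable g m) {C : ℝ≥0∞}
    (hC : C ≠ ⊤) (hfC : ∀ n, ∫⁻ x, f n x ^ p ∂m ≤ C) (hgq : ∫⁻ x, g x ^ q ∂m ≠ ⊤)
    (hae : ∀ᵐ x ∂m, Tendsto (fun n => f n x) atTop (𝓝 0)) :
    Tendsto (fun n => ∫⁻ x, f n x * g x ∂m) atTop (𝓝 0) := by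
  have hp := hpq.pos
  have hq := hpq.symm.pos
  have hp1 : 0 < p - 1 := hpq.sub_one_pos
  -- If `a b` exceeds `M b^q`, then `M b^(q-1) ≤ a`, and raising this to the power `p - 1` gives
  -- `M^(p-1) b ≤ a^(p-1)`. The `min` is dominated by `M g^q`, so dominated convergence applies to
  -- it, while the other term is at most `M^(1-p) C` after integration, which is small for large `M`
  -- uniformly in `n`.
  have pointwise : ∀ (M : ℝ≥0∞), M ≠ 0 → M ≠ ⊤ → ∀ a b : ℝ≥0∞,
      a * b ≤ min (a * b) (M * b ^ q) + M ^ (1 - p) * a ^ p := by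
    intro M hM hM' a b
    rcases le_total (a * b) (M * b ^ q) with h | h
    · rw [min_eq_left h]; exact le_self_add
    · rcases eq_or_ne b 0 with rfl | hb0
      · simp
      rcases eq_or_ne b ⊤ with rfl | hb
      · rw [ENNReal.top_rpow_of_pos hq, ENNReal.mul_top hM, top_le_iff] at h
        rw [ENNReal.top_rpow_of_pos hq, ENNReal.mul_top hM, h]
        simp
      refine le_add_left ?_
      have h1 : M * b ^ (q - 1) ≤ a := by
        have h2 : b ^ q = b ^ (q - 1) * b := by
          calc b ^ q = b ^ (q - 1) * b ^ (1 : ℝ) := by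
                rw [← ENNReal.rpow_add _ _ hb0 hb]; ring_nf
            _ = _ := by rw [ENNReal.rpow_one]
        rw [h2, ← mul_assoc] at h
        exact (ENNReal.mul_le_mul_iff_left hb0 hb).1 h
      have h3 : M ^ (p - 1) * b ≤ a ^ (p - 1) := by
        have := ENNReal.rpow_le_rpow h1 hp1.le
        rw [ENNReal.mul_rpow_of_nonneg _ _ hp1.le, ← ENNReal.rpow_mul,
          show (q - 1) * (p - 1) = 1 from ?_, ENNReal.rpow_one] at this
        · exact this
        · have := hpq.mul_eq_add
          nlinarith
      rcases eq_or_ne a 0 with rfl | ha0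
      · simp
      rcases eq_or_ne a ⊤ with rfl | ha
      · rw [ENNReal.top_rpow_of_pos hp, ENNReal.mul_top]
        · exact le_top
        · simp [ENNReal.rpow_eq_zero_iff, hM, hM']
      calc a * b = M ^ (1 - p) * (a * (M ^ (p - 1) * b)) := by
            have : M ^ (1 - p) * M ^ (p - 1) = 1 := by
              rw [← ENNReal.rpow_add _ _ hM hM']; simp
            calc a * b = (M ^ (1 - p) * M ^ (p - 1)) * (a * b) := by rw [this, one_mul]
              _ = _ := by ring
        _ ≤ M ^ (1 - p) * (a * a ^ (p - 1)) := by gcongr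
        _ = M ^ (1 - p) * a ^ p := by
            congr 1
            calc a * a ^ (p - 1) = a ^ (1 : ℝ) * a ^ (p - 1) := by rw [ENNReal.rpow_one]
              _ = a ^ p := by rw [← ENNReal.rpow_add _ _ ha0 ha]; ring_nf
  have small : ∀ M : ℝ≥0∞, M ≠ 0 → M ≠ ⊤ →
      Tendsto (fun n => ∫⁻ x, min (f n x * g x) (M * g x ^ q) ∂m) atTop (𝓝 0) := by
    intro M hM hM'
    have hgfin : ∀ᵐ x ∂m, g x ^ q < ⊤ := ae_lt_top' (hg.pow_const q) hgq
    have := tendsto_lintegral_of_dominated_convergence' (μ := m)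
      (F := fun n x => min (f n x * g x) (M * g x ^ q)) (f := fun _ => 0)
      (fun x => M * g x ^ q)
      (fun n => ((hf n).mul hg).min ((hg.pow_const q).const_mul M))
      (fun n => Eventually.of_forall fun x => min_le_right _ _)
      (by rw [lintegral_const_mul'' _ (hg.pow_const q)]; exact ENNReal.mul_ne_top hM' hgq)
      (by
        filter_upwards [hae, hgfin] with x hx hgx
        have hgx' : g x ≠ ⊤ := by
          rintro h; rw [h, ENNReal.top_rpow_of_pos hq] at hgx; exact lt_irrefl _ hgx
        have h1 : Tendsto (fun n => f n x * g x) atTop (𝓝 0) := by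
          simpa using ENNReal.Tendsto.mul_const hx (Or.inr hgx')
        exact tendsto_of_tendsto_of_tendsto_of_le_of_le tendsto_const_nhds h1
          (fun _ => zero_le) fun n => min_le_left _ _)
    simpa using this
  rw [ENNReal.tendsto_nhds_zero]
  intro ε hε
  obtain ⟨M, hM0, hMt, hM⟩ : ∃ M : ℝ≥0∞, M ≠ 0 ∧ M ≠ ⊤ ∧ M ^ (1 - p) * C ≤ ε / 2 := by
    have h1 : Tendsto (fun t : ℝ => ENNReal.ofReal t ^ (1 - p) * C) atTop (𝓝 0) := by
      have h2 : Tendsto (fun t : ℝ => ENNReal.ofReal (t ^ (-(p - 1)))) atTop (𝓝 0) := by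
        simpa using ENNReal.tendsto_ofReal (tendsto_rpow_neg_atTop hp1)
      have h3 : Tendsto (fun t : ℝ => ENNReal.ofReal (t ^ (-(p - 1))) * C) atTop (𝓝 0) := by
        simpa using ENNReal.Tendsto.mul_const h2 (Or.inr hC)
      refine h3.congr' ?_
      filter_upwards [eventually_gt_atTop 0] with t ht
      rw [ENNReal.ofReal_rpow_of_pos ht]
      congr 3; ring
    have h2 := (h1.eventually (ge_mem_nhds (ENNReal.half_pos hε.ne'))).and (eventually_gt_atTop 0)
    obtain ⟨t, ht, ht0⟩ := h2.exists
    exact ⟨ENNReal.ofReal t, by simpa using ht0, ENNReal.ofReal_ne_top, ht⟩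
  filter_upwards [(small M hM0 hMt).eventually (ge_mem_nhds (ENNReal.half_pos hε.ne'))] with n hn
  calc ∫⁻ x, f n x * g x ∂m
      ≤ ∫⁻ x, min (f n x * g x) (M * g x ^ q) + M ^ (1 - p) * f n x ^ p ∂m :=
        lintegral_mono fun x => pointwise M hM0 hMt _ _
    _ = (∫⁻ x, min (f n x * g x) (M * g x ^ q) ∂m) + M ^ (1 - p) * ∫⁻ x, f n x ^ p ∂m := by
        rw [lintegral_add_right' _ (((hf n).pow_const p).const_mul _),
          lintegral_const_mul'' _ ((hf n).pow_const p)]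
    _ ≤ ε / 2 + M ^ (1 - p) * C := by gcongr; exact hfC n
    _ ≤ ε / 2 + ε / 2 := by gcongr
    _ = ε := ENNReal.add_halves ε

variable {H : Type*} [NormedAddCommGroup H]

lemma lintegral_enorm_rpow {r : ℝ} (hr : 0 < r) {f : α → H} (hf : MemLp f (ENNReal.ofReal r) m) :
    ∫⁻ x, ‖f x‖ₑ ^ r ∂m = ENNReal.ofReal (∫ x, ‖f x‖ ^ r ∂m) := by
  have hi := hf.integrable_norm_rpow (by simpa using hr) ENNReal.ofReal_ne_top
  rw [ENNReal.toReal_ofReal hr.le] at hi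
  rw [ofReal_integral_eq_lintegral_ofReal hi
    (Eventually.of_forall fun x => Real.rpow_nonneg (norm_nonneg _) _)]
  refine lintegral_congr fun x => ?_
  rw [← ofReal_norm, ENNReal.ofReal_rpow_of_nonneg (norm_nonneg _) hr.le]

lemma integrable_norm_rpow {r : ℝ} (hr : 0 < r) {f : α → H} (hf : MemLp f (ENNReal.ofReal r) m) :
    Integrable (fun x => ‖f x‖ ^ r) m := by
  have hi := hf.integrable_norm_rpow (by simpa using hr) ENNReal.ofReal_ne_top
  rwa [ENNReal.toReal_ofReal hr.le] at hi

lemma memLp_of_integrable_norm_rpow {r : ℝ} (hr : 0 < r) {f : α → H}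
    (hf : AEStronglyMeasurable f m) (hi : Integrable (fun x => ‖f x‖ ^ r) m) :
    MemLp f (ENNReal.ofReal r) m := by
  rw [← integrable_norm_rpow_iff hf (by simpa using hr) ENNReal.ofReal_ne_top,
    ENNReal.toReal_ofReal hr.le]
  exact hi

lemma add_rpow_le_two_rpow {r a b : ℝ} (hr : 0 ≤ r) (ha : 0 ≤ a) (hb : 0 ≤ b) :
    (a + b) ^ r ≤ 2 ^ r * (a ^ r + b ^ r) := by
  calc (a + b) ^ r ≤ (2 * max a b) ^ r := by
        gcongr; linarith [le_max_left a b, le_max_right a b]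
    _ = 2 ^ r * max a b ^ r := Real.mul_rpow (by norm_num) (by positivity)
    _ ≤ _ := by
        gcongr
        rcases max_choice a b with h | h <;> rw [h]
        · linarith [Real.rpow_nonneg hb r]
        · linarith [Real.rpow_nonneg ha r]

lemma integral_norm_add_rpow_le {r : ℝ} (hr : 0 < r) {f g : α → H}
    (hf : MemLp f (ENNReal.ofReal r) m) (hg : MemLp g (ENNReal.ofReal r) m) :
    ∫ x, ‖f x + g x‖ ^ r ∂m ≤ 2 ^ r * (∫ x, ‖f x‖ ^ r ∂m + ∫ x, ‖g x‖ ^ r ∂m) := by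
  have hf' := integrable_norm_rpow hr hf
  have hg' := integrable_norm_rpow hr hg
  rw [← integral_add hf' hg', ← integral_const_mul]
  refine integral_mono_of_nonneg (Eventually.of_forall fun x => Real.rpow_nonneg (norm_nonneg _) _)
    ((hf'.add hg').const_mul _) (Eventually.of_forall fun x => ?_)
  refine le_trans ?_ (add_rpow_le_two_rpow hr.le (norm_nonneg _) (norm_nonneg _))
  exact Real.rpow_le_rpow (norm_nonneg _) (norm_add_le _ _) hr.le

lemma integral_norm_sub_rpow_le {r : ℝ} (hr : 0 < r) {f g : α → H}
    (hf : MemLp f (ENNReal.ofReal r) m) (hg : MemLp g (ENNReal.ofReal r) m) :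
    ∫ x, ‖f x - g x‖ ^ r ∂m ≤ 2 ^ r * (∫ x, ‖f x‖ ^ r ∂m + ∫ x, ‖g x‖ ^ r ∂m) := by
  simpa [sub_eq_add_neg] using integral_norm_add_rpow_le hr hf hg.neg

variable [InnerProductSpace ℝ H]

lemma integrable_inner_of_holder {p q : ℝ} (hpq : p.HolderConjugate q) {f g : α → H}
    (hf : MemLp f (ENNReal.ofReal p) m) (hg : MemLp g (ENNReal.ofReal q) m) :
    Integrable (fun x => inner ℝ (f x) (g x)) m := by
  have : ENNReal.HolderConjugate (ENNReal.ofReal p) (ENNReal.ofReal q) := hpq.ennrealOfReal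
  refine (hf.norm.integrable_mul hg.norm).mono' (hf.1.inner hg.1) (Eventually.of_forall fun x => ?_)
  exact norm_inner_le_norm _ _

lemma abs_integral_inner_le {p q : ℝ} (hpq : p.HolderConjugate q) {f g : α → H}
    (hf : MemLp f (ENNReal.ofReal p) m) (hg : MemLp g (ENNReal.ofReal q) m) :
    |∫ x, inner ℝ (f x) (g x) ∂m| ≤
      (∫ x, ‖f x‖ ^ p ∂m) ^ (1 / p) * (∫ x, ‖g x‖ ^ q ∂m) ^ (1 / q) := by
  have : ENNReal.HolderConjugate (ENNReal.ofReal p) (ENNReal.ofReal q) := hpq.ennrealOfReal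
  calc |∫ x, inner ℝ (f x) (g x) ∂m| ≤ ∫ x, ‖(inner ℝ (f x) (g x) : ℝ)‖ ∂m :=
        by rw [← Real.norm_eq_abs]; exact norm_integral_le_integral_norm _
    _ ≤ ∫ x, ‖f x‖ * ‖g x‖ ∂m := by
        refine integral_mono_of_nonneg (Eventually.of_forall fun x => norm_nonneg _)
          (hf.norm.integrable_mul hg.norm) (Eventually.of_forall fun x => norm_inner_le_norm _ _)
    _ ≤ _ := integral_mul_norm_le_Lp_mul_Lq hpq hf hg

/-- Pairings of an `Lᵖ`-bounded sequence with a sequence tending to zero in `L^q` tend to zero. -/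
lemma tendsto_integral_inner_zero_of_strong {p q : ℝ} (hpq : p.HolderConjugate q)
    {f g : ℕ → α → H} (hf : ∀ n, MemLp (f n) (ENNReal.ofReal p) m)
    (hg : ∀ n, MemLp (g n) (ENNReal.ofReal q) m) {C : ℝ} (hfC : ∀ n, ∫ x, ‖f n x‖ ^ p ∂m ≤ C)
    (hg0 : Tendsto (fun n => ∫ x, ‖g n x‖ ^ q ∂m) atTop (𝓝 0)) :
    Tendsto (fun n => ∫ x, inner ℝ (f n x) (g n x) ∂m) atTop (𝓝 0) := by
  have hp := hpq.pos
  have hq := hpq.symm.pos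
  have h1 : Tendsto (fun n => C ^ (1 / p) * (∫ x, ‖g n x‖ ^ q ∂m) ^ (1 / q)) atTop (𝓝 0) := by
    have := (hg0.rpow_const (p := 1 / q) (Or.inr (by positivity))).const_mul (C ^ (1 / p))
    rwa [Real.zero_rpow (by positivity), mul_zero] at this
  refine squeeze_zero_norm (fun n => ?_) h1
  refine (abs_integral_inner_le hpq (hf n) (hg n)).trans ?_
  have : 0 ≤ ∫ x, ‖f n x‖ ^ p ∂m := integral_nonneg fun x => Real.rpow_nonneg (norm_nonneg _) _
  have : 0 ≤ ∫ x, ‖g n x‖ ^ q ∂m := integral_nonneg fun x => Real.rpow_nonneg (norm_nonneg _) _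
  gcongr
  exact hfC n

/-- An `Lᵖ`-bounded sequence converging almost everywhere converges weakly in `Lᵖ`. -/
lemma tendsto_integral_inner_of_ae {p q : ℝ} (hpq : p.HolderConjugate q) {f : ℕ → α → H}
    {f₀ g : α → H} (hf : ∀ n, MemLp (f n) (ENNReal.ofReal p) m)
    (hf₀ : MemLp f₀ (ENNReal.ofReal p) m) (hg : MemLp g (ENNReal.ofReal q) m) {C : ℝ}
    (hfC : ∀ n, ∫ x, ‖f n x‖ ^ p ∂m ≤ C)
    (hae : ∀ᵐ x ∂m, Tendsto (fun n => f n x) atTop (𝓝 (f₀ x))) :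
    Tendsto (fun n => ∫ x, inner ℝ (f n x) (g x) ∂m) atTop
      (𝓝 (∫ x, inner ℝ (f₀ x) (g x) ∂m)) := by
  have hp := hpq.pos
  have hq := hpq.symm.pos
  refine tendsto_integral_of_L1 _ (integrable_inner_of_holder hpq hf₀ hg).1
    (Eventually.of_forall fun n => integrable_inner_of_holder hpq (hf n) hg) ?_
  have key : Tendsto (fun n => ∫⁻ x, ‖f n x - f₀ x‖ₑ * ‖g x‖ₑ ∂m) atTop (𝓝 0) := by
    refine tendsto_lintegral_mul_zero hpq
      (C := ENNReal.ofReal (2 ^ p * (C + ∫ x, ‖f₀ x‖ ^ p ∂m)))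
      (fun n => ((hf n).1.sub hf₀.1).enorm) hg.1.enorm ENNReal.ofReal_ne_top (fun n => ?_) ?_ ?_
    · rw [lintegral_enorm_rpow hp (f := fun x => f n x - f₀ x) ((hf n).sub hf₀)]
      refine ENNReal.ofReal_le_ofReal ((integral_norm_sub_rpow_le hp (hf n) hf₀).trans ?_)
      gcongr
      exact hfC n
    · rw [lintegral_enorm_rpow hq hg]; exact ENNReal.ofReal_ne_top
    · filter_upwards [hae] with x hx
      have := (hx.sub_const (f₀ x)).enorm
      simpa using this
  refine tendsto_of_tendsto_of_tendsto_of_le_of_le tendsto_const_nhds key (fun _ => zero_le)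
    fun n => lintegral_mono fun x => ?_
  simp only
  rw [← inner_sub_left]
  rw [← ofReal_norm, ← ofReal_norm, ← ofReal_norm, ← ENNReal.ofReal_mul (norm_nonneg _)]
  exact ENNReal.ofReal_le_ofReal (norm_inner_le_norm _ _)

end LebesgueSpaces

/-! ### The Brezis–Lieb lemma for vector-valued functions and any exponent `r > 0`. -/

section BrezisLieb

variable {α : Type*} [MeasurableSpace α] {m : Measure α}

/-- By continuity `(1 + δ)^r < 1 + ε` for small `δ`. If `b ≤ δ a` the first term suffices; otherwise
`a ≤ b / δ` and the second does. No convexity is used, so `r < 1` is allowed. -/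
lemma exists_add_rpow_le {r : ℝ} (hr : 0 < r) {ε : ℝ} (hε : 0 < ε) :
    ∃ C : ℝ, 0 ≤ C ∧ ∀ a b : ℝ, 0 ≤ a → 0 ≤ b → (a + b) ^ r ≤ (1 + ε) * a ^ r + C * b ^ r := by
  obtain ⟨δ, hδ, hδ0⟩ : ∃ δ : ℝ, (1 + δ) ^ r < 1 + ε ∧ 0 < δ := by
    have h1 : Tendsto (fun δ : ℝ => (1 + δ) ^ r) (𝓝[>] 0) (𝓝 ((1 + 0) ^ r)) := by
      refine tendsto_nhdsWithin_of_tendsto_nhds ?_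
      exact (tendsto_const_nhds.add tendsto_id).rpow_const (Or.inr hr.le)
    have h2 : ((1 : ℝ) + 0) ^ r < 1 + ε := by simpa using hε
    exact ((h1.eventually (gt_mem_nhds h2)).and self_mem_nhdsWithin).exists
  refine ⟨(1 / δ + 1) ^ r, by positivity, fun a b ha hb => ?_⟩
  have ha' : 0 ≤ a ^ r := Real.rpow_nonneg ha r
  have hb' : 0 ≤ b ^ r := Real.rpow_nonneg hb r
  rcases le_total b (δ * a) with h | h
  · calc (a + b) ^ r ≤ ((1 + δ) * a) ^ r := by gcongr; linarith
      _ = (1 + δ) ^ r * a ^ r := Real.mul_rpow (by positivity) ha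
      _ ≤ (1 + ε) * a ^ r := by gcongr
      _ ≤ _ := le_add_of_nonneg_right (by positivity)
  · calc (a + b) ^ r ≤ ((1 / δ + 1) * b) ^ r := by
          gcongr
          have : a ≤ b / δ := by rw [le_div_iff₀ hδ0]; linarith
          calc a + b ≤ b / δ + b := by linarith
            _ = _ := by ring
      _ = (1 / δ + 1) ^ r * b ^ r := Real.mul_rpow (by positivity) hb
      _ ≤ _ := le_add_of_nonneg_left (by positivity)

variable {H : Type*} [NormedAddCommGroup H]

/-- The upper estimate is the triangle inequality combined with `exists_add_rpow_le`; the lower one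
is the same estimate applied to `x = (x + y) - y`. -/
lemma exists_abs_norm_add_rpow_sub_le {r : ℝ} (hr : 0 < r) {ε : ℝ} (hε : 0 < ε) :
    ∃ C : ℝ, 0 ≤ C ∧ ∀ x y : H,
      |‖x + y‖ ^ r - ‖x‖ ^ r - ‖y‖ ^ r| ≤ ε * ‖x‖ ^ r + C * ‖y‖ ^ r := by
  obtain ⟨C, hC, h⟩ := exists_add_rpow_le hr hε
  refine ⟨C + 1, by positivity, fun x y => ?_⟩
  have hx : 0 ≤ ‖x‖ ^ r := Real.rpow_nonneg (norm_nonneg _) r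
  have hy : 0 ≤ ‖y‖ ^ r := Real.rpow_nonneg (norm_nonneg _) r
  have hxy : 0 ≤ ‖x + y‖ ^ r := Real.rpow_nonneg (norm_nonneg _) r
  have h1 : ‖x + y‖ ^ r ≤ (1 + ε) * ‖x‖ ^ r + C * ‖y‖ ^ r :=
    (Real.rpow_le_rpow (norm_nonneg _) (norm_add_le x y) hr.le).trans
      (h _ _ (norm_nonneg _) (norm_nonneg _))
  have h2 : ‖x‖ ^ r ≤ (1 + ε) * ‖x + y‖ ^ r + C * ‖y‖ ^ r := by
    refine le_trans (Real.rpow_le_rpow (norm_nonneg _) ?_ hr.le)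
      (h _ _ (norm_nonneg _) (norm_nonneg _))
    simpa using norm_sub_le (x + y) y
  rw [abs_le]
  constructor
  -- A violation would make `‖x + y‖ ^ r` smaller than `(1 - ε) ‖x‖ ^ r - C ‖y‖ ^ r`; inserted in
  -- `h2` this is impossible because `(1 + ε)(1 - ε) < 1`.
  · by_contra! hcon
    have h3 : ‖x + y‖ ^ r < ‖x‖ ^ r - ε * ‖x‖ ^ r - C * ‖y‖ ^ r := by linarith
    have h4 : (1 + ε) * ‖x + y‖ ^ r ≤ (1 + ε) * (‖x‖ ^ r - ε * ‖x‖ ^ r - C * ‖y‖ ^ r) := by gcongr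
    nlinarith [mul_nonneg hε.le hx, mul_nonneg hC hy, mul_nonneg hε.le (mul_nonneg hε.le hx),
      mul_nonneg hε.le (mul_nonneg hC hy)]
  · linarith

/-- The Brezis–Lieb lemma. -/
lemma tendsto_integral_abs_brezisLieb {r : ℝ} (hr : 0 < r) {f : ℕ → α → H} {f₀ : α → H}
    (hf : ∀ n, MemLp (f n) (ENNReal.ofReal r) m) (hf₀ : MemLp f₀ (ENNReal.ofReal r) m) {C : ℝ}
    (hfC : ∀ n, ∫ x, ‖f n x‖ ^ r ∂m ≤ C)
    (hae : ∀ᵐ x ∂m, Tendsto (fun n => f n x) atTop (𝓝 (f₀ x))) :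
    Tendsto (fun n => ∫ x, |‖f n x‖ ^ r - ‖f n x - f₀ x‖ ^ r - ‖f₀ x‖ ^ r| ∂m) atTop (𝓝 0) := by
  set K := 2 ^ r * (C + ∫ x, ‖f₀ x‖ ^ r ∂m) with hK
  have hwC : ∀ n, ∫ x, ‖f n x - f₀ x‖ ^ r ∂m ≤ K := fun n =>
    (integral_norm_sub_rpow_le hr (hf n) hf₀).trans (by rw [hK]; gcongr; exact hfC n)
  have hK0 : 0 ≤ K :=
    le_trans (integral_nonneg fun x => Real.rpow_nonneg (norm_nonneg _) _) (hwC 0)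
  have if0 := integrable_norm_rpow hr hf₀
  have ifn := fun n => integrable_norm_rpow hr (hf n)
  have iw : ∀ n, Integrable (fun x => ‖f n x - f₀ x‖ ^ r) m :=
    fun n => integrable_norm_rpow hr ((hf n).sub hf₀)
  have iD : ∀ n, Integrable (fun x => |‖f n x‖ ^ r - ‖f n x - f₀ x‖ ^ r - ‖f₀ x‖ ^ r|) m :=
    fun n => (((ifn n).sub (iw n)).sub if0).abs
  rw [Metric.tendsto_atTop]
  intro η hη
  -- Chosen so that `ε (K + 1) = η / 2`; the `+ 1` covers `K = 0`.
  set ε := η / (2 * (K + 1)) with hε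
  have hε0 : 0 < ε := by positivity
  obtain ⟨B, hB, hle⟩ := exists_abs_norm_add_rpow_sub_le (H := H) hr hε0
  have hpt : ∀ n x, |‖f n x‖ ^ r - ‖f n x - f₀ x‖ ^ r - ‖f₀ x‖ ^ r| ≤
      ε * ‖f n x - f₀ x‖ ^ r + B * ‖f₀ x‖ ^ r := fun n x => by
    simpa using hle (f n x - f₀ x) (f₀ x)
  have hcv : ∀ᵐ x ∂m, Tendsto (fun n => |‖f n x‖ ^ r - ‖f n x - f₀ x‖ ^ r - ‖f₀ x‖ ^ r|) atTop
      (𝓝 0) := by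
    filter_upwards [hae] with x hx
    have h1 := (hx.norm.rpow_const (p := r) (Or.inr hr.le))
    have h2 := ((hx.sub_const (f₀ x)).norm.rpow_const (p := r) (Or.inr hr.le))
    have h3 := ((h1.sub h2).sub_const (‖f₀ x‖ ^ r)).abs
    simpa [Real.zero_rpow hr.ne'] using h3
  -- The error itself has no fixed integrable majorant, but its excess over `ε ‖f n - f₀‖ ^ r` is
  -- dominated by `B ‖f₀‖ ^ r`. The subtracted part costs at most `ε K`.
  have hdom : Tendsto (fun n => ∫ x, max (|‖f n x‖ ^ r - ‖f n x - f₀ x‖ ^ r - ‖f₀ x‖ ^ r| -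
      ε * ‖f n x - f₀ x‖ ^ r) 0 ∂m) atTop (𝓝 (∫ _, 0 ∂m)) := by
    refine tendsto_integral_of_dominated_convergence (fun x => B * ‖f₀ x‖ ^ r)
      (fun n => (((iD n).sub ((iw n).const_mul ε)).1.sup aestronglyMeasurable_const))
      (if0.const_mul B) (fun n => Eventually.of_forall fun x => ?_) ?_
    · rw [Real.norm_eq_abs, abs_of_nonneg (le_max_right _ _)]
      refine max_le ?_ (mul_nonneg hB (Real.rpow_nonneg (norm_nonneg _) _))
      linarith [hpt n x]
    · filter_upwards [hcv] with x hx
      refine squeeze_zero (fun _ => le_max_right _ _) (fun n => ?_) hx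
      refine max_le ?_ (abs_nonneg _)
      have : 0 ≤ ε * ‖f n x - f₀ x‖ ^ r := mul_nonneg hε0.le (Real.rpow_nonneg (norm_nonneg _) _)
      linarith
  rw [integral_zero] at hdom
  obtain ⟨n₀, hn₀⟩ := (Metric.tendsto_atTop.1 hdom) (η / 2) (by positivity)
  refine ⟨n₀, fun n hn => ?_⟩
  have h1 := (abs_lt.1 (by simpa [Real.dist_eq] using hn₀ n hn)).2
  rw [Real.dist_eq, sub_zero, abs_of_nonneg (integral_nonneg fun x => abs_nonneg _)]
  have imax : Integrable (fun x => max (|‖f n x‖ ^ r - ‖f n x - f₀ x‖ ^ r - ‖f₀ x‖ ^ r| -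
      ε * ‖f n x - f₀ x‖ ^ r) 0) m := ((iD n).sub ((iw n).const_mul ε)).pos_part
  calc ∫ x, |‖f n x‖ ^ r - ‖f n x - f₀ x‖ ^ r - ‖f₀ x‖ ^ r| ∂m
      ≤ ∫ x, (max (|‖f n x‖ ^ r - ‖f n x - f₀ x‖ ^ r - ‖f₀ x‖ ^ r| -
          ε * ‖f n x - f₀ x‖ ^ r) 0 + ε * ‖f n x - f₀ x‖ ^ r) ∂m := by
        refine integral_mono (iD n) (imax.add ((iw n).const_mul ε)) fun x => ?_
        simp only
        linarith [le_max_left (|‖f n x‖ ^ r - ‖f n x - f₀ x‖ ^ r - ‖f₀ x‖ ^ r| -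
          ε * ‖f n x - f₀ x‖ ^ r) 0]
    _ = (∫ x, max (|‖f n x‖ ^ r - ‖f n x - f₀ x‖ ^ r - ‖f₀ x‖ ^ r| -
          ε * ‖f n x - f₀ x‖ ^ r) 0 ∂m) + ε * ∫ x, ‖f n x - f₀ x‖ ^ r ∂m := by
        rw [integral_add imax ((iw n).const_mul ε), integral_const_mul]
    _ < η / 2 + η / 2 := by
        refine add_lt_add_of_lt_of_le h1 ?_
        calc ε * ∫ x, ‖f n x - f₀ x‖ ^ r ∂m ≤ ε * (K + 1) := by
              gcongr; linarith [hwC n]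
          _ = η / 2 := by rw [hε]; field_simp
    _ = η := by ring

/-- The Brezis–Lieb lemma, tested against a bounded function. -/
lemma tendsto_integral_mul_norm_sub_rpow {r : ℝ} (hr : 0 < r) {f : ℕ → α → H} {f₀ : α → H}
    (hf : ∀ n, MemLp (f n) (ENNReal.ofReal r) m) (hf₀ : MemLp f₀ (ENNReal.ofReal r) m) {C : ℝ}
    (hfC : ∀ n, ∫ x, ‖f n x‖ ^ r ∂m ≤ C)
    (hae : ∀ᵐ x ∂m, Tendsto (fun n => f n x) atTop (𝓝 (f₀ x)))
    {φ : α → ℝ} (hφ : AEStronglyMeasurable φ m) {B : ℝ} (hB : ∀ x, |φ x| ≤ B) :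
    Tendsto (fun n => ∫ x, φ x * ‖f n x - f₀ x‖ ^ r ∂m -
      (∫ x, φ x * ‖f n x‖ ^ r ∂m - ∫ x, φ x * ‖f₀ x‖ ^ r ∂m)) atTop (𝓝 0) := by
  have h := (tendsto_integral_abs_brezisLieb hr hf hf₀ hfC hae).const_mul B
  rw [mul_zero] at h
  have hint : ∀ g : α → H, MemLp g (ENNReal.ofReal r) m →
      Integrable (fun x => φ x * ‖g x‖ ^ r) m := fun g hg =>
    (integrable_norm_rpow hr hg).bdd_mul hφ (Eventually.of_forall hB)
  refine squeeze_zero_norm (fun n => ?_) h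
  have i1 := hint _ (hf n)
  have i2 := hint _ hf₀
  have i3 : Integrable (fun x => φ x * ‖f n x - f₀ x‖ ^ r) m := hint _ ((hf n).sub hf₀)
  have i4 : Integrable (fun x => φ x * ‖f n x‖ ^ r - φ x * ‖f₀ x‖ ^ r) m := i1.sub i2
  rw [← integral_sub i1 i2, ← integral_sub i3 i4, ← integral_const_mul]
  refine (norm_integral_le_integral_norm _).trans ?_
  refine integral_mono (i3.sub (i1.sub i2)).norm ?_ fun x => ?_
  · exact ((((integrable_norm_rpow hr (hf n)).sub
      (integrable_norm_rpow hr ((hf n).sub hf₀))).sub (integrable_norm_rpow hr hf₀)).abs).const_mul B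
  · simp only [Real.norm_eq_abs]
    rw [show φ x * ‖f n x - f₀ x‖ ^ r - (φ x * ‖f n x‖ ^ r - φ x * ‖f₀ x‖ ^ r) =
      - (φ x * (‖f n x‖ ^ r - ‖f n x - f₀ x‖ ^ r - ‖f₀ x‖ ^ r)) by ring, abs_neg, abs_mul]
    gcongr
    exact hB x

end BrezisLieb

/-! ### The duality map `ξ ↦ |ξ|^{r-2} ξ`: growth, continuity, strict monotonicity, and derivatives
of norms. -/

section Flux

lemma Lp_norm_rpow {H : Type*} [NormedAddCommGroup H] {α : Type*} [MeasurableSpace α]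
    {m : Measure α} {r : ℝ} (hr : 0 < r) (f : Lp H (ENNReal.ofReal r) m) :
    ‖f‖ ^ r = ∫ x, ‖f x‖ ^ r ∂m := by
  rw [Lp.norm_def, (Lp.memLp f).eLpNorm_eq_integral_rpow_norm (by simpa using hr)
    ENNReal.ofReal_ne_top, ENNReal.toReal_ofReal (by positivity), ENNReal.toReal_ofReal hr.le,
    ← Real.rpow_mul (integral_nonneg fun x => by positivity), inv_mul_cancel₀ hr.ne', Real.rpow_one]

variable {H : Type*} [NormedAddCommGroup H] [InnerProductSpace ℝ H]

/-- The duality map `ξ ↦ |ξ|^{r-2} ξ`. -/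
def flux (r : ℝ) (ξ : H) : H := ‖ξ‖ ^ (r - 2) • ξ

lemma norm_flux {r : ℝ} (hr : 1 < r) (ξ : H) : ‖flux r ξ‖ = ‖ξ‖ ^ (r - 1) := by
  rw [flux, norm_smul, Real.norm_of_nonneg (Real.rpow_nonneg (norm_nonneg _) _)]
  rcases eq_or_ne ξ 0 with rfl | h
  · simp [Real.zero_rpow (by linarith : r - 1 ≠ 0)]
  · rw [← Real.rpow_add_one (norm_ne_zero_iff.mpr h)]; ring_nf

lemma norm_flux_rpow {p q : ℝ} (hpq : p.HolderConjugate q) (ξ : H) :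
    ‖flux p ξ‖ ^ q = ‖ξ‖ ^ p := by
  rw [norm_flux hpq.lt, ← Real.rpow_mul (norm_nonneg _), hpq.sub_one_mul_conj]

lemma inner_flux_self {r : ℝ} (hr : 0 < r) (ξ : H) : inner ℝ (flux r ξ) ξ = ‖ξ‖ ^ r := by
  rw [flux, real_inner_smul_left, real_inner_self_eq_norm_sq]
  rcases eq_or_ne ξ 0 with rfl | h
  · simp [Real.zero_rpow hr.ne']
  · rw [← Real.rpow_natCast, ← Real.rpow_add (norm_pos_iff.mpr h)]; norm_num

/-- Only the origin needs care: for `r < 2` the scalar factor is singular there, but the norm of the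
flux is `‖ξ‖ ^ (r - 1)`, which tends to zero. -/
lemma continuous_flux {r : ℝ} (hr : 1 < r) : Continuous (flux r : H → H) := by
  rw [continuous_iff_continuousAt]
  intro ξ
  rcases eq_or_ne ξ 0 with rfl | h
  · have h0 : flux r (0 : H) = 0 := by simp [flux]
    rw [ContinuousAt, h0, tendsto_zero_iff_norm_tendsto_zero]
    simp only [norm_flux hr]
    have : Tendsto (fun x : H => ‖x‖ ^ (r - 1)) (𝓝 0) (𝓝 (‖(0 : H)‖ ^ (r - 1))) :=
      tendsto_norm_zero.rpow_const (Or.inr (by linarith)) |>.trans (by simp)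
    simpa [Real.zero_rpow (by linarith : r - 1 ≠ 0)] using this
  · unfold flux
    fun_prop (discharger := simp [h])

/-- A splitting into a radial part and an angular part, each nonnegative. It treats `r < 2` and `r ≥
2` alike, and the vanishing of the sum forces both parts to vanish. -/
lemma inner_flux_sub_eq {r : ℝ} (hr : 1 < r) (ξ ζ : H) :
    inner ℝ (flux r ξ - flux r ζ) (ξ - ζ) =
      (‖ξ‖ ^ (r - 1) - ‖ζ‖ ^ (r - 1)) * (‖ξ‖ - ‖ζ‖) +
        (‖ξ‖ ^ (r - 2) + ‖ζ‖ ^ (r - 2)) * (‖ξ‖ * ‖ζ‖ - inner ℝ ξ ζ) := by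
  have h : ∀ x : H, ‖x‖ ^ (r - 1) = ‖x‖ ^ (r - 2) * ‖x‖ := fun x => by
    rw [← norm_flux hr x, flux, norm_smul, Real.norm_of_nonneg (Real.rpow_nonneg (norm_nonneg _) _)]
  simp only [flux, inner_sub_left, inner_sub_right, real_inner_smul_left,
    real_inner_self_eq_norm_sq, h, real_inner_comm ξ ζ]
  ring

lemma rpow_sub_mul_sub_nonneg {e a b : ℝ} (he : 0 ≤ e) (ha : 0 ≤ a) (hb : 0 ≤ b) :
    0 ≤ (a ^ e - b ^ e) * (a - b) := by
  rcases le_total a b with h | h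
  · exact mul_nonneg_of_nonpos_of_nonpos
      (sub_nonpos.2 (Real.rpow_le_rpow ha h he)) (sub_nonpos.2 h)
  · exact mul_nonneg (sub_nonneg.2 (Real.rpow_le_rpow hb h he)) (sub_nonneg.2 h)

lemma inner_flux_remainder_nonneg {r : ℝ} (ξ ζ : H) :
    0 ≤ (‖ξ‖ ^ (r - 2) + ‖ζ‖ ^ (r - 2)) * (‖ξ‖ * ‖ζ‖ - inner ℝ ξ ζ) :=
  mul_nonneg (add_nonneg (Real.rpow_nonneg (norm_nonneg _) _) (Real.rpow_nonneg (norm_nonneg _) _))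
    (sub_nonneg.2 (real_inner_le_norm _ _))

lemma inner_flux_sub_nonneg {r : ℝ} (hr : 1 < r) (ξ ζ : H) :
    0 ≤ inner ℝ (flux r ξ - flux r ζ) (ξ - ζ) := by
  rw [inner_flux_sub_eq hr]
  exact add_nonneg (rpow_sub_mul_sub_nonneg (by linarith) (norm_nonneg _) (norm_nonneg _))
    (inner_flux_remainder_nonneg _ _)

/-- If `a n` stays on the far side of some `l ≠ b`, both factors are at least as large in modulus as
for `l`, so the product stays away from zero. No bound on `a` has to be known beforehand. -/
lemma tendsto_of_rpow_sub_mul_sub {e b : ℝ} (he : 0 < e) (hb : 0 ≤ b) {a : ℕ → ℝ}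
    (ha : ∀ n, 0 ≤ a n) (h : Tendsto (fun n => (a n ^ e - b ^ e) * (a n - b)) atTop (𝓝 0)) :
    Tendsto a atTop (𝓝 b) := by
  rw [tendsto_order]
  constructor
  · intro l hl
    by_cases hl0 : l < 0
    · exact Eventually.of_forall fun n => hl0.trans_le (ha n)
    push Not at hl0
    have hpos : 0 < (b ^ e - l ^ e) * (b - l) :=
      mul_pos (sub_pos.2 (Real.rpow_lt_rpow hl0 hl he)) (sub_pos.2 hl)
    filter_upwards [h.eventually (gt_mem_nhds hpos)] with n hn
    by_contra! hcon
    have h1 : a n ^ e ≤ l ^ e := Real.rpow_le_rpow (ha n) hcon he.le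
    have h2 : l ^ e ≤ b ^ e := Real.rpow_le_rpow hl0 hl.le he.le
    have : (b ^ e - l ^ e) * (b - l) ≤ (b ^ e - a n ^ e) * (b - a n) := by
      gcongr; linarith
    linarith [show (b ^ e - a n ^ e) * (b - a n) = (a n ^ e - b ^ e) * (a n - b) by ring]
  · intro l hl
    have hpos : 0 < (l ^ e - b ^ e) * (l - b) :=
      mul_pos (sub_pos.2 (Real.rpow_lt_rpow hb hl he)) (sub_pos.2 hl)
    filter_upwards [h.eventually (gt_mem_nhds hpos)] with n hn
    by_contra! hcon
    have h1 : l ^ e ≤ a n ^ e := Real.rpow_le_rpow (hb.trans hl.le) hcon he.le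
    have h2 : b ^ e ≤ l ^ e := Real.rpow_le_rpow hb hl.le he.le
    have : (l ^ e - b ^ e) * (l - b) ≤ (a n ^ e - b ^ e) * (a n - b) := by
      gcongr; linarith
    linarith

/-- The radial part gives convergence of norms. In the angular part the weight is at least `‖ζ‖ ^ (r
- 2) > 0` when `ζ ≠ 0`, so `‖ξ n‖ ‖ζ‖ - ⟪ξ n, ζ⟫ → 0`. Together they control `‖ξ n - ζ‖² = (‖ξ n‖ -
‖ζ‖)² + 2 (‖ξ n‖ ‖ζ‖ - ⟪ξ n, ζ⟫)`. -/
lemma tendsto_of_inner_flux_sub {r : ℝ} (hr : 1 < r) {ξ : ℕ → H} {ζ : H}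
    (h : Tendsto (fun n => inner ℝ (flux r (ξ n) - flux r ζ) (ξ n - ζ)) atTop (𝓝 0)) :
    Tendsto ξ atTop (𝓝 ζ) := by
  simp only [inner_flux_sub_eq hr] at h
  have hnn1 : ∀ n, 0 ≤ (‖ξ n‖ ^ (r - 1) - ‖ζ‖ ^ (r - 1)) * (‖ξ n‖ - ‖ζ‖) := fun n =>
    rpow_sub_mul_sub_nonneg (by linarith) (norm_nonneg _) (norm_nonneg _)
  have hnn2 := fun n => inner_flux_remainder_nonneg (r := r) (ξ n) ζ
  have h1 : Tendsto (fun n => ‖ξ n‖) atTop (𝓝 ‖ζ‖) :=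
    tendsto_of_rpow_sub_mul_sub (e := r - 1) (by linarith) (norm_nonneg _) (fun n => norm_nonneg _)
      (squeeze_zero hnn1 (fun n => le_add_of_nonneg_right (hnn2 n)) h)
  rcases eq_or_ne ζ 0 with rfl | hζ
  · rw [tendsto_zero_iff_norm_tendsto_zero]; simpa using h1
  have hζ' : 0 < ‖ζ‖ := norm_pos_iff.mpr hζ
  have h2 : Tendsto (fun n => ‖ξ n‖ * ‖ζ‖ - inner ℝ (ξ n) ζ) atTop (𝓝 0) := by
    have h3 := squeeze_zero hnn2 (fun n => le_add_of_nonneg_left (hnn1 n)) h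
    have hc : 0 < ‖ζ‖ ^ (r - 2) := Real.rpow_pos_of_pos hζ' _
    have h4 := h3.const_mul (‖ζ‖ ^ (r - 2))⁻¹
    rw [mul_zero] at h4
    refine squeeze_zero (fun n => sub_nonneg.2 (real_inner_le_norm _ _)) (fun n => ?_) h4
    rw [← mul_assoc]
    refine le_mul_of_one_le_left (sub_nonneg.2 (real_inner_le_norm _ _)) ?_
    rw [mul_add, inv_mul_cancel₀ hc.ne']
    have := Real.rpow_nonneg (norm_nonneg (ξ n)) (r - 2)
    have : 0 ≤ (‖ζ‖ ^ (r - 2))⁻¹ * ‖ξ n‖ ^ (r - 2) := by positivity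
    linarith
  rw [tendsto_iff_norm_sub_tendsto_zero]
  have h5 : Tendsto (fun n => ‖ξ n - ζ‖ ^ 2) atTop (𝓝 0) := by
    have h6 : Tendsto (fun n => (‖ξ n‖ - ‖ζ‖) ^ 2 + 2 * (‖ξ n‖ * ‖ζ‖ - inner ℝ (ξ n) ζ)) atTop
        (𝓝 ((‖ζ‖ - ‖ζ‖) ^ 2 + 2 * 0)) :=
      ((h1.sub_const _).pow 2).add (h2.const_mul 2)
    simp only [sub_self, mul_zero, add_zero, ne_eq, OfNat.ofNat_ne_zero, not_false_eq_true,
      zero_pow] at h6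
    refine h6.congr fun n => ?_
    rw [norm_sub_sq_real]; ring
  have h7 := h5.sqrt
  simpa using h7

variable {α : Type*} [MeasurableSpace α] {m : Measure α}

lemma memLp_flux {p q : ℝ} (hpq : p.HolderConjugate q) {f : α → H}
    (hf : MemLp f (ENNReal.ofReal p) m) :
    MemLp (fun x => flux p (f x)) (ENNReal.ofReal q) m := by
  refine memLp_of_integrable_norm_rpow hpq.symm.pos
    ((continuous_flux hpq.lt).comp_aestronglyMeasurable hf.1) ?_
  simp only [norm_flux_rpow hpq]
  exact integrable_norm_rpow hpq.pos hf

/-- Differentiation under the integral: for `|t| < 1` the derivative of the integrand is bounded by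
`r (‖f‖ + ‖g‖) ^ r`. Derivatives along lines suffice, since the Fréchet derivative of the energy is
given. -/
lemma hasDerivAt_integral_norm_add_smul_rpow {r : ℝ} (hr : 1 < r) {f g : α → H}
    (hf : MemLp f (ENNReal.ofReal r) m) (hg : MemLp g (ENNReal.ofReal r) m) :
    HasDerivAt (fun t : ℝ => ∫ x, ‖f x + t • g x‖ ^ r ∂m)
      (r * ∫ x, inner ℝ (flux r (f x)) (g x) ∂m) 0 := by
  have hr0 : 0 < r := by linarith
  have hcont := continuous_flux (H := H) hr
  have hmem : ∀ t : ℝ, MemLp (fun x => f x + t • g x) (ENNReal.ofReal r) m :=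
    fun t => hf.add (hg.const_smul t)
  have hbound : MemLp (fun x => ‖f x‖ + ‖g x‖) (ENNReal.ofReal r) m := hf.norm.add hg.norm
  have ibound := (integrable_norm_rpow hr0 hbound).const_mul r
  have h := hasDerivAt_integral_of_dominated_loc_of_deriv_le (μ := m) (x₀ := (0 : ℝ))
    (F := fun t x => ‖f x + t • g x‖ ^ r)
    (F' := fun t x => r * inner ℝ (flux r (f x + t • g x)) (g x))
    (s := Metric.ball 0 1) (bound := fun x => r * ‖‖f x‖ + ‖g x‖‖ ^ r)
    (Metric.ball_mem_nhds _ one_pos)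
    (Eventually.of_forall fun t => (integrable_norm_rpow hr0 (hmem t)).1)
    (integrable_norm_rpow hr0 (hmem 0))
    (((hcont.comp_aestronglyMeasurable (hmem 0).1).inner hg.1).const_mul r)
    (Eventually.of_forall fun x t ht => ?_) ibound (Eventually.of_forall fun x t _ => ?_)
  · have h2 := h.2
    simp only [zero_smul, add_zero, integral_const_mul] at h2
    exact h2
  · have ht' : |t| ≤ 1 := by simpa using (mem_ball_zero_iff.1 ht).le
    have h1 : ‖f x + t • g x‖ ≤ ‖f x‖ + ‖g x‖ := by
      refine (norm_add_le _ _).trans ?_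
      gcongr
      rw [norm_smul]
      exact mul_le_of_le_one_left (norm_nonneg _) ht'
    rw [norm_mul, Real.norm_of_nonneg hr0.le, Real.norm_of_nonneg (by positivity : 0 ≤ ‖f x‖ + ‖g x‖)]
    gcongr
    calc ‖(inner ℝ (flux r (f x + t • g x)) (g x) : ℝ)‖
        ≤ ‖flux r (f x + t • g x)‖ * ‖g x‖ := norm_inner_le_norm _ _
      _ ≤ (‖f x‖ + ‖g x‖) ^ (r - 1) * (‖f x‖ + ‖g x‖) := by
          rw [norm_flux hr]
          gcongr
          exact le_add_of_nonneg_left (norm_nonneg _)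
      _ = (‖f x‖ + ‖g x‖) ^ r := by
          rw [← Real.rpow_add_one' (by positivity) (by linarith)]; ring_nf
  · have h1 := (hasFDerivAt_norm_rpow (f x + t • g x) hr).comp_hasDerivAt t
      (((hasDerivAt_id t).smul_const (g x)).const_add (f x))
    refine h1.congr_deriv ?_
    rw [smul_apply, one_smul, innerSL_apply_apply, smul_eq_mul, flux,
      real_inner_smul_left, mul_assoc]

lemma hasDerivAt_Lp_norm_rpow {r : ℝ} (hr : 1 < r) (f g : Lp H (ENNReal.ofReal r) m) :
    HasDerivAt (fun t : ℝ => ‖f + t • g‖ ^ r)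
      (r * ∫ x, inner ℝ (flux r (f x)) (g x) ∂m) 0 := by
  refine (hasDerivAt_integral_norm_add_smul_rpow hr (Lp.memLp f) (Lp.memLp g)).congr_of_eventuallyEq
    (Eventually.of_forall fun t => ?_)
  simp only
  rw [Lp_norm_rpow (by linarith)]
  refine integral_congr_ae ?_
  filter_upwards [Lp.coeFn_add f (t • g), Lp.coeFn_smul t g] with x h1 h2
  rw [h1, Pi.add_apply, h2, Pi.smul_apply]

end Flux

/-! ### From local convergence in measure to almost everywhere convergence. -/

section AlmostEverywhere

variable {X : Type*} [PseudoMetricSpace X] [MeasurableSpace X] {m : Measure X}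
  {F : Type*} [PseudoMetricSpace F]

/-- A sequence converging in measure on every ball has a subsequence converging almost everywhere. -/
lemma exists_strictMono_tendsto_ae_of_tendsto_measure_ball (x₀ : X) {f : ℕ → X → F} {f₀ : X → F}
    (h : ∀ R ε : ℝ, 0 < ε →
      Tendsto (fun n => m (Metric.ball x₀ R ∩ {x | ε ≤ dist (f n x) (f₀ x)})) atTop (𝓝 0)) :
    ∃ k : ℕ → ℕ, StrictMono k ∧ ∀ᵐ x ∂m, Tendsto (fun n => f (k n) x) atTop (𝓝 (f₀ x)) := by
  -- A diagonal choice for Borel–Cantelli: at stage `j` the ball has radius `j`, the tolerance is `1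
  -- / (j + 1)`, and the exceptional set has measure at most `2^(-j)`.
  have hev : ∀ j : ℕ, ∀ᶠ n in atTop,
      m (Metric.ball x₀ j ∩ {x | 1 / ((j : ℝ) + 1) ≤ dist (f n x) (f₀ x)}) ≤ (1 / 2) ^ j := by
    intro j
    refine (h j (1 / ((j : ℝ) + 1)) (by positivity)).eventually (ge_mem_nhds ?_)
    exact ENNReal.pow_pos (by simp) j
  obtain ⟨k, hk, hkm⟩ := extraction_forall_of_eventually hev
  refine ⟨k, hk, ?_⟩
  have hsum : ∑' j : ℕ, m (Metric.ball x₀ j ∩ {x | 1 / ((j : ℝ) + 1) ≤ dist (f (k j) x) (f₀ x)}) ≠ ⊤ := by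
    refine ne_top_of_le_ne_top ?_ (ENNReal.tsum_le_tsum hkm)
    rw [ENNReal.tsum_geometric]
    simp
  filter_upwards [ae_eventually_notMem hsum] with x hx
  rw [Metric.tendsto_atTop]
  intro ε hε
  obtain ⟨n₁, hn₁⟩ := eventually_atTop.1 hx
  obtain ⟨n₂, hn₂⟩ := exists_nat_gt (dist x x₀)
  obtain ⟨n₃, hn₃⟩ := exists_nat_one_div_lt hε
  refine ⟨max n₁ (max n₂ n₃), fun n hn => ?_⟩
  have h1 := hn₁ n (le_trans (le_max_left _ _) hn)
  have h2 : (n₂ : ℝ) ≤ n := by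
    exact_mod_cast (le_max_left n₂ n₃).trans ((le_max_right _ _).trans hn)
  have h3 : (n₃ : ℝ) ≤ n := by
    exact_mod_cast (le_max_right n₂ n₃).trans ((le_max_right _ _).trans hn)
  have h4 : x ∈ Metric.ball x₀ (n : ℝ) := by rw [Metric.mem_ball]; linarith
  have h5 : dist (f (k n) x) (f₀ x) < 1 / ((n : ℝ) + 1) := by
    by_contra! hcon
    exact h1 ⟨h4, hcon⟩
  refine h5.trans (lt_of_le_of_lt ?_ hn₃)
  gcongr

end AlmostEverywhere

/-! ### Fractional derivatives of test functions. -/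

section FractionalDerivative

open Params

variable {P : Params}

variable (P) in
-- In polar coordinates the radial exponent is `p - 1 - s p > -1` near zero, because `s < 1`, and
-- `-1 - s p < -1` at infinity, because `s > 0`. Up to a constant, this function dominates the
-- integrand of the fractional derivative of a test function.
lemma integrable_min_one_rpow_div :
    Integrable (fun h : P.E => min 1 (‖h‖ ^ P.p) / ‖h‖ ^ (P.N + P.s * P.p)) := by
  have hp := P.p_pos
  have hs := P.s_pos
  have hs1 := P.s_lt_one
  have hN := P.N_pos
  have hsp : 0 < P.s * P.p := by positivity
  have hsp1 : P.s * P.p < P.p := by nlinarith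
  have hnt : Nontrivial P.E := Module.nontrivial_of_finrank_pos (R := ℝ) (by simpa using hN)
  refine (integrable_fun_norm_addHaar (volume : Measure P.E)
    (f := fun y => min 1 (y ^ P.p) / y ^ (P.N + P.s * P.p))).2 ?_
  rw [finrank_euclideanSpace, Fintype.card_fin,
    show Set.Ioi (0 : ℝ) = Set.Ioo 0 1 ∪ Set.Ici 1 by rw [Set.Ioo_union_Ici_eq_Ioi one_pos]]
  have hpow : ∀ y : ℝ, 0 < y → ∀ e : ℝ,
      y ^ (P.N - 1) * (y ^ e / y ^ (P.N + P.s * P.p)) = y ^ (e - 1 - P.s * P.p) := by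
    intro y hy e
    rw [← Real.rpow_natCast, ← Real.rpow_sub hy, ← Real.rpow_add hy, Nat.cast_sub hN]
    congr 1; push_cast; ring
  refine IntegrableOn.union ?_ ?_
  · have h1 : IntegrableOn (fun y : ℝ => y ^ (P.p - 1 - P.s * P.p)) (Set.Ioo 0 1) :=
      (intervalIntegral.integrableOn_Ioo_rpow_iff one_pos).2 (by linarith)
    refine h1.congr_fun (fun y hy => ?_) measurableSet_Ioo
    have : min 1 (y ^ P.p) = y ^ P.p := min_eq_right (Real.rpow_le_one hy.1.le hy.2.le hp.le)
    simp only [smul_eq_mul]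
    rw [this, hpow y hy.1]
  · rw [integrableOn_Ici_iff_integrableOn_Ioi]
    have h1 : IntegrableOn (fun y : ℝ => y ^ (0 - 1 - P.s * P.p)) (Set.Ioi 1) :=
      integrableOn_Ioi_rpow_of_lt (by linarith) one_pos
    refine h1.congr_fun (fun y hy => ?_) measurableSet_Ioi
    have hy1 : (1 : ℝ) < y := hy
    have : min 1 (y ^ P.p) = y ^ (0 : ℝ) := by
      rw [Real.rpow_zero]; exact min_eq_left (Real.one_le_rpow hy1.le hp.le)
    simp only [smul_eq_mul]
    rw [this, hpow y (by linarith)]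

variable (P) in
lemma lintegral_min_one_rpow_div_lt_top :
    ∫⁻ h : P.E, ENNReal.ofReal (min 1 (‖h‖ ^ P.p) / ‖h‖ ^ (P.N + P.s * P.p)) < ⊤ := by
  have h := (integrable_min_one_rpow_div P).lintegral_lt_top
  exact h

lemma fracDerivPow_eq_lintegral (u : P.E → ℝ) (x : P.E) :
    fracDerivPow u x =
      ∫⁻ y, ENNReal.ofReal (|u x - u y| ^ P.p / ‖x - y‖ ^ (P.N + P.s * P.p)) := by
  rw [fracDerivPow, ← lintegral_add_left_eq_self (μ := (volume : Measure P.E))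
    (fun y => ENNReal.ofReal (|u x - u y| ^ P.p / ‖x - y‖ ^ (P.N + P.s * P.p))) x]
  refine lintegral_congr fun h => ?_
  rw [abs_sub_comm, show x - (x + h) = -h by abel, norm_neg]

lemma fracDerivPow_eq_lintegral_diffQuot (u : P.E → ℝ) (x : P.E) :
    fracDerivPow u x = ∫⁻ y, ‖diffQuot u (x, y)‖ₑ ^ P.p := by
  simp only [fracDerivPow_eq_lintegral, enorm_diffQuot_rpow]

lemma lintegral_fracDerivPow (u : P.E → ℝ) : ∫⁻ x, fracDerivPow u x = gagliardoPow u := by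
  simp only [gagliardoPow, fracDerivPow_eq_lintegral]

lemma measurable_fracDerivPow {u : P.E → ℝ} (hu : Measurable u) : Measurable (fracDerivPow u) := by
  unfold fracDerivPow
  exact Measurable.lintegral_prod_right (by fun_prop)

variable {φ : P.E → ℝ}

lemma exists_abs_sub_rpow_le_min (hφ : ContDiff ℝ ∞ φ) (hc : HasCompactSupport φ) :
    ∃ C : ℝ, 0 ≤ C ∧ ∀ x h : P.E, |φ (x + h) - φ x| ^ P.p ≤ C * min 1 (‖h‖ ^ P.p) := by
  have hp := P.p_pos
  obtain ⟨L, hL⟩ := hφ.lipschitzWith_of_hasCompactSupport hc (by simp)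
  obtain ⟨B, hB⟩ := hc.exists_bound_of_continuous hφ.continuous
  have hB0 : 0 ≤ B := (norm_nonneg _).trans (hB 0)
  refine ⟨(L + 2 * B) ^ P.p, by positivity, fun x h => ?_⟩
  have h1 : |φ (x + h) - φ x| ≤ L * ‖h‖ := by
    have := hL.dist_le_mul (x + h) x
    simpa [Real.dist_eq] using this
  have h2 : |φ (x + h) - φ x| ≤ 2 * B := by
    have h3 := hB (x + h); have h4 := hB x
    rw [Real.norm_eq_abs] at h3 h4
    linarith [abs_sub (φ (x + h)) (φ x)]
  have hL0 : (0 : ℝ) ≤ L := L.2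
  rcases min_choice 1 (‖h‖ ^ P.p) with hm | hm <;> rw [hm]
  · rw [mul_one]; gcongr; linarith
  · rw [← Real.mul_rpow (by positivity) (norm_nonneg _)]
    gcongr
    exact h1.trans (by gcongr; linarith)

lemma exists_fracDerivPow_le (hφ : ContDiff ℝ ∞ φ) (hc : HasCompactSupport φ) :
    ∃ C : ℝ≥0∞, C ≠ ⊤ ∧ ∀ x : P.E, fracDerivPow φ x ≤ C := by
  obtain ⟨C, hC, h⟩ := exists_abs_sub_rpow_le_min hφ hc
  refine ⟨ENNReal.ofReal C *
    ∫⁻ h : P.E, ENNReal.ofReal (min 1 (‖h‖ ^ P.p) / ‖h‖ ^ (P.N + P.s * P.p)),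
    ENNReal.mul_ne_top ENNReal.ofReal_ne_top (lintegral_min_one_rpow_div_lt_top P).ne, fun x => ?_⟩
  rw [← lintegral_const_mul' _ _ ENNReal.ofReal_ne_top]
  refine lintegral_mono fun y => ?_
  rw [← ENNReal.ofReal_mul hC, ← mul_div_assoc]
  gcongr
  exact h x y

lemma gagliardoPow_lt_top_of_contDiff (hφ : ContDiff ℝ ∞ φ) (hc : HasCompactSupport φ) :
    gagliardoPow φ < ⊤ := by
  have hp := P.p_pos
  obtain ⟨C, hC, hle⟩ := exists_abs_sub_rpow_le_min hφ hc
  have hφm : Measurable φ := hφ.continuous.measurable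
  set S := tsupport φ with hS
  have hSm : MeasurableSet S := (isClosed_tsupport φ).measurableSet
  rw [← lintegral_fracDerivPow]
  unfold fracDerivPow
  rw [lintegral_lintegral_swap (by fun_prop)]
  -- For a fixed shift `h` the increment vanishes unless `x` or `x + h` lies in the support `S`, so
  -- integration in `x` costs only the factor `2 * volume S`.
  have hle' : ∀ h x : P.E, ENNReal.ofReal (|φ (x + h) - φ x| ^ P.p / ‖h‖ ^ (P.N + P.s * P.p)) ≤
      ENNReal.ofReal C * ENNReal.ofReal (min 1 (‖h‖ ^ P.p) / ‖h‖ ^ (P.N + P.s * P.p)) *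
        (S.indicator 1 x + S.indicator 1 (x + h)) := by
    intro h x
    rw [← ENNReal.ofReal_mul hC, ← mul_div_assoc]
    by_cases h1 : x ∈ S
    · rw [Set.indicator_of_mem h1, mul_add]
      refine le_add_right ?_
      rw [Pi.one_apply, mul_one]
      gcongr
      exact hle x h
    by_cases h2 : x + h ∈ S
    · rw [Set.indicator_of_mem h2, mul_add]
      refine le_add_left ?_
      rw [Pi.one_apply, mul_one]
      gcongr
      exact hle x h
    rw [image_eq_zero_of_notMem_tsupport h1, image_eq_zero_of_notMem_tsupport h2]
    simp [Real.zero_rpow hp.ne']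
  have hSv : volume S < ⊤ := hc.isCompact.measure_lt_top
  calc ∫⁻ h, ∫⁻ x, ENNReal.ofReal (|φ (x + h) - φ x| ^ P.p / ‖h‖ ^ (P.N + P.s * P.p))
      ≤ ∫⁻ h, ∫⁻ x, ENNReal.ofReal C *
          ENNReal.ofReal (min 1 (‖h‖ ^ P.p) / ‖h‖ ^ (P.N + P.s * P.p)) *
          (S.indicator 1 x + S.indicator 1 (x + h)) :=
        lintegral_mono fun h => lintegral_mono fun x => hle' h x
    _ = ∫⁻ h : P.E, ENNReal.ofReal C *
          ENNReal.ofReal (min 1 (‖h‖ ^ P.p) / ‖h‖ ^ (P.N + P.s * P.p)) * (2 * volume S) := by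
        refine lintegral_congr fun h => ?_
        rw [lintegral_const_mul' _ _ (by finiteness),
          lintegral_add_left (measurable_one.indicator hSm),
          lintegral_add_right_eq_self (μ := (volume : Measure P.E)) (S.indicator 1) h,
          lintegral_indicator_one hSm, two_mul]
    _ = ENNReal.ofReal C *
          (∫⁻ h : P.E, ENNReal.ofReal (min 1 (‖h‖ ^ P.p) / ‖h‖ ^ (P.N + P.s * P.p))) *
          (2 * volume S) := by
        rw [lintegral_mul_const' _ _ (by finiteness), lintegral_const_mul' _ _ (by finiteness)]
    _ < ⊤ := by
        have := lintegral_min_one_rpow_div_lt_top P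
        finiteness

end FractionalDerivative

/-! ### Mollification: `Lᵖ` bounds, weak gradients, and a quantitative rate. -/

section Mollification

open Params ContinuousLinearMap Convolution

variable {P : Params}

/-- A smooth bump function with inner radius `1 / (n + 1)`. -/
def bumpSeq (P : Params) (n : ℕ) : ContDiffBump (0 : P.E) where
  rIn := 1 / ((n : ℝ) + 1)
  rOut := 2 * (1 / ((n : ℝ) + 1))
  rIn_pos := by positivity
  rIn_lt_rOut := by linarith [show (0 : ℝ) < 1 / ((n : ℝ) + 1) by positivity]

/-- The standard mollifiers. -/
def moll (P : Params) (n : ℕ) : P.E → ℝ := (bumpSeq P n).normed volume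

/-- The mollification of `v` at scale `1 / (n + 1)`. -/
def mollify {F : Type*} [NormedAddCommGroup F] [NormedSpace ℝ F] (n : ℕ) (v : P.E → F) : P.E → F :=
  moll P n ⋆[lsmul ℝ ℝ, volume] v

lemma moll_nonneg (n : ℕ) (t : P.E) : 0 ≤ moll P n t := (bumpSeq P n).nonneg_normed t

lemma integral_moll (n : ℕ) : ∫ t, moll P n t = 1 := (bumpSeq P n).integral_normed

lemma contDiff_moll (n : ℕ) : ContDiff ℝ ∞ (moll P n) := (bumpSeq P n).contDiff_normed

lemma hasCompactSupport_moll (n : ℕ) : HasCompactSupport (moll P n) :=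
  (bumpSeq P n).hasCompactSupport_normed

lemma integrable_moll (n : ℕ) : Integrable (moll P n) :=
  (contDiff_moll n).continuous.integrable_of_hasCompactSupport (hasCompactSupport_moll n)

lemma lintegral_moll (n : ℕ) : ∫⁻ t, ENNReal.ofReal (moll P n t) = 1 := by
  rw [← ofReal_integral_eq_lintegral_ofReal (integrable_moll n)
    (Eventually.of_forall (moll_nonneg n)), integral_moll, ENNReal.ofReal_one]

variable {F : Type*} [NormedAddCommGroup F] [NormedSpace ℝ F]

lemma mollify_apply (n : ℕ) (v : P.E → F) (x : P.E) :
    mollify n v x = ∫ t, moll P n t • v (x - t) := rfl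

lemma mollify_apply_swap (n : ℕ) (v : P.E → F) (x : P.E) :
    mollify n v x = ∫ t, moll P n (x - t) • v t := convolution_lsmul_swap

lemma integrable_moll_smul (n : ℕ) {v : P.E → F} (hv : LocallyIntegrable v) (x : P.E) :
    Integrable (fun t => moll P n t • v (x - t)) :=
  (hasCompactSupport_moll n).convolutionExists_left (lsmul ℝ ℝ) (contDiff_moll n).continuous hv x

lemma contDiff_mollify (n : ℕ) {v : P.E → F} (hv : LocallyIntegrable v) :
    ContDiff ℝ ∞ (mollify n v) :=
  (hasCompactSupport_moll n).contDiff_convolution_left (lsmul ℝ ℝ) (contDiff_moll n) hv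

lemma hasCompactSupport_mollify (n : ℕ) {v : P.E → F} (hv : HasCompactSupport v) :
    HasCompactSupport (mollify n v) :=
  (hasCompactSupport_moll n).convolution (L := lsmul ℝ ℝ) hv

lemma tendsto_mollify_ae [CompleteSpace F] {v : P.E → F} (hv : LocallyIntegrable v) :
    ∀ᵐ x, Tendsto (fun n => mollify n v x) atTop (𝓝 (v x)) := by
  refine ContDiffBump.ae_convolution_tendsto_right_of_locallyIntegrable (φ := bumpSeq P)
    (K := 2) ?_ (Eventually.of_forall fun n => le_rfl) hv
  have := (tendsto_one_div_add_atTop_nhds_zero_nat (𝕜 := ℝ)).const_mul 2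
  rwa [mul_zero] at this

/-- Jensen's inequality for the probability density `w`, obtained from Hölder with the splitting `w
= w^(1/p) w^(1/q)`. -/
lemma lintegral_mul_rpow_le {α : Type*} [MeasurableSpace α] {m : Measure α} {p : ℝ} (hp : 1 < p)
    {w f : α → ℝ≥0∞} (hw : Measurable w) (hf : AEMeasurable f m) (h1 : ∫⁻ x, w x ∂m = 1) :
    (∫⁻ x, w x * f x ∂m) ^ p ≤ ∫⁻ x, w x * f x ^ p ∂m := by
  have hpq := Real.HolderConjugate.conjExponent hp
  set q := p.conjExponent
  have hp0 := hpq.pos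
  have h := ENNReal.lintegral_mul_le_Lp_mul_Lq m hpq (f := fun x => w x ^ (1 / p) * f x)
    (g := fun x => w x ^ (1 / q)) ((hw.pow_const _).aemeasurable.mul hf) (hw.pow_const _).aemeasurable
  have e1 : ∀ x, ((fun x => w x ^ (1 / p) * f x) * fun x => w x ^ (1 / q)) x = w x * f x := by
    intro x
    simp only [Pi.mul_apply]
    rw [mul_right_comm, ← ENNReal.rpow_add_of_nonneg _ _ (by positivity)
      (by have := hpq.symm.pos; positivity)]
    have : 1 / p + 1 / q = 1 := by simpa using hpq.inv_add_inv_eq_one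
    rw [this, ENNReal.rpow_one]
  have e2 : ∀ x, (w x ^ (1 / p) * f x) ^ p = w x * f x ^ p := by
    intro x
    rw [ENNReal.mul_rpow_of_nonneg _ _ hp0.le, ← ENNReal.rpow_mul, one_div_mul_cancel hp0.ne',
      ENNReal.rpow_one]
  have e3 : ∀ x, (w x ^ (1 / q)) ^ q = w x := by
    intro x
    rw [← ENNReal.rpow_mul, one_div_mul_cancel hpq.symm.pos.ne', ENNReal.rpow_one]
  simp only [e1, e2, e3, h1, ENNReal.one_rpow, mul_one] at h
  calc (∫⁻ x, w x * f x ∂m) ^ p ≤ ((∫⁻ x, w x * f x ^ p ∂m) ^ (1 / p)) ^ p :=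
        ENNReal.rpow_le_rpow h hp0.le
    _ = _ := by rw [← ENNReal.rpow_mul, one_div_mul_cancel hp0.ne', ENNReal.rpow_one]

lemma enorm_integral_moll_smul_rpow_le {p : ℝ} (hp : 1 < p) (n : ℕ) {G : P.E → F}
    (hG : AEStronglyMeasurable G) :
    ‖∫ t, moll P n t • G t‖ₑ ^ p ≤ ∫⁻ t, ENNReal.ofReal (moll P n t) * ‖G t‖ₑ ^ p := by
  refine le_trans (ENNReal.rpow_le_rpow (enorm_integral_le_lintegral_enorm _) (by linarith)) ?_
  have : ∀ t, ‖moll P n t • G t‖ₑ = ENNReal.ofReal (moll P n t) * ‖G t‖ₑ := fun t => by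
    rw [enorm_smul, Real.enorm_of_nonneg (moll_nonneg n t)]
  simp only [this]
  exact lintegral_mul_rpow_le hp (contDiff_moll n).continuous.measurable.ennreal_ofReal hG.enorm
    (lintegral_moll n)

lemma lintegral_enorm_mollify_rpow_le {p : ℝ} (hp : 1 < p) (n : ℕ) {g : P.E → F}
    (hg : StronglyMeasurable g) :
    ∫⁻ x, ‖mollify n g x‖ₑ ^ p ≤ ∫⁻ x, ‖g x‖ₑ ^ p := by
  have hm : Measurable fun x => ‖g x‖ₑ ^ p := hg.enorm.pow_const p
  have hmoll : Measurable fun t => ENNReal.ofReal (moll P n t) :=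
    (contDiff_moll n).continuous.measurable.ennreal_ofReal
  calc ∫⁻ x, ‖mollify n g x‖ₑ ^ p
      ≤ ∫⁻ x, ∫⁻ t, ENNReal.ofReal (moll P n t) * ‖g (x - t)‖ₑ ^ p :=
        lintegral_mono fun x => enorm_integral_moll_smul_rpow_le hp n
          (hg.comp_measurable (measurable_const.sub measurable_id)).aestronglyMeasurable
    _ = ∫⁻ t, ∫⁻ x, ENNReal.ofReal (moll P n t) * ‖g (x - t)‖ₑ ^ p := by
        refine lintegral_lintegral_swap (Measurable.aemeasurable ?_)
        exact (hmoll.comp measurable_snd).mul (hm.comp (measurable_fst.sub measurable_snd))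
    _ = ∫⁻ t, ENNReal.ofReal (moll P n t) * ∫⁻ x, ‖g x‖ₑ ^ p := by
        refine lintegral_congr fun t => ?_
        rw [lintegral_const_mul' _ _ ENNReal.ofReal_ne_top,
          lintegral_sub_right_eq_self (μ := (volume : Measure P.E)) (fun x => ‖g x‖ₑ ^ p) t]
    _ = ∫⁻ x, ‖g x‖ₑ ^ p := by
        rw [lintegral_mul_const _ hmoll, lintegral_moll, one_mul]

lemma memLp_mollify {p : ℝ} (hp : 1 < p) (n : ℕ) {g : P.E → F} (hg : StronglyMeasurable g)
    (hgp : MemLp g (ENNReal.ofReal p)) : MemLp (mollify n g) (ENNReal.ofReal p) := by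
  have hp0 : 0 < p := by linarith
  refine ⟨(contDiff_mollify n (hgp.locallyIntegrable (by simpa using hp.le))).continuous.aestronglyMeasurable,
    ?_⟩
  have h := lintegral_enorm_mollify_rpow_le hp n hg
  rw [eLpNorm_lt_top_iff_lintegral_rpow_enorm_lt_top (by simpa using hp0) ENNReal.ofReal_ne_top,
    ENNReal.toReal_ofReal hp0.le]
  refine h.trans_lt ?_
  rw [lintegral_enorm_rpow hp0 hgp]
  exact ENNReal.ofReal_lt_top

lemma integral_norm_mollify_rpow_le {p : ℝ} (hp : 1 < p) (n : ℕ) {g : P.E → F}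
    (hg : StronglyMeasurable g) (hgp : MemLp g (ENNReal.ofReal p)) :
    ∫ x, ‖mollify n g x‖ ^ p ≤ ∫ x, ‖g x‖ ^ p := by
  have h := lintegral_enorm_mollify_rpow_le hp n hg
  rw [lintegral_enorm_rpow (by linarith) hgp,
    lintegral_enorm_rpow (by linarith) (memLp_mollify hp n hg hgp)] at h
  exact (ENNReal.ofReal_le_ofReal_iff
    (integral_nonneg fun x => Real.rpow_nonneg (norm_nonneg _) _)).1 h

lemma eLpNorm_mollify_le {p : ℝ} (hp : 1 < p) (n : ℕ) {g : P.E → F} (hg : StronglyMeasurable g) :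
    eLpNorm (mollify n g) (ENNReal.ofReal p) ≤ eLpNorm g (ENNReal.ofReal p) := by
  have hp0 : 0 < p := by linarith
  rw [eLpNorm_eq_lintegral_rpow_enorm_toReal (by simpa using hp0) ENNReal.ofReal_ne_top,
    eLpNorm_eq_lintegral_rpow_enorm_toReal (by simpa using hp0) ENNReal.ofReal_ne_top,
    ENNReal.toReal_ofReal hp0.le]
  exact ENNReal.rpow_le_rpow (lintegral_enorm_mollify_rpow_le hp n hg) (by positivity)

/-- The gradient of a mollification is the mollification of the weak gradient. -/
lemma hasFDerivAt_mollify (n : ℕ) {v : P.E → ℝ} {g : P.E → P.E} (hv : LocallyIntegrable v)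
    (hg : LocallyIntegrable g) (hvg : IsWeakGradient v g) (x : P.E) :
    HasFDerivAt (mollify n v) (innerSL ℝ (mollify n g x)) x := by
  have h1 := (hasCompactSupport_moll (P := P) n).hasFDerivAt_convolution_left (lsmul ℝ ℝ)
    ((contDiff_moll n).of_le (by simp)) hv x
  refine h1.congr_fderiv ?_
  ext w
  have hc' : HasCompactSupport (fderiv ℝ (moll P n)) := (hasCompactSupport_moll n).fderiv ℝ
  have hcont' : Continuous (fderiv ℝ (moll P n)) := (contDiff_moll n).continuous_fderiv (by simp)
  have hex := hc'.convolutionExists_left ((lsmul ℝ ℝ : ℝ →L[ℝ] ℝ →L[ℝ] ℝ).precompL P.E) hcont' hv x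
  rw [convolution_eq_swap, ContinuousLinearMap.integral_apply]
  swap
  · exact hex.integrable_swap
  -- The reflected and translated kernel is an admissible test function; the sign from the
  -- reflection cancels the one in the definition of the weak gradient.
  have htest := hvg (fun t => moll P n (x - t))
    ((contDiff_moll n).comp (contDiff_const.sub contDiff_id))
    ((hasCompactSupport_moll n).comp_homeomorph (Homeomorph.subLeft x)) w
  have hfd : ∀ t, fderiv ℝ (fun t => moll P n (x - t)) t w = - fderiv ℝ (moll P n) (x - t) w := by
    intro t
    have h2 : HasFDerivAt (fun t : P.E => x - t) (-(ContinuousLinearMap.id ℝ P.E)) t := by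
      simpa using (hasFDerivAt_id t).const_sub x
    have h3 := (((contDiff_moll (P := P) n).differentiable (by simp)) (x - t)).hasFDerivAt.comp t h2
    have h4 : fderiv ℝ (fun t => moll P n (x - t)) t = _ := h3.fderiv
    rw [h4]; simp
  simp only [hfd, mul_neg, integral_neg, neg_inj] at htest
  have e1 : ∀ t, ((lsmul ℝ ℝ : ℝ →L[ℝ] ℝ →L[ℝ] ℝ).precompL P.E) (fderiv ℝ (moll P n) (x - t)) (v t) w
      = v t * fderiv ℝ (moll P n) (x - t) w := by
    intro t; rw [precompL_apply]; simp [mul_comm]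
  simp only [e1]
  rw [htest, innerSL_apply_apply, mollify_apply_swap, real_inner_comm, ← integral_inner]
  · refine integral_congr_ae (Eventually.of_forall fun t => ?_)
    simp only
    rw [real_inner_smul_right, real_inner_comm, mul_comm]
  · have := ((hasCompactSupport_moll (P := P) n).convolutionExists_left (lsmul ℝ ℝ)
      (contDiff_moll n).continuous hg x).integrable_swap
    exact this

variable (P) in
-- At scale `δ` the kernel has height of order `δ^(-N)` on a ball of radius `2 δ`, so the weight
-- `‖t‖^(N + s p)` leaves the factor `δ^(s p)`. This gain compares the mollifier with the Gagliardo
-- kernel.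
lemma exists_moll_mul_rpow_le :
    ∃ C : ℝ, 0 ≤ C ∧ ∀ (n : ℕ) (t : P.E),
      moll P n t * ‖t‖ ^ (P.N + P.s * P.p) ≤ C * (1 / ((n : ℝ) + 1)) ^ (P.s * P.p) := by
  have hp := P.p_pos
  have hs := P.s_pos
  have hN := P.N_pos
  set V := (volume : Measure P.E).real (Metric.closedBall 0 1) with hV
  have hVpos : 0 < V :=
    ENNReal.toReal_pos (Metric.measure_closedBall_pos _ _ one_pos).ne' measure_closedBall_lt_top.ne
  refine ⟨2 ^ (P.N + P.s * P.p) / V, by positivity, fun n t => ?_⟩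
  set δ : ℝ := 1 / ((n : ℝ) + 1) with hδ
  have hδ0 : 0 < δ := by positivity
  by_cases ht : t ∈ Metric.ball (0 : P.E) (2 * δ)
  · have h1 : moll P n t ≤ 1 / (δ ^ (P.N : ℝ) * V) := by
      refine ((bumpSeq P n).normed_le_div_measure_closedBall_rIn volume t).trans (le_of_eq ?_)
      have : (volume : Measure P.E).real (Metric.closedBall 0 δ) = δ ^ (P.N : ℝ) * V := by
        have h2 := Measure.addHaar_closedBall_mul_of_pos (volume : Measure P.E) 0 hδ0 1
        rw [mul_one, finrank_euclideanSpace, Fintype.card_fin] at h2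
        rw [measureReal_def, h2, ENNReal.toReal_mul, ENNReal.toReal_ofReal (by positivity), hV,
          measureReal_def, Real.rpow_natCast]
      rw [← this]; rfl
    have h2 : ‖t‖ ≤ 2 * δ := by simpa using (mem_ball_zero_iff.1 ht).le
    calc moll P n t * ‖t‖ ^ (P.N + P.s * P.p)
        ≤ 1 / (δ ^ (P.N : ℝ) * V) * (2 * δ) ^ (P.N + P.s * P.p) := by gcongr
      _ = 2 ^ (P.N + P.s * P.p) / V * δ ^ (P.s * P.p) := by
          rw [Real.mul_rpow (by norm_num) hδ0.le, Real.rpow_add hδ0 (P.N : ℝ)]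
          have : δ ^ (P.N : ℝ) ≠ 0 := (Real.rpow_pos_of_pos hδ0 _).ne'
          field_simp
  · have : moll P n t = 0 := by
      have h3 : t ∉ Function.support (moll P n) := by
        rw [moll, (bumpSeq P n).support_normed_eq]; exact ht
      simpa using h3
    rw [this, zero_mul]; positivity

variable (P) in
/-- Mollification converges at a rate controlled by the Gagliardo seminorm. -/
lemma exists_lintegral_sub_mollify_rpow_le :
    ∃ C : ℝ, 0 ≤ C ∧ ∀ (n : ℕ) (v : P.E → ℝ), StronglyMeasurable v → LocallyIntegrable v →
      ∫⁻ x, ‖v x - mollify n v x‖ₑ ^ P.p ≤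
        ENNReal.ofReal (C * (1 / ((n : ℝ) + 1)) ^ (P.s * P.p)) * gagliardoPow v := by
  obtain ⟨C, hC, hle⟩ := exists_moll_mul_rpow_le P
  refine ⟨C, hC, fun n v hvm hv => ?_⟩
  have hp := P.p_pos
  have hs := P.s_pos
  rw [← lintegral_fracDerivPow, ← lintegral_const_mul' _ _ ENNReal.ofReal_ne_top]
  refine lintegral_mono fun x => ?_
  -- As the kernel has integral one, the error is an average of increments of `v`. Jensen moves the
  -- power inside, and the kernel is then compared with `‖t‖^(-(N + s p))`.
  have e : v x - mollify n v x = ∫ t, moll P n t • (v x - v (x - t)) := by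
    simp only [smul_sub]
    rw [integral_sub ((integrable_moll n).smul_const (v x)) (integrable_moll_smul n hv x),
      integral_smul_const, integral_moll, one_smul, mollify_apply]
  have e2 : fracDerivPow v x =
      ∫⁻ t, ENNReal.ofReal (|v x - v (x - t)| ^ P.p / ‖t‖ ^ (P.N + P.s * P.p)) := by
    rw [fracDerivPow_eq_lintegral, ← lintegral_sub_left_eq_self _ x]
    simp only [sub_sub_cancel]
  have hG : AEStronglyMeasurable (fun t => v x - v (x - t)) :=
    (stronglyMeasurable_const.sub (hvm.comp_measurable
      (measurable_const.sub measurable_id))).aestronglyMeasurable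
  rw [e, e2, ← lintegral_const_mul' _ _ ENNReal.ofReal_ne_top]
  refine (enorm_integral_moll_smul_rpow_le P.one_lt_p n hG).trans (lintegral_mono fun t => ?_)
  simp only
  rw [← ofReal_norm, ENNReal.ofReal_rpow_of_nonneg (norm_nonneg _) hp.le,
    ← ENNReal.ofReal_mul (moll_nonneg n t), ← ENNReal.ofReal_mul (by positivity), Real.norm_eq_abs]
  rcases eq_or_ne t 0 with rfl | ht
  · simp [Real.zero_rpow hp.ne']
  · refine ENNReal.ofReal_le_ofReal ?_
    have ht' : 0 < ‖t‖ ^ (P.N + P.s * P.p) := Real.rpow_pos_of_pos (norm_pos_iff.2 ht) _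
    rw [← mul_div_assoc, le_div_iff₀ ht']
    calc moll P n t * |v x - v (x - t)| ^ P.p * ‖t‖ ^ (P.N + P.s * P.p)
        = (moll P n t * ‖t‖ ^ (P.N + P.s * P.p)) * |v x - v (x - t)| ^ P.p := by ring
      _ ≤ _ := mul_le_mul_of_nonneg_right (hle n t) (by positivity)

end Mollification

/-! ### The Sobolev inequality on `𝒲_p`, by mollification and cutoff. -/

section Sobolev

open Params

variable {P : Params}

lemma inner_gradient_eq_fderiv (φ : P.E → ℝ) (x v : P.E) :
    inner ℝ (gradient φ x) v = fderiv ℝ φ x v := by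
  rw [← InnerProductSpace.toDual_apply_apply, toDual_gradient]

lemma norm_gradient (φ : P.E → ℝ) (x : P.E) : ‖gradient φ x‖ = ‖fderiv ℝ φ x‖ := by
  rw [← toDual_gradient, LinearIsometryEquiv.norm_map]

lemma continuous_gradient {φ : P.E → ℝ} (hφ : ContDiff ℝ ∞ φ) : Continuous (gradient φ) :=
  (InnerProductSpace.toDual ℝ P.E).symm.continuous.comp (hφ.continuous_fderiv (by simp))

/-- Testing the weak gradient of `u` with `φ ψ` produces the term `ψ ∇φ`, which is moved to the
other side. -/
lemma IsWeakGradient.smooth_mul {u : P.E → ℝ} {g : P.E → P.E} (h : IsWeakGradient u g)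
    (hu : LocallyIntegrable u) (hg : LocallyIntegrable g) {φ : P.E → ℝ} (hφ : ContDiff ℝ ∞ φ) :
    IsWeakGradient (fun x => φ x * u x) (fun x => φ x • g x + u x • gradient φ x) := by
  intro ψ hψ hc v
  have h1 := h (fun x => φ x * ψ x) (hφ.mul hψ) hc.mul_left v
  have hfd : ∀ x, fderiv ℝ (fun x => φ x * ψ x) x v =
      φ x * fderiv ℝ ψ x v + ψ x * fderiv ℝ φ x v := by
    intro x
    rw [fderiv_fun_mul (hφ.differentiable (by simp) x) (hψ.differentiable (by simp) x)]
    simp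
  have cφ' : Continuous (fun x => fderiv ℝ φ x v) :=
    (hφ.continuous_fderiv (by simp)).clm_apply continuous_const
  have cψ' : Continuous (fun x => fderiv ℝ ψ x v) :=
    (hψ.continuous_fderiv (by simp)).clm_apply continuous_const
  have i1 : Integrable (fun x => (φ x * fderiv ℝ ψ x v) * u x) := by
    simpa using hu.integrable_smul_left_of_hasCompactSupport (hφ.continuous.mul cψ')
      ((hc.fderiv_apply ℝ v).mul_left)
  have i2 : Integrable (fun x => (ψ x * fderiv ℝ φ x v) * u x) := by
    simpa using hu.integrable_smul_left_of_hasCompactSupport (hψ.continuous.mul cφ') hc.mul_right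
  have i3 : Integrable (fun x => inner ℝ (g x) v * (φ x * ψ x)) := by
    have := (hg.integrable_smul_left_of_hasCompactSupport (hφ.continuous.mul hψ.continuous)
      hc.mul_left).inner_const (𝕜 := ℝ) v
    refine this.congr (Eventually.of_forall fun x => ?_)
    simp only [real_inner_smul_left, Pi.mul_apply]; ring
  have e1 : ∫ x, u x * fderiv ℝ (fun x => φ x * ψ x) x v =
      (∫ x, (φ x * fderiv ℝ ψ x v) * u x) + ∫ x, (ψ x * fderiv ℝ φ x v) * u x := by
    rw [← integral_add i1 i2]
    refine integral_congr_ae (Eventually.of_forall fun x => ?_)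
    simp only [hfd]; ring
  have e2 : ∫ x, inner ℝ (φ x • g x + u x • gradient φ x) v * ψ x =
      (∫ x, inner ℝ (g x) v * (φ x * ψ x)) + ∫ x, (ψ x * fderiv ℝ φ x v) * u x := by
    rw [← integral_add i3 i2]
    refine integral_congr_ae (Eventually.of_forall fun x => ?_)
    simp only [inner_add_left, real_inner_smul_left, inner_gradient_eq_fderiv]; ring
  have e3 : ∫ x, φ x * u x * fderiv ℝ ψ x v = ∫ x, (φ x * fderiv ℝ ψ x v) * u x :=
    integral_congr_ae (Eventually.of_forall fun x => by simp only; ring)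
  rw [e3, e2]
  linarith

/-- The Sobolev inequality for compactly supported weakly differentiable functions. -/
lemma exists_eLpNorm_le_of_hasCompactSupport (P : Params) :
    ∃ C : NNReal, ∀ (v : P.E → ℝ) (g : P.E → P.E), StronglyMeasurable v → StronglyMeasurable g →
      LocallyIntegrable v → LocallyIntegrable g → HasCompactSupport v → IsWeakGradient v g →
      eLpNorm v P.pstarE ≤ C * eLpNorm g P.pE := by
  have hp := P.p_pos
  have hpN := P.p_lt_N
  refine ⟨SNormLESNormFDerivOfEqConst ℝ (volume : Measure P.E) (P.p.toNNReal : ℝ),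
    fun v g hvm hgm hv hg hc hvg => ?_⟩
  have hn : ∀ n, eLpNorm (mollify n v) P.pstarE ≤
      SNormLESNormFDerivOfEqConst ℝ (volume : Measure P.E) (P.p.toNNReal : ℝ) * eLpNorm g P.pE := by
    intro n
    have h1 := eLpNorm_le_eLpNorm_fderiv_of_eq (volume : Measure P.E)
      ((contDiff_mollify n hv).of_le (by simp))
      (hasCompactSupport_mollify n hc)
      (p := P.p.toNNReal) (p' := P.pstar.toNNReal) (by simpa using P.one_lt_p.le)
      (by simpa using P.N_pos) (by
        rw [Real.coe_toNNReal _ P.pstar_pos.le, NNReal.coe_inv, Real.coe_toNNReal _ hp.le, finrank_euclideanSpace,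
          Fintype.card_fin, pstar]
        have : (P.N : ℝ) - P.p ≠ 0 := by linarith
        have : (P.N : ℝ) ≠ 0 := by linarith
        field_simp)
    refine h1.trans ?_
    gcongr
    refine le_trans (le_of_eq ?_) (eLpNorm_mollify_le P.one_lt_p n hgm)
    refine eLpNorm_congr_norm_ae (Eventually.of_forall fun x => ?_)
    rw [(hasFDerivAt_mollify n hv hg hvg x).fderiv, innerSL_apply_norm]
  -- The smooth Sobolev inequality holds for every mollification with the same right-hand side, and
  -- Fatou passes to the limit.
  refine (Lp.eLpNorm_lim_le_liminf_eLpNorm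
    (fun n => (contDiff_mollify n hv).continuous.aestronglyMeasurable) v
    (tendsto_mollify_ae hv)).trans ?_
  exact liminf_le_of_frequently_le' (Frequently.of_forall hn)

/-- Smooth cutoff functions exhausting the space. -/
def cutoff (P : Params) (n : ℕ) (x : P.E) : ℝ := bumpSeq P 0 ((1 / ((n : ℝ) + 1)) • x)

lemma contDiff_cutoff (n : ℕ) : ContDiff ℝ ∞ (cutoff P n) :=
  (bumpSeq P 0).contDiff.comp (contDiff_id.const_smul _)

lemma cutoff_nonneg (n : ℕ) (x : P.E) : 0 ≤ cutoff P n x := (bumpSeq P 0).nonneg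

lemma cutoff_le_one (n : ℕ) (x : P.E) : cutoff P n x ≤ 1 := (bumpSeq P 0).le_one

lemma cutoff_eq_one {n : ℕ} {x : P.E} (hx : ‖x‖ ≤ n + 1) : cutoff P n x = 1 := by
  refine (bumpSeq P 0).one_of_mem_closedBall ?_
  rw [mem_closedBall_zero_iff, norm_smul, Real.norm_of_nonneg (by positivity), one_div_mul_eq_div,
    div_le_iff₀ (by positivity)]
  simpa [bumpSeq] using hx

lemma cutoff_eq_zero {n : ℕ} {x : P.E} (hx : 2 * ((n : ℝ) + 1) ≤ ‖x‖) : cutoff P n x = 0 := by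
  refine (bumpSeq P 0).zero_of_le_dist ?_
  rw [dist_zero_right, norm_smul, Real.norm_of_nonneg (by positivity), one_div_mul_eq_div,
    le_div_iff₀ (by positivity)]
  simpa [bumpSeq] using hx

lemma hasCompactSupport_cutoff (n : ℕ) : HasCompactSupport (cutoff P n) := by
  refine HasCompactSupport.intro (isCompact_closedBall (0 : P.E) (2 * ((n : ℝ) + 1))) fun x hx => ?_
  refine cutoff_eq_zero ?_
  rw [mem_closedBall_zero_iff, not_le] at hx
  exact hx.le

variable (P) in
lemma exists_norm_gradient_cutoff_le :
    ∃ B : ℝ, 0 ≤ B ∧ ∀ (n : ℕ) (x : P.E), ‖gradient (cutoff P n) x‖ ≤ B * (1 / ((n : ℝ) + 1)) := by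
  obtain ⟨B, hB⟩ := ((bumpSeq P 0).hasCompactSupport.fderiv ℝ).exists_bound_of_continuous
    ((bumpSeq P 0).contDiff.continuous_fderiv (n := 1) (by simp))
  refine ⟨B, (norm_nonneg _).trans (hB 0), fun n x => ?_⟩
  have h1 : HasFDerivAt (fun x : P.E => (1 / ((n : ℝ) + 1)) • x)
      ((1 / ((n : ℝ) + 1)) • ContinuousLinearMap.id ℝ P.E) x := (hasFDerivAt_id x).fun_const_smul _
  have h2 := (((bumpSeq P 0).contDiff (n := 1)).differentiable (by simp)
    ((1 / ((n : ℝ) + 1)) • x)).hasFDerivAt.comp x h1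
  have h3 : fderiv ℝ (cutoff P n) x = _ := h2.fderiv
  rw [norm_gradient, h3, ContinuousLinearMap.comp_smul, ContinuousLinearMap.comp_id, norm_smul,
    Real.norm_of_nonneg (by positivity), mul_comm]
  gcongr
  exact hB _

lemma gradient_cutoff_eq_zero {n : ℕ} {x : P.E} (hx : 2 * ((n : ℝ) + 1) < ‖x‖) :
    gradient (cutoff P n) x = 0 := by
  have : cutoff P n =ᶠ[𝓝 x] fun _ => 0 := by
    filter_upwards [continuous_norm.continuousAt.eventually (lt_mem_nhds hx)] with y hy
    exact cutoff_eq_zero hy.le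
  rw [gradient, this.fderiv_eq]; simp

/-- For `u ∈ L^{p*}` the power `|u|ᵖ` lies in `L^{p*/p}`, so weights in `L^{N/p}` are admissible.
This pairing controls cutoff errors and commutators alike. -/
lemma holderConjugate_N_div_p (P : Params) : (P.N / P.p).HolderConjugate (P.pstar / P.p) := by
  have hp := P.p_pos
  have hpN := P.p_lt_N
  rw [Real.holderConjugate_iff]
  refine ⟨by rwa [lt_div_iff₀ hp, one_mul], ?_⟩
  rw [pstar]
  have : (P.N : ℝ) - P.p ≠ 0 := by linarith
  have : (P.N : ℝ) ≠ 0 := by linarith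
  field_simp
  ring

variable (P) in
-- The `L^N` norm of a gradient is invariant under dilation: the decay `1 / (n + 1)` of the gradient
-- is balanced by the growth of the ball that carries it.
lemma exists_lintegral_gradient_cutoff_le :
    ∃ C : ℝ≥0∞, C ≠ ⊤ ∧ ∀ n, ∫⁻ x, ‖gradient (cutoff P n) x‖ₑ ^ (P.N : ℝ) ≤ C := by
  obtain ⟨B, hB0, hB⟩ := exists_norm_gradient_cutoff_le P
  have hN := P.N_pos
  refine ⟨ENNReal.ofReal (2 * B) ^ (P.N : ℝ) * volume (Metric.closedBall (0 : P.E) 1),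
    ENNReal.mul_ne_top (by finiteness) measure_closedBall_lt_top.ne, fun n => ?_⟩
  set δ : ℝ := (n : ℝ) + 1 with hδ
  have hδ0 : 0 < δ := by positivity
  calc ∫⁻ x, ‖gradient (cutoff P n) x‖ₑ ^ (P.N : ℝ)
      ≤ ∫⁻ x, (Metric.closedBall (0 : P.E) (2 * δ)).indicator
          (fun _ => ENNReal.ofReal (B * (1 / δ)) ^ (P.N : ℝ)) x := by
        refine lintegral_mono fun x => ?_
        by_cases hx : x ∈ Metric.closedBall (0 : P.E) (2 * δ)
        · rw [Set.indicator_of_mem hx, ← ofReal_norm]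
          gcongr
          exact hB n x
        · rw [Set.indicator_of_notMem hx, gradient_cutoff_eq_zero]
          · simp [P.N_pos.ne']
          · rwa [mem_closedBall_zero_iff, not_le] at hx
    _ = ENNReal.ofReal (B * (1 / δ)) ^ (P.N : ℝ) * volume (Metric.closedBall (0 : P.E) (2 * δ)) := by
        rw [lintegral_indicator_const measurableSet_closedBall]
    _ = _ := by
        have h2 := Measure.addHaar_closedBall_mul_of_pos (volume : Measure P.E) 0
          (by positivity : 0 < 2 * δ) 1
        rw [mul_one, finrank_euclideanSpace, Fintype.card_fin] at h2
        rw [h2, ← mul_assoc, ← Real.rpow_natCast, ← ENNReal.ofReal_rpow_of_pos (by positivity),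
          ← ENNReal.mul_rpow_of_nonneg _ _ (by positivity), ← ENNReal.ofReal_mul (by positivity)]
        congr 3
        field_simp

/-- The gradients of the cutoffs are bounded in `L^N` and tend to zero pointwise, so their `p`-th
powers are weakly null against `|u|ᵖ`. Membership in `L^{p*}` is all the decay at infinity that is
needed. -/
lemma tendsto_lintegral_mul_gradient_cutoff {u : P.E → ℝ} (hu : MemLp u P.pstarE) :
    Tendsto (fun n => ∫⁻ x, ‖u x • gradient (cutoff P n) x‖ₑ ^ P.p) atTop (𝓝 0) := by
  have hp := P.p_pos
  obtain ⟨C, hC, hle⟩ := exists_lintegral_gradient_cutoff_le P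
  obtain ⟨B, hB0, hB⟩ := exists_norm_gradient_cutoff_le P
  have h := tendsto_lintegral_mul_zero (holderConjugate_N_div_p P)
    (f := fun n x => ‖gradient (cutoff P n) x‖ₑ ^ P.p) (g := fun x => ‖u x‖ₑ ^ P.p)
    (fun n => ((continuous_gradient (contDiff_cutoff n)).enorm.measurable.pow_const _).aemeasurable)
    (hu.1.enorm.pow_const _) hC (fun n => ?_) ?_ (Eventually.of_forall fun x => ?_)
  · refine h.congr fun n => lintegral_congr fun x => ?_
    rw [enorm_smul, ENNReal.mul_rpow_of_nonneg _ _ hp.le, mul_comm]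
  · simp only [← ENNReal.rpow_mul, mul_div_cancel₀ _ hp.ne']
    exact hle n
  · simp only [← ENNReal.rpow_mul, mul_div_cancel₀ _ hp.ne']
    rw [lintegral_enorm_rpow P.pstar_pos hu]
    exact ENNReal.ofReal_ne_top
  · have h1 : Tendsto (fun n => ‖gradient (cutoff P n) x‖) atTop (𝓝 0) := by
      refine squeeze_zero (fun _ => norm_nonneg _) (fun n => hB n x) ?_
      simpa using (tendsto_one_div_add_atTop_nhds_zero_nat (𝕜 := ℝ)).const_mul B
    have h2 := (ENNReal.tendsto_ofReal h1).ennrpow_const P.p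
    simpa [hp] using h2

/-- The Sobolev inequality on `𝒲_p`. -/
lemma exists_norm_val_le (P : Params) : ∃ C : ℝ, 0 < C ∧ ∀ u : W P, ‖W.val u‖ ≤ C * ‖W.grad u‖ := by
  obtain ⟨C, hC⟩ := exists_eLpNorm_le_of_hasCompactSupport P
  refine ⟨C + 1, by positivity, fun u => ?_⟩
  have hp := P.p_pos
  have hum : StronglyMeasurable (u : P.E → ℝ) := Lp.stronglyMeasurable _
  have hgm : StronglyMeasurable (W.grad u : P.E → P.E) := Lp.stronglyMeasurable _
  have hul : LocallyIntegrable (u : P.E → ℝ) := (Lp.memLp (W.val u)).locallyIntegrable Fact.out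
  have hgl : LocallyIntegrable (W.grad u : P.E → P.E) :=
    (Lp.memLp (W.grad u)).locallyIntegrable Fact.out
  have hcut : ∀ n, eLpNorm (fun x => cutoff P n x * u x) P.pstarE ≤
      C * (eLpNorm (W.grad u) P.pE + eLpNorm (fun x => u x • gradient (cutoff P n) x) P.pE) := by
    intro n
    have hφ := contDiff_cutoff (P := P) n
    have hgc := continuous_gradient hφ
    have l1 : LocallyIntegrable (fun x => cutoff P n x • W.grad u x) :=
      LocallyIntegrable.continuous_smul hφ.continuous hgl
    have l2 : LocallyIntegrable (fun x => u x • gradient (cutoff P n) x) :=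
      LocallyIntegrable.smul_continuous hgc hul
    refine (hC _ _ (hφ.continuous.stronglyMeasurable.mul hum)
      ((hφ.continuous.stronglyMeasurable.smul hgm).add (hum.smul hgc.stronglyMeasurable))
      ?_ (l1.add l2) (hasCompactSupport_cutoff n).mul_right
      ((W.isWeakGradient_grad u).smooth_mul hul hgl hφ)).trans ?_
    · exact LocallyIntegrable.continuous_smul hφ.continuous hul
    · gcongr
      refine (eLpNorm_add_le (hφ.continuous.stronglyMeasurable.smul hgm).aestronglyMeasurable
        (hum.smul hgc.stronglyMeasurable).aestronglyMeasurable Fact.out).trans ?_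
      refine add_le_add (eLpNorm_mono fun x => ?_) le_rfl
      rw [Pi.smul_apply', norm_smul, Real.norm_of_nonneg (cutoff_nonneg n x)]
      exact mul_le_of_le_one_left (norm_nonneg _) (cutoff_le_one n x)
  have hlim : Tendsto (fun n => C * (eLpNorm (W.grad u) P.pE +
      eLpNorm (fun x => u x • gradient (cutoff P n) x) P.pE)) atTop
      (𝓝 (C * (eLpNorm (W.grad u) P.pE + 0))) := by
    refine ENNReal.Tendsto.const_mul (tendsto_const_nhds.add ?_) (Or.inr ENNReal.coe_ne_top)
    have h := (tendsto_lintegral_mul_gradient_cutoff (Lp.memLp (W.val u))).ennrpow_const (1 / P.p)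
    rw [ENNReal.zero_rpow_of_pos (by positivity)] at h
    refine h.congr fun n => ?_
    rw [eLpNorm_eq_lintegral_rpow_enorm_toReal P.pE_ne_zero ENNReal.ofReal_ne_top,
      ENNReal.toReal_ofReal hp.le]
  have hfatou := Lp.eLpNorm_lim_le_liminf_eLpNorm (p := P.pstarE) (μ := volume)
    (f := fun n x => cutoff P n x * u x)
    (fun n => ((contDiff_cutoff n).continuous.stronglyMeasurable.mul hum).aestronglyMeasurable)
    (u : P.E → ℝ) (Eventually.of_forall fun x => by
      obtain ⟨n₀, hn₀⟩ := exists_nat_gt ‖x‖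
      refine tendsto_const_nhds.congr' ?_
      filter_upwards [eventually_ge_atTop n₀] with n hn
      have : (n₀ : ℝ) ≤ n := by exact_mod_cast hn
      rw [cutoff_eq_one (by linarith), one_mul])
  have hmain : eLpNorm (u : P.E → ℝ) P.pstarE ≤ C * eLpNorm (W.grad u) P.pE := by
    refine hfatou.trans ((liminf_le_liminf (Eventually.of_forall hcut)).trans ?_)
    rw [hlim.liminf_eq, add_zero]
  rw [Lp.norm_def, Lp.norm_def]
  have h2 := ENNReal.toReal_mono (by
    exact ENNReal.mul_ne_top ENNReal.coe_ne_top (Lp.eLpNorm_ne_top _)) hmain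
  rw [ENNReal.toReal_mul, ENNReal.coe_toReal] at h2
  refine h2.trans ?_
  gcongr
  simp

end Sobolev

/-! ### Functionals on `𝒲_p`, and almost everywhere convergence of weakly convergent sequences. -/

section Functionals

open Params

variable {P : Params}

lemma Params.holderConjugate_pconj (P : Params) : P.p.HolderConjugate (P.p / (P.p - 1)) :=
  Real.HolderConjugate.conjExponent P.one_lt_p

lemma Params.one_lt_pstar (P : Params) : 1 < P.pstar := P.one_lt_p.trans_le P.p_le_pstar

lemma Params.holderConjugate_pstar (P : Params) :
    P.pstar.HolderConjugate (P.pstar / (P.pstar - 1)) :=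
  Real.HolderConjugate.conjExponent P.one_lt_pstar

variable {α : Type*} [MeasurableSpace α] {m : Measure α} {H : Type*} [NormedAddCommGroup H]
  [InnerProductSpace ℝ H]

/-- The functional `f ↦ ∫ ⟪f, g⟫` on `Lᵖ` for `g ∈ L^q`. -/
def pairingL {p q : ℝ} (hpq : p.HolderConjugate q) [Fact (1 ≤ ENNReal.ofReal p)] {g : α → H}
    (hg : MemLp g (ENNReal.ofReal q) m) : Lp H (ENNReal.ofReal p) m →L[ℝ] ℝ :=
  LinearMap.mkContinuous
    { toFun := fun f => ∫ x, inner ℝ (f x) (g x) ∂m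
      map_add' := fun f₁ f₂ => by
        rw [← integral_add (integrable_inner_of_holder hpq (Lp.memLp f₁) hg)
          (integrable_inner_of_holder hpq (Lp.memLp f₂) hg)]
        refine integral_congr_ae ?_
        filter_upwards [Lp.coeFn_add f₁ f₂] with x hx
        rw [hx, Pi.add_apply, inner_add_left]
      map_smul' := fun c f => by
        rw [RingHom.id_apply, smul_eq_mul, ← integral_const_mul]
        refine integral_congr_ae ?_
        filter_upwards [Lp.coeFn_smul c f] with x hx
        rw [hx, Pi.smul_apply, real_inner_smul_left] }
    ((∫ x, ‖g x‖ ^ q ∂m) ^ (1 / q)) fun f => by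
      refine (abs_integral_inner_le hpq (Lp.memLp f) hg).trans (le_of_eq ?_)
      rw [← Lp_norm_rpow hpq.pos, ← Real.rpow_mul (norm_nonneg _), mul_one_div_cancel hpq.pos.ne',
        Real.rpow_one, mul_comm]

lemma pairingL_apply {p q : ℝ} (hpq : p.HolderConjugate q) [Fact (1 ≤ ENNReal.ofReal p)] {g : α → H}
    (hg : MemLp g (ENNReal.ofReal q) m) (f : Lp H (ENNReal.ofReal p) m) :
    pairingL hpq hg f = ∫ x, inner ℝ (f x) (g x) ∂m := rfl

namespace W

lemma gagliardo_nonneg (u : W P) : 0 ≤ gagliardo u := by rw [← norm_quot]; exact norm_nonneg _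

lemma norm_grad_le (u : W P) : ‖grad u‖ ≤ ‖u‖ := by
  rw [norm_eq]; linarith [gagliardo_nonneg u]

lemma norm_quot_le (u : W P) : ‖quot u‖ ≤ ‖u‖ := by
  rw [norm_eq, norm_quot]; linarith [norm_nonneg (grad u)]

/-- The weak gradient as a continuous linear map. -/
def gradL : W P →L[ℝ] Lp P.E P.pE (volume : Measure P.E) :=
  grad.mkContinuous 1 fun u => by rw [one_mul]; exact norm_grad_le u

/-- The Sobolev embedding `𝒲_p → L^{p*}`. -/
def valL : W P →L[ℝ] Lp ℝ P.pstarE (volume : Measure P.E) :=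
  val.mkContinuous (exists_norm_val_le P).choose fun u => by
    refine ((exists_norm_val_le P).choose_spec.2 u).trans ?_
    gcongr
    · exact (exists_norm_val_le P).choose_spec.1.le
    · exact norm_grad_le u

lemma coe_sub (u v : W P) : ((u - v : W P) : P.E → ℝ) =ᵐ[volume] fun x => u x - v x := by
  rw [map_sub]; exact Lp.coeFn_sub _ _

lemma grad_sub (u v : W P) : (grad (u - v) : P.E → P.E) =ᵐ[volume] fun x => grad u x - grad v x := by
  rw [map_sub]; exact Lp.coeFn_sub _ _

lemma quot_ae_eq (u : W P) :
    (quot u : P.E × P.E → ℝ) =ᵐ[(volume : Measure P.E).prod volume] diffQuot (u : P.E → ℝ) :=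
  (memLp_diffQuot u).coeFn_toLp

lemma quot_sub (u v : W P) : (quot (u - v) : P.E × P.E → ℝ)
    =ᵐ[(volume : Measure P.E).prod volume] fun z => quot u z - quot v z := by
  rw [map_sub]; exact Lp.coeFn_sub _ _

lemma memLp_coe (u : W P) : MemLp (u : P.E → ℝ) P.pstarE := Lp.memLp (val u)

lemma stronglyMeasurable (u : W P) : StronglyMeasurable (u : P.E → ℝ) := Lp.stronglyMeasurable _

lemma locallyIntegrable (u : W P) : LocallyIntegrable (u : P.E → ℝ) :=
  (memLp_coe u).locallyIntegrable Fact.out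

lemma memLp_grad (u : W P) : MemLp (grad u : P.E → P.E) P.pE := Lp.memLp _

lemma locallyIntegrable_grad (u : W P) : LocallyIntegrable (grad u : P.E → P.E) :=
  (memLp_grad u).locallyIntegrable Fact.out

lemma memLp_quot (u : W P) :
    MemLp (quot u : P.E × P.E → ℝ) P.pE ((volume : Measure P.E).prod volume) := Lp.memLp _

lemma gagliardoPow_eq (u : W P) : gagliardoPow (u : P.E → ℝ) = ENNReal.ofReal (gagliardo u ^ P.p) := by
  rw [gagliardo, ← Real.rpow_mul ENNReal.toReal_nonneg, one_div_mul_cancel P.p_pos.ne',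
    Real.rpow_one, ENNReal.ofReal_toReal (gagliardoPow_lt_top u).ne]

/-- Elements of `𝒲_p` from functions. -/
lemma exists_of_memLp {u : P.E → ℝ} {g : P.E → P.E} (hu : MemLp u P.pstarE) (hg : MemLp g P.pE)
    (hug : IsWeakGradient u g) (hs : gagliardoPow u < ⊤) :
    ∃ v : W P, (v : P.E → ℝ) =ᵐ[volume] u ∧ (grad v : P.E → P.E) =ᵐ[volume] g ∧
      (quot v : P.E × P.E → ℝ) =ᵐ[(volume : Measure P.E).prod volume] diffQuot u := by
  have h1 : IsWeakGradient (hu.toLp u : P.E → ℝ) (hg.toLp g) :=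
    hug.congr hu.coeFn_toLp.symm hg.coeFn_toLp.symm
  have h2 : gagliardoPow (hu.toLp u : P.E → ℝ) < ⊤ := by
    rw [← memLp_diffQuot_iff hu.1] at hs
    rw [← memLp_diffQuot_iff (Lp.aestronglyMeasurable _)]
    exact (memLp_congr_ae (diffQuot_congr hu.coeFn_toLp)).2 hs
  let v : W P := ⟨hu.toLp u, ⟨hg.toLp g, h1⟩, h2⟩
  have hv : (v : P.E → ℝ) =ᵐ[volume] u := hu.coeFn_toLp
  refine ⟨v, hv, ?_, (quot_ae_eq v).trans (diffQuot_congr hv)⟩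
  have : grad v = hg.toLp g := (isWeakGradient_grad v).unique h1
  rw [this]
  exact hg.coeFn_toLp

end W

open W

variable {u : ℕ → W P} {u₀ : W P}

lemma WeaklyConverges.comp (h : WeaklyConverges u u₀) {k : ℕ → ℕ} (hk : StrictMono k) :
    WeaklyConverges (fun n => u (k n)) u₀ := fun l => (h l).comp hk.tendsto_atTop

lemma WeaklyConverges.sub_const (h : WeaklyConverges u u₀) :
    WeaklyConverges (fun n => u n - u₀) 0 := fun l => by
  simpa using (h l).sub_const (l u₀)

lemma WeaklyConverges.tendsto_integral_inner_grad (h : WeaklyConverges u u₀) {G : P.E → P.E}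
    (hG : MemLp G P.pconjE) :
    Tendsto (fun n => ∫ x, inner ℝ (grad (u n) x) (G x)) atTop
      (𝓝 (∫ x, inner ℝ (grad u₀ x) (G x))) :=
  h ((pairingL P.holderConjugate_pconj hG).comp gradL)

/-- Evaluating a mollification at a point is pairing with a fixed compactly supported kernel, which
is continuous on `𝒲_p` through the Sobolev embedding. -/
lemma WeaklyConverges.tendsto_mollify (h : WeaklyConverges u u₀) (j : ℕ) (x : P.E) :
    Tendsto (fun n => mollify j (u n : P.E → ℝ) x) atTop (𝓝 (mollify j (u₀ : P.E → ℝ) x)) := by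
  have hc : Continuous (fun t => moll P j (x - t)) :=
    (contDiff_moll j).continuous.comp (continuous_const.sub continuous_id)
  have hG : MemLp (fun t => moll P j (x - t)) (ENNReal.ofReal (P.pstar / (P.pstar - 1))) :=
    hc.memLp_of_hasCompactSupport ((hasCompactSupport_moll j).comp_homeomorph (Homeomorph.subLeft x))
  have h1 := h ((pairingL P.holderConjugate_pstar hG).comp valL)
  have e : ∀ v : W P, (pairingL P.holderConjugate_pstar hG).comp valL v =
      mollify j (v : P.E → ℝ) x := by
    intro v
    rw [mollify_apply_swap, ContinuousLinearMap.comp_apply, pairingL_apply]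
    rfl
  simpa only [e] using h1

/-- A bounded weakly null sequence tends to zero in measure on balls. -/
lemma WeaklyConverges.tendsto_measure_ball (h : WeaklyConverges u 0) {C : ℝ}
    (hC : ∀ n, ‖u n‖ ≤ C) (R : ℝ) {ε : ℝ} (hε : 0 < ε) :
    Tendsto (fun n => volume (Metric.ball (0 : P.E) R ∩ {x | ε ≤ |u n x|})) atTop (𝓝 0) := by
  have hp := P.p_pos
  have hs := P.s_pos
  obtain ⟨B, hB, hmoll⟩ := exists_lintegral_sub_mollify_rpow_le P
  have hC0 : 0 ≤ C := (norm_nonneg _).trans (hC 0)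
  -- Chebyshev with the mollification rate. The bound does not depend on `n`, because the Gagliardo
  -- seminorms are bounded; this takes the place of a compact embedding.
  have hfirst : ∀ j n, volume {x | ε / 2 ≤ |u n x - mollify j (u n : P.E → ℝ) x|} ≤
      ENNReal.ofReal (B * (1 / ((j : ℝ) + 1)) ^ (P.s * P.p)) * ENNReal.ofReal (C ^ P.p) /
        ENNReal.ofReal ((ε / 2) ^ P.p) := by
    intro j n
    have hsub : {x | ε / 2 ≤ |u n x - mollify j (u n : P.E → ℝ) x|} ⊆
        {x | ENNReal.ofReal ((ε / 2) ^ P.p) ≤ ‖u n x - mollify j (u n : P.E → ℝ) x‖ₑ ^ P.p} := by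
      intro x hx
      simp only [Set.mem_ofPred_eq] at hx ⊢
      rw [← ofReal_norm, ENNReal.ofReal_rpow_of_nonneg (norm_nonneg _) hp.le, Real.norm_eq_abs]
      gcongr
    refine (measure_mono hsub).trans ((meas_ge_le_lintegral_div ?_ ?_ ENNReal.ofReal_ne_top).trans ?_)
    · exact (((W.stronglyMeasurable (u n)).sub (contDiff_mollify j
        (W.locallyIntegrable (u n))).continuous.stronglyMeasurable).enorm.pow_const _).aemeasurable
    · simp only [ne_eq, ENNReal.ofReal_eq_zero, not_le]; positivity
    · gcongr
      refine (hmoll j _ (W.stronglyMeasurable (u n)) (W.locallyIntegrable (u n))).trans ?_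
      gcongr
      rw [W.gagliardoPow_eq]
      gcongr
      · exact gagliardo_nonneg _
      · rw [← norm_quot]; exact (norm_quot_le _).trans (hC n)
  -- At a fixed scale mollifications converge pointwise, hence in measure on the ball, which has
  -- finite measure.
  have hsecond : ∀ j, Tendsto (fun n => volume (Metric.ball (0 : P.E) R ∩
      {x | ε / 2 ≤ |mollify j (u n : P.E → ℝ) x|})) atTop (𝓝 0) := by
    intro j
    have h0 : mollify j ((0 : W P) : P.E → ℝ) = fun _ => 0 := by
      funext x
      rw [mollify_apply_swap]
      refine integral_eq_zero_of_ae ?_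
      have : ((0 : W P) : P.E → ℝ) =ᵐ[volume] 0 := by rw [map_zero]; exact Lp.coeFn_zero ..
      filter_upwards [this] with t ht
      rw [ht]; simp
    have hfin : IsFiniteMeasure ((volume : Measure P.E).restrict (Metric.ball (0 : P.E) R)) :=
      ⟨by rw [Measure.restrict_apply_univ]; exact measure_ball_lt_top⟩
    have hm := tendstoInMeasure_of_tendsto_ae
      (μ := (volume : Measure P.E).restrict (Metric.ball (0 : P.E) R))
      (f := fun n => mollify j (u n : P.E → ℝ)) (g := fun _ => 0)
      (fun n => (contDiff_mollify j (W.locallyIntegrable (u n))).continuous.aestronglyMeasurable)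
      (Eventually.of_forall fun x => by
        have := h.tendsto_mollify j x
        rwa [h0] at this)
    rw [tendstoInMeasure_iff_dist] at hm
    refine (hm (ε / 2) (by positivity)).congr fun n => ?_
    simp only [Real.dist_eq, sub_zero]
    rw [Measure.restrict_apply, Set.inter_comm]
    exact measurableSet_le measurable_const
      (contDiff_mollify j (W.locallyIntegrable (u n))).continuous.abs.measurable
  have hsum : ∀ j n, volume (Metric.ball (0 : P.E) R ∩ {x | ε ≤ |u n x|}) ≤
      volume {x | ε / 2 ≤ |u n x - mollify j (u n : P.E → ℝ) x|} +
        volume (Metric.ball (0 : P.E) R ∩ {x | ε / 2 ≤ |mollify j (u n : P.E → ℝ) x|}) := by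
    intro j n
    refine (measure_mono ?_).trans (measure_union_le _ _)
    rintro x ⟨hxR, hx⟩
    simp only [Set.mem_ofPred_eq] at hx
    by_cases h1 : ε / 2 ≤ |u n x - mollify j (u n : P.E → ℝ) x|
    · exact Or.inl h1
    · refine Or.inr ⟨hxR, ?_⟩
      simp only [Set.mem_ofPred_eq]
      have := abs_sub_abs_le_abs_sub (u n x) (mollify j (u n : P.E → ℝ) x)
      linarith [not_le.1 h1]
  rw [ENNReal.tendsto_nhds_zero]
  intro η hη
  have hj : Tendsto (fun j : ℕ => ENNReal.ofReal (B * (1 / ((j : ℝ) + 1)) ^ (P.s * P.p)) *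
      ENNReal.ofReal (C ^ P.p) / ENNReal.ofReal ((ε / 2) ^ P.p)) atTop (𝓝 0) := by
    have h1 : Tendsto (fun j : ℕ => B * (1 / ((j : ℝ) + 1)) ^ (P.s * P.p)) atTop (𝓝 0) := by
      have := ((tendsto_one_div_add_atTop_nhds_zero_nat (𝕜 := ℝ)).rpow_const
        (p := P.s * P.p) (Or.inr (by positivity))).const_mul B
      rwa [Real.zero_rpow (by positivity), mul_zero] at this
    have h2 := ENNReal.tendsto_ofReal h1
    rw [ENNReal.ofReal_zero] at h2
    have h3 := ENNReal.Tendsto.mul_const h2 (Or.inr (ENNReal.ofReal_ne_top (r := C ^ P.p)))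
    rw [zero_mul] at h3
    have h4 := ENNReal.Tendsto.div_const h3 (b := ENNReal.ofReal ((ε / 2) ^ P.p)) (Or.inr (by
      simp only [ne_eq, ENNReal.ofReal_eq_zero, not_le]; positivity))
    simpa using h4
  obtain ⟨j, hj⟩ := (hj.eventually (ge_mem_nhds (ENNReal.half_pos hη.ne'))).exists
  filter_upwards [(hsecond j).eventually (ge_mem_nhds (ENNReal.half_pos hη.ne'))] with n hn
  calc _ ≤ _ := hsum j n
    _ ≤ η / 2 + η / 2 := add_le_add ((hfirst j n).trans hj) hn
    _ = η := ENNReal.add_halves η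

/-- A bounded weakly convergent sequence has a subsequence converging almost everywhere. -/
lemma WeaklyConverges.exists_subseq_tendsto_ae (h : WeaklyConverges u u₀) {C : ℝ}
    (hC : ∀ n, ‖u n‖ ≤ C) :
    ∃ k : ℕ → ℕ, StrictMono k ∧ ∀ᵐ x, Tendsto (fun n => u (k n) x) atTop (𝓝 (u₀ x)) := by
  refine exists_strictMono_tendsto_ae_of_tendsto_measure_ball (0 : P.E)
    (f := fun n => (u n : P.E → ℝ)) (f₀ := (u₀ : P.E → ℝ)) fun R ε hε => ?_
  have h1 := h.sub_const.tendsto_measure_ball (C := C + ‖u₀‖)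
    (fun n => (norm_sub_le _ _).trans (by gcongr; exact hC n)) R hε
  refine h1.congr fun n => measure_congr ?_
  filter_upwards [W.coe_sub (u n) u₀] with x hx
  refine congrArg (fun t => x ∈ Metric.ball (0 : P.E) R ∧ ε ≤ t) ?_
  rw [hx, Real.dist_eq]

end Functionals

/-! ### The chain rule for weak gradients. -/

section ChainRule

open Params W

variable {P : Params}

/-- Composition with a `C¹` function whose derivative is bounded by one. -/
lemma W.exists_comp {θ θ' : ℝ → ℝ} (hθ : ∀ t, HasDerivAt θ (θ' t) t) (hθ' : Continuous θ')
    (h1 : ∀ t, |θ' t| ≤ 1) (h0 : θ 0 = 0) (u : W P) :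
    ∃ v : W P, (v : P.E → ℝ) =ᵐ[volume] (fun x => θ (u x)) ∧
      (grad v : P.E → P.E) =ᵐ[volume] (fun x => θ' (u x) • grad u x) ∧
      (quot v : P.E × P.E → ℝ) =ᵐ[(volume : Measure P.E).prod volume]
        diffQuot (fun x => θ (u x)) ∧ ‖v‖ ≤ ‖u‖ := by
  have hp := P.p_pos
  have hdiff : Differentiable ℝ θ := fun t => (hθ t).differentiableAt
  have hlip : ∀ a b, |θ a - θ b| ≤ |a - b| := by
    have : LipschitzWith 1 θ := lipschitzWith_of_nnnorm_deriv_le hdiff fun t => by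
      rw [(hθ t).deriv]; exact_mod_cast h1 t
    intro a b
    simpa [Real.dist_eq] using this.dist_le_mul a b
  have hle : ∀ a, |θ a| ≤ |a| := fun a => by simpa [h0] using hlip a 0
  have hθc : Continuous θ := hdiff.continuous
  have hm1 : MemLp (fun x => θ (u x)) P.pstarE :=
    (memLp_coe u).mono (hθc.comp_aestronglyMeasurable (memLp_coe u).1)
      (Eventually.of_forall fun x => hle _)
  have hm2 : MemLp (fun x => θ' (u x) • grad u x) P.pE :=
    (memLp_grad u).mono ((hθ'.comp_aestronglyMeasurable (memLp_coe u).1).smul (memLp_grad u).1)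
      (Eventually.of_forall fun x => by
        rw [norm_smul]; exact mul_le_of_le_one_left (norm_nonneg _) (h1 _))
  have hdq : ∀ z, ‖diffQuot (fun x => θ (u x)) z‖ ≤ ‖diffQuot (u : P.E → ℝ) z‖ := by
    intro z
    simp only [diffQuot, norm_div, Real.norm_eq_abs]
    exact div_le_div_of_nonneg_right (hlip _ _) (abs_nonneg _)
  have hgag : gagliardoPow (fun x => θ (u x)) < ⊤ := by
    rw [← memLp_diffQuot_iff hm1.1]
    exact (memLp_diffQuot u).mono (aestronglyMeasurable_diffQuot hm1.1) (Eventually.of_forall hdq)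
  have hwg : IsWeakGradient (fun x => θ (u x)) (fun x => θ' (u x) • grad u x) := by
    intro ψ hψ hc w
    have hul := locallyIntegrable u
    have hgl := locallyIntegrable_grad u
    have cψ' : Continuous (fun x => fderiv ℝ ψ x w) :=
      (hψ.continuous_fderiv (by simp)).clm_apply continuous_const
    have hcψ' : HasCompactSupport (fun x => fderiv ℝ ψ x w) := hc.fderiv_apply ℝ w
    have hae := tendsto_mollify_ae hul
    have hae' := tendsto_mollify_ae hgl
    have cmu : ∀ n, Continuous (mollify n (u : P.E → ℝ)) := fun n =>
      (contDiff_mollify n hul).continuous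
    have cmg : ∀ n, Continuous (mollify n (grad u : P.E → P.E)) := fun n =>
      (contDiff_mollify n hgl).continuous
    have mmu : ∀ n, MemLp (fun x => θ (mollify n (u : P.E → ℝ) x)) P.pstarE := fun n =>
      (memLp_mollify P.one_lt_pstar n (W.stronglyMeasurable u) (memLp_coe u)).mono
        (hθc.comp (cmu n)).aestronglyMeasurable (Eventually.of_forall fun x => hle _)
    have mmg : ∀ n, MemLp (fun x => θ' (mollify n (u : P.E → ℝ) x) •
        mollify n (grad u : P.E → P.E) x) P.pE := fun n =>
      (memLp_mollify P.one_lt_p n (Lp.stronglyMeasurable _) (memLp_grad u)).mono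
        ((hθ'.comp (cmu n)).smul (cmg n)).aestronglyMeasurable (Eventually.of_forall fun x => by
          rw [norm_smul]; exact mul_le_of_le_one_left (norm_nonneg _) (h1 _))
    -- The identity is classical for `θ` of the mollified function. Both sides are bounded in their
    -- Lebesgue spaces, by `|θ t| ≤ |t|` and `|θ'| ≤ 1`, and converge almost everywhere, hence
    -- weakly.
    have hL := tendsto_integral_inner_of_ae P.holderConjugate_pstar mmu hm1
      (cψ'.memLp_of_hasCompactSupport hcψ') (C := ∫ x, ‖u x‖ ^ P.pstar) (fun n => by
        refine le_trans ?_ (integral_norm_mollify_rpow_le P.one_lt_pstar n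
          (W.stronglyMeasurable u) (memLp_coe u))
        refine integral_mono (integrable_norm_rpow P.pstar_pos (mmu n)) (integrable_norm_rpow
          P.pstar_pos (memLp_mollify P.one_lt_pstar n (W.stronglyMeasurable u) (memLp_coe u)))
          fun x => ?_
        exact Real.rpow_le_rpow (norm_nonneg _) (hle _) P.pstar_pos.le) (by
        filter_upwards [hae] with x hx
        exact (hθc.tendsto _).comp hx)
    have hcψ : Continuous (fun x => ψ x • w) := hψ.continuous.smul continuous_const
    have hR := tendsto_integral_inner_of_ae P.holderConjugate_pconj mmg hm2
      (hcψ.memLp_of_hasCompactSupport hc.smul_right) (C := ∫ x, ‖grad u x‖ ^ P.p) (fun n => by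
        refine le_trans ?_ (integral_norm_mollify_rpow_le P.one_lt_p n
          (Lp.stronglyMeasurable _) (memLp_grad u))
        refine integral_mono (integrable_norm_rpow hp (mmg n)) (integrable_norm_rpow
          hp (memLp_mollify P.one_lt_p n (Lp.stronglyMeasurable _) (memLp_grad u))) fun x => ?_
        refine Real.rpow_le_rpow (norm_nonneg _) ?_ hp.le
        rw [norm_smul]; exact mul_le_of_le_one_left (norm_nonneg _) (h1 _)) (by
        filter_upwards [hae, hae'] with x hx hx'
        exact ((hθ'.tendsto _).comp hx).smul hx')
    have hn : ∀ n, ∫ x, inner ℝ (θ (mollify n (u : P.E → ℝ) x)) (fderiv ℝ ψ x w) =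
        - ∫ x, inner ℝ (θ' (mollify n (u : P.E → ℝ) x) • mollify n (grad u : P.E → P.E) x)
          (ψ x • w) := by
      intro n
      have hfd : ∀ x, HasFDerivAt (fun x => θ (mollify n (u : P.E → ℝ) x))
          (θ' (mollify n (u : P.E → ℝ) x) • innerSL ℝ (mollify n (grad u : P.E → P.E) x)) x :=
        fun x => (hθ _).comp_hasFDerivAt x (hasFDerivAt_mollify n hul hgl (isWeakGradient_grad u) x)
      have e : ∀ x, fderiv ℝ (fun x => θ (mollify n (u : P.E → ℝ) x)) x w * ψ x =
          inner ℝ (θ' (mollify n (u : P.E → ℝ) x) • mollify n (grad u : P.E → P.E) x)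
            (ψ x • w) := by
        intro x
        rw [(hfd x).fderiv, smul_apply, innerSL_apply_apply, real_inner_smul_left,
          real_inner_smul_right, smul_eq_mul]
        ring
      have hibp := integral_mul_fderiv_eq_neg_fderiv_mul_of_integrable (μ := volume)
        (f := fun x => θ (mollify n (u : P.E → ℝ) x)) (g := ψ) (v := w) ?_ ?_ ?_
        (fun x _ => (hfd x).differentiableAt) (fun x _ => hψ.differentiable (by simp) x)
      · simp only [e] at hibp
        rw [← hibp]
        refine integral_congr_ae (Eventually.of_forall fun x => ?_)
        simp [mul_comm]
      · simp only [e]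
        refine Continuous.integrable_of_hasCompactSupport
          (((hθ'.comp (cmu n)).smul (cmg n)).inner hcψ) ?_
        refine hc.mono fun x hx => ?_
        contrapose! hx
        simp only [Function.mem_support, ne_eq, not_not] at hx ⊢
        simp [hx]
      · exact ((hθc.comp (cmu n)).mul cψ').integrable_of_hasCompactSupport hcψ'.mul_left
      · exact ((hθc.comp (cmu n)).mul hψ.continuous).integrable_of_hasCompactSupport hc.mul_left
    simp only [hn] at hL
    have hfin := tendsto_nhds_unique hL hR.neg
    have e1 : ∫ x, θ (u x) * fderiv ℝ ψ x w = ∫ x, inner ℝ (θ (u x)) (fderiv ℝ ψ x w) :=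
      integral_congr_ae (Eventually.of_forall fun x => by simp [mul_comm])
    have e2 : ∫ x, inner ℝ (θ' (u x) • grad u x) w * ψ x =
        ∫ x, inner ℝ (θ' (u x) • grad u x) (ψ x • w) :=
      integral_congr_ae (Eventually.of_forall fun x => by
        simp only [real_inner_smul_right]; ring)
    rw [e1, e2, hfin]
  obtain ⟨v, hv, hvg, hvq⟩ := exists_of_memLp hm1 hm2 hwg hgag
  refine ⟨v, hv, hvg, hvq, ?_⟩
  rw [norm_eq, norm_eq, ← norm_quot, ← norm_quot]
  refine add_le_add (Lp.norm_le_norm_of_ae_le ?_) (Lp.norm_le_norm_of_ae_le ?_)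
  · filter_upwards [hvg] with x hx
    rw [hx, norm_smul]; exact mul_le_of_le_one_left (norm_nonneg _) (h1 _)
  · filter_upwards [hvq, quot_ae_eq u] with z hz hz'
    rw [hz, hz']; exact hdq z

end ChainRule

/-! ### The derivative of the energy. -/

section FirstVariation

open Params W

variable {P : Params}

/-- A Fréchet derivative is determined by derivatives along lines, and those are computed term by
term. -/
lemma energy_hasFDerivAt_apply {f A : W P →L[ℝ] ℝ} {u : W P} (hA : HasFDerivAt (energy f) A u)
    (v : W P) :
    A v = (∫ x, inner ℝ (flux P.p (grad u x)) (grad v x)) +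
      (∫ z, inner ℝ (flux P.p (quot u z)) (quot v z) ∂((volume : Measure P.E).prod volume)) -
      (∫ x, inner ℝ (flux P.pstar (u x)) (v x)) - f v := by
  have hp := P.p_pos
  have hps := P.pstar_pos
  have h1 : HasDerivAt (fun t : ℝ => energy f (u + t • v)) (A v) 0 := by
    have hline : HasDerivAt (fun t : ℝ => u + t • v) v 0 := by
      simpa using ((hasDerivAt_id (0 : ℝ)).smul_const v).const_add u
    have hA' : HasFDerivAt (energy f) A (u + (0 : ℝ) • v) := by simpa using hA
    exact hA'.comp_hasDerivAt 0 hline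
  have d1 := hasDerivAt_Lp_norm_rpow P.one_lt_p (grad u) (grad v)
  have d2 := hasDerivAt_Lp_norm_rpow P.one_lt_p (quot u) (quot v)
  have d3 := hasDerivAt_Lp_norm_rpow P.one_lt_pstar (val u) (val v)
  have d4 : HasDerivAt (fun t : ℝ => f u + t * f v) (f v) 0 := by
    simpa using ((hasDerivAt_id (0 : ℝ)).mul_const (f v)).const_add (f u)
  have h2 := ((((d1.add d2).const_mul (1 / P.p)).sub (d3.const_mul (1 / P.pstar))).sub d4)
  have h3 : HasDerivAt (fun t : ℝ => energy f (u + t • v)) _ 0 :=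
    h2.congr_of_eventuallyEq (Eventually.of_forall fun t => by
      simp only [energy, ← norm_quot, map_add, map_smul, Pi.add_apply, Pi.sub_apply, smul_eq_mul])
  rw [h1.unique h3]
  field_simp

end FirstVariation

/-! ### Multiplication by test functions on `𝒲_p` and compactness of its commutators. -/

section Multiplication

open Params W

variable {P : Params}

lemma lintegral_enorm_rpow_mul_le {u : P.E → ℝ} (hu : AEStronglyMeasurable u) {k : P.E → ℝ≥0∞}
    (hk : Measurable k) :
    ∫⁻ x, ‖u x‖ₑ ^ P.p * k x ≤ (∫⁻ x, ‖u x‖ₑ ^ P.pstar) ^ (P.p / P.pstar) *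
      (∫⁻ x, k x ^ (P.N / P.p)) ^ (P.p / P.N) := by
  have hp := P.p_pos
  have h := ENNReal.lintegral_mul_le_Lp_mul_Lq volume (holderConjugate_N_div_p P).symm
    (f := fun x => ‖u x‖ₑ ^ P.p) (hu.enorm.pow_const _) hk.aemeasurable
  simp only [Pi.mul_apply, ← ENNReal.rpow_mul, mul_div_cancel₀ _ hp.ne', one_div_div] at h
  exact h

/-- Sequences that are bounded in `L^{p*}` and tend to zero almost everywhere tend to zero in `Lᵖ`
with respect to weights in `L^{N/p}`. -/
lemma tendsto_lintegral_enorm_rpow_mul {u : ℕ → P.E → ℝ} (hu : ∀ n, MemLp (u n) P.pstarE)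
    {C : ℝ} (hC : ∀ n, ∫ x, ‖u n x‖ ^ P.pstar ≤ C)
    (hae : ∀ᵐ x, Tendsto (fun n => u n x) atTop (𝓝 0)) {k : P.E → ℝ≥0∞}
    (hk : Measurable k) (hkN : ∫⁻ x, k x ^ (P.N / P.p) ≠ ⊤) :
    Tendsto (fun n => ∫⁻ x, ‖u n x‖ₑ ^ P.p * k x) atTop (𝓝 0) := by
  have hp := P.p_pos
  refine tendsto_lintegral_mul_zero (holderConjugate_N_div_p P).symm
    (fun n => (hu n).1.enorm.pow_const _) hk.aemeasurable (C := ENNReal.ofReal C)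
    ENNReal.ofReal_ne_top (fun n => ?_) hkN ?_
  · simp only [← ENNReal.rpow_mul, mul_div_cancel₀ _ hp.ne']
    rw [lintegral_enorm_rpow P.pstar_pos (hu n)]
    exact ENNReal.ofReal_le_ofReal (hC n)
  · filter_upwards [hae] with x hx
    have := hx.enorm.ennrpow_const P.p
    simpa [hp] using this

/-- The off-diagonal term in the product rule for difference quotients. -/
def crossTerm (φ u : P.E → ℝ) (z : P.E × P.E) : ℝ := u z.2 * diffQuot φ z

lemma diffQuot_mul (φ u : P.E → ℝ) (z : P.E × P.E) :
    diffQuot (fun x => φ x * u x) z = φ z.1 * diffQuot u z + crossTerm φ u z := by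
  simp only [diffQuot, crossTerm]; ring

lemma measurable_diffQuot {φ : P.E → ℝ} (hφ : Measurable φ) : Measurable (diffQuot φ) := by
  unfold diffQuot
  fun_prop

lemma aestronglyMeasurable_crossTerm {φ u : P.E → ℝ} (hφ : Measurable φ)
    (hu : AEStronglyMeasurable u) :
    AEStronglyMeasurable (crossTerm φ u) ((volume : Measure P.E).prod volume) :=
  hu.comp_snd.mul (measurable_diffQuot hφ).aestronglyMeasurable

/-- Integrating out the variable on which `u` does not depend turns the nonlocal commutator into a
weight on `|u|ᵖ`, in complete analogy with `|∇φ|ᵖ` for the local one. -/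
lemma lintegral_crossTerm {φ u : P.E → ℝ} (hφ : Measurable φ) (hu : AEStronglyMeasurable u) :
    ∫⁻ z, ‖crossTerm φ u z‖ₑ ^ P.p ∂((volume : Measure P.E).prod volume) =
      ∫⁻ y, ‖u y‖ₑ ^ P.p * fracDerivPow φ y := by
  have hp := P.p_pos
  rw [lintegral_prod_symm _ ((aestronglyMeasurable_crossTerm hφ hu).enorm.pow_const _)]
  refine lintegral_congr fun y => ?_
  rw [fracDerivPow_eq_lintegral_diffQuot, ← lintegral_const_mul _ (by
    exact ((measurable_diffQuot hφ).comp (measurable_const.prodMk measurable_id)).enorm.pow_const _)]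
  refine lintegral_congr fun x => ?_
  rw [crossTerm, enorm_mul, ENNReal.mul_rpow_of_nonneg _ _ hp.le, enorm_diffQuot_rpow,
    enorm_diffQuot_rpow, abs_sub_comm, norm_sub_rev]

variable {φ : P.E → ℝ}

/-- The fractional derivative of a test function is bounded and integrable, and `N / p > 1`, so
interpolation gives the required power. -/
lemma lintegral_fracDerivPow_rpow_ne_top (hφ : ContDiff ℝ ∞ φ) (hc : HasCompactSupport φ) :
    ∫⁻ x, fracDerivPow φ x ^ (P.N / P.p) ≠ ⊤ := by
  have hp := P.p_pos
  obtain ⟨C, hC, hle⟩ := exists_fracDerivPow_le hφ hc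
  have h1 : 0 ≤ P.N / P.p - 1 := by
    have := (holderConjugate_N_div_p P).lt; linarith
  refine ne_top_of_le_ne_top (b := C ^ (P.N / P.p - 1) * gagliardoPow φ) ?_ ?_
  · exact ENNReal.mul_ne_top (ENNReal.rpow_ne_top_of_nonneg h1 hC)
      (gagliardoPow_lt_top_of_contDiff hφ hc).ne
  · rw [← lintegral_fracDerivPow, ← lintegral_const_mul' _ _ (ENNReal.rpow_ne_top_of_nonneg h1 hC)]
    refine lintegral_mono fun x => ?_
    calc fracDerivPow φ x ^ (P.N / P.p) = fracDerivPow φ x ^ (P.N / P.p - 1) * fracDerivPow φ x := by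
          conv_rhs => rw [← ENNReal.rpow_one (fracDerivPow φ x)]
          rw [← ENNReal.rpow_mul, one_mul, ← ENNReal.rpow_add_of_nonneg _ _ h1 zero_le_one]
          ring_nf
      _ ≤ _ := by gcongr; exact hle x

lemma lintegral_gradient_rpow_ne_top (hφ : ContDiff ℝ ∞ φ) (hc : HasCompactSupport φ) :
    ∫⁻ x, (‖gradient φ x‖ₑ ^ P.p) ^ (P.N / P.p) ≠ ⊤ := by
  have hp := P.p_pos
  have hN : (0 : ℝ) < P.N := by exact_mod_cast P.N_pos
  simp only [← ENNReal.rpow_mul, mul_div_cancel₀ _ hp.ne']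
  have hcs : HasCompactSupport (gradient φ) := by
    refine (hc.fderiv ℝ).mono fun x hx => ?_
    contrapose! hx
    simp only [Function.mem_support, ne_eq, not_not] at hx ⊢
    rw [← norm_eq_zero, norm_gradient, hx, norm_zero]
  rw [lintegral_enorm_rpow hN ((continuous_gradient hφ).memLp_of_hasCompactSupport hcs)]
  exact ENNReal.ofReal_ne_top

lemma measurable_enorm_gradient_rpow (hφ : ContDiff ℝ ∞ φ) :
    Measurable fun x => ‖gradient φ x‖ₑ ^ P.p :=
  (continuous_gradient hφ).enorm.measurable.pow_const _

lemma enorm_smul_gradient_rpow (u : P.E → ℝ) (x : P.E) :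
    ‖u x • gradient φ x‖ₑ ^ P.p = ‖u x‖ₑ ^ P.p * ‖gradient φ x‖ₑ ^ P.p := by
  rw [enorm_smul, ENNReal.mul_rpow_of_nonneg _ _ P.p_pos.le]

/-- Common to the local commutator `u ∇φ` and the nonlocal one: an operator whose `Lᵖ` norm is a
weighted norm of `u` with weight in `L^{N/p}` is bounded on `L^{p*}`. -/
lemma exists_eLpNorm_le_of_lintegral_eq {α : Type*} [MeasurableSpace α] {m : Measure α}
    {G : Type*} [NormedAddCommGroup G] {k : P.E → ℝ≥0∞} (hk : Measurable k)
    (hkN : ∫⁻ x, k x ^ (P.N / P.p) ≠ ⊤) {T : (P.E → ℝ) → α → G}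
    (hT : ∀ u : P.E → ℝ, AEStronglyMeasurable u →
      ∫⁻ z, ‖T u z‖ₑ ^ P.p ∂m = ∫⁻ x, ‖u x‖ₑ ^ P.p * k x) :
    ∃ K : NNReal, ∀ u : P.E → ℝ, AEStronglyMeasurable u →
      eLpNorm (T u) P.pE m ≤ K * eLpNorm u P.pstarE := by
  have hp := P.p_pos
  have hps := P.pstar_pos
  have hN : (0 : ℝ) < P.N := by exact_mod_cast P.N_pos
  have hfin : (∫⁻ x, k x ^ (P.N / P.p)) ^ (1 / P.N : ℝ) ≠ ⊤ :=
    ENNReal.rpow_ne_top_of_nonneg (by positivity) hkN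
  refine ⟨((∫⁻ x, k x ^ (P.N / P.p)) ^ (1 / P.N : ℝ)).toNNReal, fun u hu => ?_⟩
  rw [ENNReal.coe_toNNReal hfin, eLpNorm_eq_lintegral_rpow_enorm_toReal P.pE_ne_zero
    ENNReal.ofReal_ne_top, eLpNorm_eq_lintegral_rpow_enorm_toReal P.pstarE_ne_zero
    ENNReal.ofReal_ne_top, ENNReal.toReal_ofReal hp.le, ENNReal.toReal_ofReal hps.le, hT u hu]
  refine (ENNReal.rpow_le_rpow (lintegral_enorm_rpow_mul_le hu hk) (by positivity)).trans ?_
  rw [ENNReal.mul_rpow_of_nonneg _ _ (by positivity), ← ENNReal.rpow_mul, ← ENNReal.rpow_mul,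
    mul_comm]
  refine le_of_eq ?_
  congr 2 <;> field_simp

variable (φ) in
lemma exists_eLpNorm_smul_gradient_le (hφ : ContDiff ℝ ∞ φ) (hc : HasCompactSupport φ) :
    ∃ K : NNReal, ∀ u : P.E → ℝ, AEStronglyMeasurable u →
      eLpNorm (fun x => u x • gradient φ x) P.pE ≤ K * eLpNorm u P.pstarE :=
  exists_eLpNorm_le_of_lintegral_eq (T := fun u x => u x • gradient φ x)
    (measurable_enorm_gradient_rpow hφ) (lintegral_gradient_rpow_ne_top hφ hc)
    fun u _ => by simp only [enorm_smul_gradient_rpow]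

variable (φ) in
lemma exists_eLpNorm_crossTerm_le (hφ : ContDiff ℝ ∞ φ) (hc : HasCompactSupport φ) :
    ∃ K : NNReal, ∀ u : P.E → ℝ, AEStronglyMeasurable u →
      eLpNorm (crossTerm φ u) P.pE ((volume : Measure P.E).prod volume) ≤
        K * eLpNorm u P.pstarE :=
  exists_eLpNorm_le_of_lintegral_eq (T := crossTerm φ)
    (measurable_fracDerivPow hφ.continuous.measurable) (lintegral_fracDerivPow_rpow_ne_top hφ hc)
    fun _ hu => lintegral_crossTerm hφ.continuous.measurable hu

lemma memLp_smul_gradient (hφ : ContDiff ℝ ∞ φ) (hc : HasCompactSupport φ) (u : W P) :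
    MemLp (fun x => u x • gradient φ x) P.pE := by
  obtain ⟨K, hK⟩ := exists_eLpNorm_smul_gradient_le φ hφ hc
  exact ⟨(memLp_coe u).1.smul (continuous_gradient hφ).aestronglyMeasurable,
    (hK _ (memLp_coe u).1).trans_lt (ENNReal.mul_lt_top ENNReal.coe_lt_top (memLp_coe u).2)⟩

lemma memLp_crossTerm (hφ : ContDiff ℝ ∞ φ) (hc : HasCompactSupport φ) (u : W P) :
    MemLp (crossTerm φ u) P.pE ((volume : Measure P.E).prod volume) := by
  obtain ⟨K, hK⟩ := exists_eLpNorm_crossTerm_le φ hφ hc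
  exact ⟨aestronglyMeasurable_crossTerm hφ.continuous.measurable (memLp_coe u).1,
    (hK _ (memLp_coe u).1).trans_lt (ENNReal.mul_lt_top ENNReal.coe_lt_top (memLp_coe u).2)⟩

lemma memLp_smooth_smul {α : Type*} [MeasurableSpace α] {m : Measure α} {G : Type*}
    [NormedAddCommGroup G] [NormedSpace ℝ G] {q : ℝ≥0∞} {g : α → G} (hg : MemLp g q m) {η : α → ℝ}
    (hη : AEStronglyMeasurable η m) {B : ℝ} (hB : ∀ x, |η x| ≤ B) :
    MemLp (fun x => η x • g x) q m :=
  hg.of_le_mul (c := B) (hη.smul hg.1) (Eventually.of_forall fun x => by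
    rw [norm_smul]; exact mul_le_mul_of_nonneg_right (hB x) (norm_nonneg _))

lemma eLpNorm_smooth_smul_le {α : Type*} [MeasurableSpace α] {m : Measure α} {G : Type*}
    [NormedAddCommGroup G] [NormedSpace ℝ G] {q : ℝ≥0∞} (g : α → G) {η : α → ℝ} {B : ℝ}
    (hB : ∀ x, |η x| ≤ B) : eLpNorm (fun x => η x • g x) q m ≤ ENNReal.ofReal B * eLpNorm g q m :=
  eLpNorm_le_mul_eLpNorm_of_ae_le_mul (Eventually.of_forall fun x => by
    rw [norm_smul]; exact mul_le_mul_of_nonneg_right (hB x) (norm_nonneg _)) q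

lemma exists_abs_le (hφ : ContDiff ℝ ∞ φ) (hc : HasCompactSupport φ) :
    ∃ B : ℝ, 0 ≤ B ∧ ∀ x, |φ x| ≤ B := by
  obtain ⟨B, hB⟩ := hc.exists_bound_of_continuous hφ.continuous
  exact ⟨B, (norm_nonneg _).trans (hB 0), hB⟩

/-- Multiplication by a test function preserves `𝒲_p`. -/
lemma W.exists_mul (hφ : ContDiff ℝ ∞ φ) (hc : HasCompactSupport φ) (u : W P) :
    ∃ v : W P, (v : P.E → ℝ) =ᵐ[volume] (fun x => φ x * u x) ∧
      (grad v : P.E → P.E) =ᵐ[volume] (fun x => φ x • grad u x + u x • gradient φ x) ∧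
      (quot v : P.E × P.E → ℝ) =ᵐ[(volume : Measure P.E).prod volume]
        (fun z => φ z.1 * quot u z + crossTerm φ u z) := by
  obtain ⟨B, -, hB⟩ := exists_abs_le hφ hc
  have hm := memLp_smooth_smul (memLp_coe u) hφ.continuous.aestronglyMeasurable hB
  have hB' : ∀ z : P.E × P.E, |φ z.1| ≤ B := fun z => hB z.1
  have hq : MemLp (diffQuot (fun x => φ x * u x)) P.pE ((volume : Measure P.E).prod volume) := by
    have := (memLp_smooth_smul (memLp_diffQuot u)
      (hφ.continuous.comp continuous_fst).aestronglyMeasurable hB').add (memLp_crossTerm hφ hc u)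
    refine (memLp_congr_ae (Eventually.of_forall fun z => ?_)).2 this
    exact diffQuot_mul _ _ z
  obtain ⟨v, h1, h2, h3⟩ := exists_of_memLp hm
    ((memLp_smooth_smul (memLp_grad u) hφ.continuous.aestronglyMeasurable hB).add
      (memLp_smul_gradient hφ hc u))
    ((isWeakGradient_grad u).smooth_mul (locallyIntegrable u) (locallyIntegrable_grad u) hφ)
    ((memLp_diffQuot_iff hm.1).1 hq)
  refine ⟨v, h1, h2, ?_⟩
  filter_upwards [h3, quot_ae_eq u] with z hz hz'
  rw [hz, hz']
  exact diffQuot_mul _ _ z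

lemma W.coe_add (u v : W P) : (↑(u + v) : P.E → ℝ) =ᵐ[volume] fun x => u x + v x := by
  rw [map_add]
  exact Lp.coeFn_add _ _

lemma W.coe_smul (c : ℝ) (u : W P) : (↑(c • u) : P.E → ℝ) =ᵐ[volume] fun x => c * u x := by
  rw [map_smul]
  exact Lp.coeFn_smul _ _

lemma W.ext_ae {u v : W P} (h : (u : P.E → ℝ) =ᵐ[volume] v) : u = v := val_injective (Lp.ext h)

/-- Multiplication by a test function, as a linear map. -/
def W.mul (hφ : ContDiff ℝ ∞ φ) (hc : HasCompactSupport φ) : W P →ₗ[ℝ] W P where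
  toFun u := (exists_mul hφ hc u).choose
  -- An element of `𝒲_p` is determined by its underlying function almost everywhere, so the choice
  -- in `toFun` is harmless.
  map_add' u v := W.ext_ae <| by
    filter_upwards [(exists_mul hφ hc (u + v)).choose_spec.1, (exists_mul hφ hc u).choose_spec.1,
      (exists_mul hφ hc v).choose_spec.1, W.coe_add (exists_mul hφ hc u).choose
      (exists_mul hφ hc v).choose, W.coe_add u v] with x h1 h2 h3 h4 h5
    rw [h1, h4, h2, h3, h5, mul_add]
  map_smul' c u := W.ext_ae <| by
    filter_upwards [(exists_mul hφ hc (c • u)).choose_spec.1, (exists_mul hφ hc u).choose_spec.1,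
      W.coe_smul c (exists_mul hφ hc u).choose, W.coe_smul c u] with x h1 h2 h3 h4
    rw [RingHom.id_apply, h1, h3, h2, h4]
    ring

lemma W.coe_mul (hφ : ContDiff ℝ ∞ φ) (hc : HasCompactSupport φ) (u : W P) :
    (W.mul hφ hc u : P.E → ℝ) =ᵐ[volume] fun x => φ x * u x := (exists_mul hφ hc u).choose_spec.1

lemma W.grad_mul (hφ : ContDiff ℝ ∞ φ) (hc : HasCompactSupport φ) (u : W P) :
    (grad (W.mul hφ hc u) : P.E → P.E) =ᵐ[volume]
      fun x => φ x • grad u x + u x • gradient φ x := (exists_mul hφ hc u).choose_spec.2.1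

lemma W.quot_mul (hφ : ContDiff ℝ ∞ φ) (hc : HasCompactSupport φ) (u : W P) :
    (quot (W.mul hφ hc u) : P.E × P.E → ℝ) =ᵐ[(volume : Measure P.E).prod volume]
      fun z => φ z.1 * quot u z + crossTerm φ u z := (exists_mul hφ hc u).choose_spec.2.2

lemma norm_Lp_le_of_ae_eq_add {α : Type*} [MeasurableSpace α] {m : Measure α} {G : Type*}
    [NormedAddCommGroup G] [NormedSpace ℝ G] (w g : Lp G P.pE m) {η : α → ℝ}
    (hη : AEStronglyMeasurable η m) {B : ℝ} (hB0 : 0 ≤ B) (hB : ∀ x, |η x| ≤ B) {r : α → G}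
    (hr : AEStronglyMeasurable r m) (h : w =ᵐ[m] fun x => η x • g x + r x) {K : NNReal} {u : W P}
    (hrK : eLpNorm r P.pE m ≤ K * eLpNorm (u : P.E → ℝ) P.pstarE) :
    ‖w‖ ≤ B * ‖g‖ + K * ‖val u‖ := by
  rw [Lp.norm_def, eLpNorm_congr_ae h, Lp.norm_def g, Lp.norm_def (val u)]
  have h1 : eLpNorm (fun x => η x • g x + r x) P.pE m ≤
      ENNReal.ofReal B * eLpNorm g P.pE m + K * eLpNorm (u : P.E → ℝ) P.pstarE :=
    (eLpNorm_add_le (hη.smul (Lp.aestronglyMeasurable g)) hr Fact.out).trans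
      (add_le_add (eLpNorm_smooth_smul_le _ hB) hrK)
  have f1 : ENNReal.ofReal B * eLpNorm g P.pE m ≠ ⊤ :=
    ENNReal.mul_ne_top ENNReal.ofReal_ne_top (Lp.eLpNorm_ne_top _)
  have f2 : K * eLpNorm (u : P.E → ℝ) P.pstarE ≠ ⊤ :=
    ENNReal.mul_ne_top ENNReal.coe_ne_top (Lp.eLpNorm_ne_top _)
  have h2 := ENNReal.toReal_mono (ENNReal.add_ne_top.2 ⟨f1, f2⟩) h1
  rwa [ENNReal.toReal_add f1 f2, ENNReal.toReal_mul, ENNReal.toReal_mul, ENNReal.toReal_ofReal hB0,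
    ENNReal.coe_toReal] at h2

lemma W.exists_norm_mul_le (hφ : ContDiff ℝ ∞ φ) (hc : HasCompactSupport φ) :
    ∃ C : ℝ, ∀ u : W P, ‖W.mul hφ hc u‖ ≤ C * ‖u‖ := by
  obtain ⟨B, hB0, hB⟩ := exists_abs_le hφ hc
  obtain ⟨K₁, hK₁⟩ := exists_eLpNorm_smul_gradient_le φ hφ hc
  obtain ⟨K₂, hK₂⟩ := exists_eLpNorm_crossTerm_le φ hφ hc
  obtain ⟨S, hS0, hS⟩ := exists_norm_val_le P
  refine ⟨B + (K₁ + K₂) * S, fun u => ?_⟩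
  have h1 := norm_Lp_le_of_ae_eq_add (grad (W.mul hφ hc u)) (grad u)
    hφ.continuous.aestronglyMeasurable hB0 hB (memLp_smul_gradient hφ hc u).1 (W.grad_mul hφ hc u)
    (hK₁ _ (memLp_coe u).1)
  have h2 := norm_Lp_le_of_ae_eq_add (quot (W.mul hφ hc u)) (quot u) (η := fun z => φ z.1)
    (hφ.continuous.comp continuous_fst).aestronglyMeasurable hB0 (fun z => hB z.1)
    (memLp_crossTerm hφ hc u).1 (W.quot_mul hφ hc u) (hK₂ _ (memLp_coe u).1)
  have h3 : ‖val u‖ ≤ S * ‖u‖ := (hS u).trans (by gcongr; exact norm_grad_le u)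
  rw [norm_eq, ← norm_quot]
  calc _ ≤ (B * ‖grad u‖ + K₁ * ‖val u‖) + (B * ‖quot u‖ + K₂ * ‖val u‖) := add_le_add h1 h2
    _ = B * ‖u‖ + (K₁ + K₂) * ‖val u‖ := by rw [norm_eq, ← norm_quot]; ring
    _ ≤ B * ‖u‖ + (K₁ + K₂) * (S * ‖u‖) := by gcongr
    _ = _ := by ring

/-- Multiplication by a test function, as a continuous linear map. -/
def W.mulL (hφ : ContDiff ℝ ∞ φ) (hc : HasCompactSupport φ) : W P →L[ℝ] W P :=
  (W.mul hφ hc).mkContinuous _ (W.exists_norm_mul_le hφ hc).choose_spec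

lemma tendsto_integral_norm_rpow_zero {α : Type*} [MeasurableSpace α] {m : Measure α} {G : Type*}
    [NormedAddCommGroup G] {r : ℝ} (hr : 0 < r) {f : ℕ → α → G}
    (hf : ∀ n, MemLp (f n) (ENNReal.ofReal r) m)
    (h : Tendsto (fun n => ∫⁻ x, ‖f n x‖ₑ ^ r ∂m) atTop (𝓝 0)) :
    Tendsto (fun n => ∫ x, ‖f n x‖ ^ r ∂m) atTop (𝓝 0) := by
  simp only [fun n => lintegral_enorm_rpow hr (hf n)] at h
  have := (ENNReal.tendsto_toReal ENNReal.zero_ne_top).comp h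
  refine this.congr fun n => ?_
  rw [Function.comp_apply, ENNReal.toReal_ofReal
    (integral_nonneg fun x => Real.rpow_nonneg (norm_nonneg _) _)]

lemma exists_integral_val_rpow_le {w : ℕ → W P} {C : ℝ} (hC : ∀ n, ‖w n‖ ≤ C) :
    ∃ K : ℝ, ∀ n, ∫ x, ‖w n x‖ ^ P.pstar ≤ K := by
  obtain ⟨S, hS0, hS⟩ := exists_norm_val_le P
  refine ⟨(S * C) ^ P.pstar, fun n => ?_⟩
  rw [← Lp_norm_rpow P.pstar_pos (val (w n))]
  refine Real.rpow_le_rpow (norm_nonneg _) ((hS _).trans ?_) P.pstar_pos.le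
  gcongr
  exact (norm_grad_le _).trans (hC n)

lemma integral_grad_rpow_le {w : ℕ → W P} {C : ℝ} (hC : ∀ n, ‖w n‖ ≤ C) (n : ℕ) :
    ∫ x, ‖grad (w n) x‖ ^ P.p ≤ C ^ P.p := by
  rw [← Lp_norm_rpow P.p_pos]
  exact Real.rpow_le_rpow (norm_nonneg _) ((norm_grad_le _).trans (hC n)) P.p_pos.le

lemma integral_quot_rpow_le {w : ℕ → W P} {C : ℝ} (hC : ∀ n, ‖w n‖ ≤ C) (n : ℕ) :
    ∫ z, ‖quot (w n) z‖ ^ P.p ∂((volume : Measure P.E).prod volume) ≤ C ^ P.p := by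
  rw [← Lp_norm_rpow P.p_pos]
  exact Real.rpow_le_rpow (norm_nonneg _) ((norm_quot_le _).trans (hC n)) P.p_pos.le

variable {w : ℕ → W P} {C : ℝ}

/-- The local commutator becomes small in norm along bounded sequences that tend to zero almost
everywhere, even though `∇w_n` need not. `tendsto_integral_crossTerm` is the nonlocal counterpart.
-/
lemma tendsto_integral_smul_gradient (hφ : ContDiff ℝ ∞ φ) (hc : HasCompactSupport φ)
    (hC : ∀ n, ‖w n‖ ≤ C) (hae : ∀ᵐ x, Tendsto (fun n => w n x) atTop (𝓝 0)) :
    Tendsto (fun n => ∫ x, ‖w n x • gradient φ x‖ ^ P.p) atTop (𝓝 0) := by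
  obtain ⟨K, hK⟩ := exists_integral_val_rpow_le hC
  refine tendsto_integral_norm_rpow_zero P.p_pos (fun n => memLp_smul_gradient hφ hc (w n)) ?_
  simp only [enorm_smul_gradient_rpow]
  exact tendsto_lintegral_enorm_rpow_mul (fun n => memLp_coe (w n)) hK hae
    (measurable_enorm_gradient_rpow hφ) (lintegral_gradient_rpow_ne_top hφ hc)

lemma tendsto_integral_crossTerm (hφ : ContDiff ℝ ∞ φ) (hc : HasCompactSupport φ)
    (hC : ∀ n, ‖w n‖ ≤ C) (hae : ∀ᵐ x, Tendsto (fun n => w n x) atTop (𝓝 0)) :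
    Tendsto (fun n => ∫ z, ‖crossTerm φ (w n) z‖ ^ P.p ∂((volume : Measure P.E).prod volume))
      atTop (𝓝 0) := by
  obtain ⟨K, hK⟩ := exists_integral_val_rpow_le hC
  refine tendsto_integral_norm_rpow_zero P.p_pos (fun n => memLp_crossTerm hφ hc (w n)) ?_
  simp only [fun n => lintegral_crossTerm hφ.continuous.measurable (memLp_coe (w n)).1]
  exact tendsto_lintegral_enorm_rpow_mul (fun n => memLp_coe (w n)) hK hae
    (measurable_fracDerivPow hφ.continuous.measurable) (lintegral_fracDerivPow_rpow_ne_top hφ hc)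

end Multiplication

/-! ### Passing to the limit in the lower order and linear terms. -/

section Testing

open Params W

variable {P : Params} {u v : ℕ → W P} {u₀ : W P} {C : ℝ}

lemma integral_flux_sub_rpow_le {α H : Type*} [MeasurableSpace α] {m : Measure α}
    [NormedAddCommGroup H] [InnerProductSpace ℝ H] {p q : ℝ} (hpq : p.HolderConjugate q)
    {f f₀ : α → H} (hf : MemLp f (ENNReal.ofReal p) m) (hf₀ : MemLp f₀ (ENNReal.ofReal p) m) :
    ∫ x, ‖flux p (f x) - flux p (f₀ x)‖ ^ q ∂m ≤
      2 ^ q * (∫ x, ‖f x‖ ^ p ∂m + ∫ x, ‖f₀ x‖ ^ p ∂m) := by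
  have := integral_norm_sub_rpow_le hpq.symm.pos (memLp_flux hpq hf) (memLp_flux hpq hf₀)
  simpa only [norm_flux_rpow hpq] using this

/-- The nonlocal flux depends only on values of the function, so its almost everywhere convergence
comes for free. Gradients are the only quantity for which it must be proved. -/
lemma W.tendsto_quot_ae {g : P.E → ℝ} (h : ∀ᵐ x, Tendsto (fun n => u n x) atTop (𝓝 (g x))) :
    ∀ᵐ z ∂((volume : Measure P.E).prod volume),
      Tendsto (fun n => quot (u n) z) atTop (𝓝 (diffQuot g z)) := by
  have h1 := (Measure.quasiMeasurePreserving_fst (μ := (volume : Measure P.E))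
    (ν := (volume : Measure P.E))).ae h
  have h2 := (Measure.quasiMeasurePreserving_snd (μ := (volume : Measure P.E))
    (ν := (volume : Measure P.E))).ae h
  filter_upwards [h1, h2, ae_all_iff.2 fun n => quot_ae_eq (u n)] with z h1 h2 h3
  simp only [h3, diffQuot]
  exact (h1.sub h2).div_const _

lemma tendsto_integral_inner_quot_zero (hC : ∀ n, ‖v n‖ ≤ C)
    (hae : ∀ᵐ x, Tendsto (fun n => v n x) atTop (𝓝 0)) {G : P.E × P.E → ℝ}
    (hG : MemLp G P.pconjE ((volume : Measure P.E).prod volume)) :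
    Tendsto (fun n => ∫ z, inner ℝ (G z) (quot (v n) z) ∂((volume : Measure P.E).prod volume))
      atTop (𝓝 0) := by
  have h := tendsto_integral_inner_of_ae P.holderConjugate_pconj (fun n => memLp_quot (v n))
    (f₀ := fun _ => 0) MemLp.zero hG (fun n => integral_quot_rpow_le hC n) (by
      filter_upwards [tendsto_quot_ae (g := fun _ => 0) hae] with z hz
      simpa [diffQuot] using hz)
  simpa only [inner_zero_left, integral_zero, real_inner_comm] using h

lemma tendsto_integral_inner_val_zero (hC : ∀ n, ‖v n‖ ≤ C)
    (hae : ∀ᵐ x, Tendsto (fun n => v n x) atTop (𝓝 0)) {G : P.E → ℝ}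
    (hG : MemLp G (ENNReal.ofReal (P.pstar / (P.pstar - 1)))) :
    Tendsto (fun n => ∫ x, inner ℝ (G x) (v n x)) atTop (𝓝 0) := by
  obtain ⟨K, hK⟩ := exists_integral_val_rpow_le hC
  have h := tendsto_integral_inner_of_ae P.holderConjugate_pstar (fun n => memLp_coe (v n))
    (f₀ := fun _ => 0) MemLp.zero hG hK hae
  simpa only [inner_zero_left, integral_zero, real_inner_comm] using h

/-- Along a Palais–Smale sequence, the functional `f` is a limit in norm of functionals that are
given by integration. -/
lemma tendsto_functional_zero {f : W P →L[ℝ] ℝ} {A : ℕ → W P →L[ℝ] ℝ}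
    (hA : ∀ n, HasFDerivAt (energy f) (A n) (u n)) (hA0 : Tendsto A atTop (𝓝 0))
    (hC : ∀ n, ‖v n‖ ≤ C) (hae : ∀ᵐ x, Tendsto (fun n => v n x) atTop (𝓝 0))
    (hgrad : ∀ G : P.E → P.E, MemLp G P.pconjE →
      Tendsto (fun n => ∫ x, inner ℝ (G x) (grad (v n) x)) atTop (𝓝 0)) :
    Tendsto (fun n => f (v n)) atTop (𝓝 0) := by
  have hC0 : 0 ≤ C := (norm_nonneg _).trans (hC 0)
  rw [Metric.tendsto_nhds]
  intro ε hε
  have h1 : Tendsto (fun m => ‖A m‖ * C) atTop (𝓝 0) := by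
    simpa using hA0.norm.mul_const C
  -- Freeze the index `m`: up to the error `‖A m‖ C < ε / 2`, the functional `f` is then a sum of
  -- pairings with fixed functions built from `u m`, and these vanish along `v`. Weak convergence of
  -- `v` in `𝒲_p` is thereby avoided.
  obtain ⟨m, hm⟩ := (h1.eventually (gt_mem_nhds (half_pos hε))).exists
  have h2 := ((hgrad _ (memLp_flux P.holderConjugate_pconj (memLp_grad (u m)))).add
    (tendsto_integral_inner_quot_zero hC hae
      (memLp_flux P.holderConjugate_pconj (memLp_quot (u m))))).sub
    (tendsto_integral_inner_val_zero hC hae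
      (memLp_flux P.holderConjugate_pstar (memLp_coe (u m))))
  rw [add_zero, sub_zero] at h2
  filter_upwards [(Metric.tendsto_nhds.1 h2) (ε / 2) (half_pos hε)] with n hn
  rw [Real.dist_eq, sub_zero] at hn ⊢
  have h3 := energy_hasFDerivAt_apply (hA m) (v n)
  have h4 : |A m (v n)| ≤ ‖A m‖ * C :=
    ((A m).le_opNorm (v n)).trans (mul_le_mul_of_nonneg_left (hC n) (norm_nonneg _))
  rw [abs_lt] at hn ⊢
  rw [abs_le] at h4
  constructor <;> linarith

lemma tendsto_apply_zero {A : ℕ → W P →L[ℝ] ℝ} (hA0 : Tendsto A atTop (𝓝 0))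
    (hC : ∀ n, ‖v n‖ ≤ C) : Tendsto (fun n => A n (v n)) atTop (𝓝 0) := by
  refine squeeze_zero_norm (a := fun n => ‖A n‖ * C) (fun n => ?_) ?_
  · exact ((A n).le_opNorm (v n)).trans (mul_le_mul_of_nonneg_left (hC n) (norm_nonneg _))
  · simpa using hA0.norm.mul_const C

end Testing

/-! ### A smooth truncation. -/

section Truncation

open Params W

/-- `C¹` truncations at height `2k` whose derivative is at least `1/2` on `[-k, k]`. -/
lemma exists_truncation {k : ℝ} (hk : 0 < k) : ∃ θ θ' : ℝ → ℝ, (∀ t, HasDerivAt θ (θ' t) t) ∧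
    Continuous θ' ∧ (∀ t, 0 ≤ θ' t ∧ θ' t ≤ 1) ∧ θ 0 = 0 ∧ θ' 0 = 1 ∧ (∀ t, |θ t| ≤ 2 * k) ∧
    ∀ t, |t| < k → 1 / 2 ≤ θ' t := by
  have hpos : ∀ t : ℝ, 0 < 1 + (t / k) ^ 2 := fun t => by positivity
  -- The bound `2k` comes from `π / 2 ≤ 2`, and the derivative `1 / (1 + (t/k)²)` is at least `1/2`
  -- for `|t| < k`.
  refine ⟨fun t => k * Real.arctan (t / k), fun t => (1 + (t / k) ^ 2)⁻¹, fun t => ?_, ?_,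
    fun t => ⟨?_, ?_⟩, by simp, by simp, fun t => ?_, fun t ht => ?_⟩
  · have h := (((hasDerivAt_id t).div_const k).arctan).const_mul k
    refine h.congr_deriv ?_
    simp only [id]
    field_simp
  · exact Continuous.inv₀ (by fun_prop) fun t => (hpos t).ne'
  · exact (inv_pos.2 (hpos t)).le
  · exact inv_le_one_of_one_le₀ (by nlinarith [sq_nonneg (t / k)])
  · rw [abs_mul, abs_of_pos hk, mul_comm]
    refine mul_le_mul_of_nonneg_right ?_ hk.le
    have h1 := Real.arctan_lt_pi_div_two (t / k)
    have h2 := Real.neg_pi_div_two_lt_arctan (t / k)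
    have h3 := Real.pi_le_four
    rw [abs_le]; constructor <;> linarith
  · rw [one_div]
    refine inv_anti₀ (hpos t) ?_
    have : (t / k) ^ 2 ≤ 1 := by
      rw [div_pow, div_le_one (by positivity), ← sq_abs]
      exact pow_le_pow_left₀ (abs_nonneg _) ht.le 2
    linarith

end Truncation

/-! ### Localized and truncated test functions. -/

section LocalizedTesting

open Params W

variable {P : Params} {φ : P.E → ℝ} {t : ℕ → W P} {C B : ℝ}

/-- The difference is the pairing of the bounded fields `Φ n` with the commutator `t_n ∇φ`, which
tends to zero in norm. -/
lemma tendsto_integral_inner_grad_mul_sub (hφ : ContDiff ℝ ∞ φ) (hc : HasCompactSupport φ)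
    (hC : ∀ n, ‖t n‖ ≤ C) (hae : ∀ᵐ x, Tendsto (fun n => t n x) atTop (𝓝 0))
    {Φ : ℕ → P.E → P.E} (hΦ : ∀ n, MemLp (Φ n) P.pconjE)
    (hB : ∀ n, ∫ x, ‖Φ n x‖ ^ (P.p / (P.p - 1)) ≤ B) :
    Tendsto (fun n => (∫ x, inner ℝ (Φ n x) (grad (mul hφ hc (t n)) x)) -
      ∫ x, φ x * inner ℝ (Φ n x) (grad (t n) x)) atTop (𝓝 0) := by
  obtain ⟨b, -, hb⟩ := exists_abs_le hφ hc
  refine (tendsto_integral_inner_zero_of_strong P.holderConjugate_pconj.symm hΦ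
    (fun n => memLp_smul_gradient hφ hc (t n)) hB
    (tendsto_integral_smul_gradient hφ hc hC hae)).congr fun n => ?_
  have hi := integrable_inner_of_holder P.holderConjugate_pconj.symm (hΦ n)
    (memLp_smooth_smul (memLp_grad (t n)) hφ.continuous.aestronglyMeasurable hb)
  simp only [← real_inner_smul_right]
  rw [eq_sub_iff_add_eq, ← integral_add (integrable_inner_of_holder P.holderConjugate_pconj.symm
    (hΦ n) (memLp_smul_gradient hφ hc (t n))) hi]
  refine integral_congr_ae ?_
  filter_upwards [grad_mul hφ hc (t n)] with x hx
  rw [hx, inner_add_right, add_comm]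

/-- The nonlocal analogue. The product rule is taken in its asymmetric form, so the cutoff is
evaluated at the first variable only, which matches the energy measure. -/
lemma tendsto_integral_inner_quot_mul_sub (hφ : ContDiff ℝ ∞ φ) (hc : HasCompactSupport φ)
    (hC : ∀ n, ‖t n‖ ≤ C) (hae : ∀ᵐ x, Tendsto (fun n => t n x) atTop (𝓝 0))
    {Φ : ℕ → P.E × P.E → ℝ} (hΦ : ∀ n, MemLp (Φ n) P.pconjE ((volume : Measure P.E).prod volume))
    (hB : ∀ n, ∫ z, ‖Φ n z‖ ^ (P.p / (P.p - 1)) ∂((volume : Measure P.E).prod volume) ≤ B) :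
    Tendsto (fun n => (∫ z, inner ℝ (Φ n z) (quot (mul hφ hc (t n)) z)
        ∂((volume : Measure P.E).prod volume)) -
      ∫ z, φ z.1 * inner ℝ (Φ n z) (quot (t n) z) ∂((volume : Measure P.E).prod volume))
      atTop (𝓝 0) := by
  obtain ⟨b, -, hb⟩ := exists_abs_le hφ hc
  refine (tendsto_integral_inner_zero_of_strong P.holderConjugate_pconj.symm hΦ
    (fun n => memLp_crossTerm hφ hc (t n)) hB
    (tendsto_integral_crossTerm hφ hc hC hae)).congr fun n => ?_
  have hi := integrable_inner_of_holder P.holderConjugate_pconj.symm (hΦ n)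
    (memLp_smooth_smul (memLp_quot (t n)) (η := fun z => φ z.1)
      (hφ.continuous.comp continuous_fst).aestronglyMeasurable (fun z => hb z.1))
  simp only [← real_inner_smul_right]
  rw [eq_sub_iff_add_eq, ← integral_add (integrable_inner_of_holder P.holderConjugate_pconj.symm
    (hΦ n) (memLp_crossTerm hφ hc (t n))) hi]
  refine integral_congr_ae ?_
  filter_upwards [quot_mul hφ hc (t n)] with x hx
  rw [hx, inner_add_right, add_comm, smul_eq_mul]

lemma W.tendsto_mul_ae (hφ : ContDiff ℝ ∞ φ) (hc : HasCompactSupport φ)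
    (hae : ∀ᵐ x, Tendsto (fun n => t n x) atTop (𝓝 0)) :
    ∀ᵐ x, Tendsto (fun n => mul hφ hc (t n) x) atTop (𝓝 0) := by
  filter_upwards [hae, ae_all_iff.2 fun n => coe_mul hφ hc (t n)] with x h1 h2
  simp only [h2]
  simpa using h1.const_mul (φ x)

lemma W.norm_mul_le (hφ : ContDiff ℝ ∞ φ) (hc : HasCompactSupport φ) (hC : ∀ n, ‖t n‖ ≤ C) (n : ℕ) :
    ‖mul hφ hc (t n)‖ ≤ ‖mulL hφ hc‖ * C :=
  ((mulL hφ hc).le_opNorm (t n)).trans (mul_le_mul_of_nonneg_left (hC n) (norm_nonneg _))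

lemma WeaklyConverges.tendsto_integral_inner_grad_zero {w : ℕ → W P} (hw : WeaklyConverges w 0)
    {G : P.E → P.E} (hG : MemLp G P.pconjE) :
    Tendsto (fun n => ∫ x, inner ℝ (G x) (grad (w n) x)) atTop (𝓝 0) := by
  have h := hw.tendsto_integral_inner_grad hG
  have h0 : ∫ x, inner ℝ (grad (0 : W P) x) (G x) = 0 := by
    rw [map_zero]
    refine integral_eq_zero_of_ae ?_
    filter_upwards [Lp.coeFn_zero P.E P.pE volume] with x hx
    rw [hx, Pi.zero_apply, inner_zero_left, Pi.zero_apply]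
  rw [h0] at h
  simpa only [real_inner_comm] using h

variable {θ' : ℝ → ℝ} {w : ℕ → W P}

lemma memLp_truncated_smul (hθ' : Continuous θ') (habs : ∀ t, |θ' t - 1| ≤ 1) {G : P.E → P.E}
    (hG : MemLp G P.pconjE) (w : W P) : MemLp (fun x => (θ' (w x) - 1) • G x) P.pconjE := by
  have hm : AEStronglyMeasurable (fun x => θ' (w x) - 1) :=
    ((hθ'.sub continuous_const).comp_aestronglyMeasurable (memLp_coe w).1 :)
  exact memLp_smooth_smul hG hm fun x => habs _

lemma tendsto_integral_truncated_smul (hθ' : Continuous θ') (habs : ∀ t, |θ' t - 1| ≤ 1)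
    (h1 : θ' 0 = 1) (hae : ∀ᵐ x, Tendsto (fun n => w n x) atTop (𝓝 0)) {G : P.E → P.E}
    (hG : MemLp G P.pconjE) :
    Tendsto (fun n => ∫ x, ‖(θ' (w n x) - 1) • G x‖ ^ (P.p / (P.p - 1))) atTop (𝓝 0) := by
  have hq := P.holderConjugate_pconj.symm.pos
  rw [← integral_zero P.E ℝ (μ := volume)]
  refine tendsto_integral_of_dominated_convergence (fun x => ‖G x‖ ^ (P.p / (P.p - 1)))
    (fun n => (integrable_norm_rpow hq (memLp_truncated_smul hθ' habs hG (w n))).1)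
    (integrable_norm_rpow hq hG) (fun n => Eventually.of_forall fun x => ?_) ?_
  · rw [Real.norm_of_nonneg (Real.rpow_nonneg (norm_nonneg _) _)]
    refine Real.rpow_le_rpow (norm_nonneg _) ?_ hq.le
    rw [norm_smul]
    exact mul_le_of_le_one_left (norm_nonneg _) (habs _)
  · filter_upwards [hae] with x hx
    have h2 : Tendsto (fun n => ‖(θ' (w n x) - 1) • G x‖) atTop (𝓝 0) := by
      have h3 : Tendsto (fun n => θ' (w n x)) atTop (𝓝 1) := by
        rw [← h1]; exact (hθ'.tendsto 0).comp hx
      have h4 := ((h3.sub_const 1).smul_const (G x)).norm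
      rwa [sub_self, zero_smul, norm_zero] at h4
    have h5 := h2.rpow_const (p := P.p / (P.p - 1)) (Or.inr hq.le)
    rwa [Real.zero_rpow hq.ne'] at h5

/-- Write `θ'(w_n) ∇w_n = ∇w_n + (θ'(w_n) - 1) ∇w_n`. The first term is weakly null; in the second
the scalar factor is moved onto the fixed `G`, where it tends to zero strongly by dominated
convergence. -/
lemma tendsto_integral_inner_grad_truncated (hθ' : Continuous θ')
    (h01 : ∀ t, 0 ≤ θ' t ∧ θ' t ≤ 1) (h1 : θ' 0 = 1) (hC : ∀ n, ‖w n‖ ≤ C)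
    (hw : WeaklyConverges w 0) (hae : ∀ᵐ x, Tendsto (fun n => w n x) atTop (𝓝 0)) {G : P.E → P.E}
    (hG : MemLp G P.pconjE) :
    Tendsto (fun n => ∫ x, inner ℝ (G x) (θ' (w n x) • grad (w n) x)) atTop (𝓝 0) := by
  have habs : ∀ t, |θ' t - 1| ≤ 1 := fun t => by
    rw [abs_le]; constructor <;> linarith [(h01 t).1, (h01 t).2]
  have hm := fun n => memLp_truncated_smul hθ' habs hG (w n)
  have h2 := tendsto_integral_inner_zero_of_strong P.holderConjugate_pconj
    (fun n => memLp_grad (w n)) hm (integral_grad_rpow_le hC)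
    (tendsto_integral_truncated_smul hθ' habs h1 hae hG)
  have h3 := (hw.tendsto_integral_inner_grad_zero hG).add h2
  rw [add_zero] at h3
  refine h3.congr fun n => ?_
  rw [← integral_add (integrable_inner_of_holder P.holderConjugate_pconj.symm hG (memLp_grad (w n)))
    (integrable_inner_of_holder P.holderConjugate_pconj (memLp_grad (w n)) (hm n))]
  refine integral_congr_ae (Eventually.of_forall fun x => ?_)
  simp only [real_inner_smul_right]
  rw [real_inner_comm (G x)]
  ring

/-- Makes the difference quotient of `θ(u - u₀)` a nonnegative multiple of that of `u - u₀`, so that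
truncation preserves the sign in the monotonicity inequality. -/
lemma exists_nonneg_sub_eq_mul_sub {θ : ℝ → ℝ} (hθ : Monotone θ) (a b : ℝ) :
    ∃ c : ℝ, 0 ≤ c ∧ θ a - θ b = c * (a - b) := by
  rcases eq_or_ne a b with rfl | hab
  · exact ⟨0, le_rfl, by simp⟩
  · refine ⟨(θ a - θ b) / (a - b), ?_, (div_mul_cancel₀ _ (sub_ne_zero.2 hab)).symm⟩
    rcases le_total a b with h | h
    · exact div_nonneg_of_nonpos (sub_nonpos.2 (hθ h)) (sub_nonpos.2 h)
    · exact div_nonneg (sub_nonneg.2 (hθ h)) (sub_nonneg.2 h)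

/-- The monotonicity of the nonlocal flux persists under monotone truncation. -/
lemma inner_flux_quot_truncated_nonneg {θ : ℝ → ℝ} (hθ : Monotone θ) (u u₀ : P.E → ℝ)
    (z : P.E × P.E) :
    0 ≤ inner ℝ (flux P.p (diffQuot u z) - flux P.p (diffQuot u₀ z))
      (diffQuot (fun x => θ (u x - u₀ x)) z) := by
  obtain ⟨c, hc, h⟩ := exists_nonneg_sub_eq_mul_sub hθ (u z.1 - u₀ z.1) (u z.2 - u₀ z.2)
  have e : diffQuot (fun x => θ (u x - u₀ x)) z = c • (diffQuot u z - diffQuot u₀ z) := by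
    simp only [diffQuot, h, smul_eq_mul]; ring
  rw [e, real_inner_smul_right]
  exact mul_nonneg hc (inner_flux_sub_nonneg P.one_lt_p _ _)

/-- The integrand that measures the failure of strong convergence of the gradients. -/
def fluxDefect (u u₀ : W P) (x : P.E) : ℝ :=
  inner ℝ (flux P.p (grad u x) - flux P.p (grad u₀ x)) (grad u x - grad u₀ x)

lemma fluxDefect_nonneg (u u₀ : W P) (x : P.E) : 0 ≤ fluxDefect u u₀ x :=
  inner_flux_sub_nonneg P.one_lt_p _ _

lemma integrable_fluxDefect (u u₀ : W P) : Integrable (fluxDefect u u₀) :=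
  integrable_inner_of_holder P.holderConjugate_pconj.symm
    ((memLp_flux P.holderConjugate_pconj (memLp_grad u)).sub
      (memLp_flux P.holderConjugate_pconj (memLp_grad u₀))) ((memLp_grad u).sub (memLp_grad u₀))

end LocalizedTesting

/-! ### The truncated energy estimate. -/

section GradientConvergence

open Params W

variable {P : Params} {u : ℕ → W P} {u₀ : W P} {f : W P →L[ℝ] ℝ} {A : ℕ → W P →L[ℝ] ℝ} {C : ℝ}
  {φ : P.E → ℝ}

/-- The critical term is not compact, but Hölder makes it proportional to the truncation height. It
matters that `K` depends neither on `k` nor on `n`. -/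
lemma exists_abs_integral_flux_pstar_le (hφ : ContDiff ℝ ∞ φ) (hc : HasCompactSupport φ)
    (hC : ∀ n, ‖u n‖ ≤ C) : ∃ K : ℝ, ∀ k : ℝ, 0 < k → ∀ n, ∀ v : W P,
      (∀ᵐ x, |v x| ≤ 2 * k * |φ x|) → |∫ x, inner ℝ (flux P.pstar (u n x)) (v x)| ≤ K * k := by
  have hps := P.pstar_pos
  have hq := P.holderConjugate_pstar.symm.pos
  obtain ⟨B, hB⟩ := exists_integral_val_rpow_le hC
  have hφm : MemLp φ P.pstarE := hφ.continuous.memLp_of_hasCompactSupport hc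
  have hI : 0 ≤ ∫ x, ‖φ x‖ ^ P.pstar := integral_nonneg fun x => Real.rpow_nonneg (norm_nonneg _) _
  refine ⟨B ^ (1 / (P.pstar / (P.pstar - 1))) * (2 * (∫ x, ‖φ x‖ ^ P.pstar) ^ (1 / P.pstar)),
    fun k hk n v hv => ?_⟩
  have hB0 : 0 ≤ B := (integral_nonneg fun x => Real.rpow_nonneg (norm_nonneg _) _).trans (hB n)
  have h1 := abs_integral_inner_le P.holderConjugate_pstar.symm
    (memLp_flux P.holderConjugate_pstar (memLp_coe (u n))) (memLp_coe v)
  simp only [norm_flux_rpow P.holderConjugate_pstar] at h1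
  have h2 : ∫ x, ‖v x‖ ^ P.pstar ≤ (2 * k) ^ P.pstar * ∫ x, ‖φ x‖ ^ P.pstar := by
    rw [← integral_const_mul]
    refine integral_mono_ae (integrable_norm_rpow hps (memLp_coe v))
      ((integrable_norm_rpow hps hφm).const_mul _) ?_
    filter_upwards [hv] with x hx
    rw [← Real.mul_rpow (by positivity) (norm_nonneg _)]
    exact Real.rpow_le_rpow (norm_nonneg _) hx hps.le
  have h3 : (∫ x, ‖v x‖ ^ P.pstar) ^ (1 / P.pstar) ≤
      2 * k * (∫ x, ‖φ x‖ ^ P.pstar) ^ (1 / P.pstar) := by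
    refine (Real.rpow_le_rpow (integral_nonneg fun x => Real.rpow_nonneg (norm_nonneg _) _) h2
      (by positivity)).trans (le_of_eq ?_)
    rw [Real.mul_rpow (by positivity) hI, ← Real.rpow_mul (by positivity),
      mul_one_div_cancel hps.ne', Real.rpow_one]
  refine h1.trans ((mul_le_mul (Real.rpow_le_rpow
    (integral_nonneg fun x => Real.rpow_nonneg (norm_nonneg _) _) (hB n) (by positivity)) h3
    (Real.rpow_nonneg (integral_nonneg fun x => Real.rpow_nonneg (norm_nonneg _) _) _)
    (by positivity)).trans (le_of_eq ?_))
  ring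

/-- The key estimate behind convergence of gradients, obtained with the test function `φ θ(u_n -
u₀)`. The constant is fixed before the truncation, so `k` can later be sent to zero. -/
lemma exists_integral_fluxDefect_le (hA : ∀ n, HasFDerivAt (energy f) (A n) (u n))
    (hA0 : Tendsto A atTop (𝓝 0)) (hC : ∀ n, ‖u n‖ ≤ C) (hu : WeaklyConverges u u₀)
    (hae : ∀ᵐ x, Tendsto (fun n => u n x) atTop (𝓝 (u₀ x))) (hφ : ContDiff ℝ ∞ φ)
    (hc : HasCompactSupport φ) (h01 : ∀ x, 0 ≤ φ x ∧ φ x ≤ 1) :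
    ∃ K : ℝ, ∀ k : ℝ, 0 < k → ∀ θ θ' : ℝ → ℝ, (∀ t, HasDerivAt θ (θ' t) t) → Continuous θ' →
      (∀ t, 0 ≤ θ' t ∧ θ' t ≤ 1) → θ 0 = 0 → θ' 0 = 1 → (∀ t, |θ t| ≤ 2 * k) → ∀ δ : ℝ, 0 < δ →
      ∀ᶠ n in atTop,
        ∫ x, φ x * (θ' ((u n - u₀ : W P) x) * fluxDefect (u n) u₀ x) ≤ K * k + δ := by
  obtain ⟨K, hK⟩ := exists_abs_integral_flux_pstar_le hφ hc hC
  refine ⟨K, fun k hk θ θ' hθ hθ'c hθ' hθ0 hθ'0 hθk δ hδ => ?_⟩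
  have hmono : Monotone θ := monotone_of_hasDerivAt_nonneg hθ fun t => (hθ' t).1
  have hθ'abs : ∀ t, |θ' t| ≤ 1 := fun t => by rw [abs_of_nonneg (hθ' t).1]; exact (hθ' t).2
  have hθc : Continuous θ := (show Differentiable ℝ θ from fun t => (hθ t).differentiableAt).continuous
  set w : ℕ → W P := fun n => u n - u₀ with hw
  have hwC : ∀ n, ‖w n‖ ≤ C + ‖u₀‖ := fun n =>
    (norm_sub_le _ _).trans (add_le_add (hC n) le_rfl)
  have hw0 : WeaklyConverges w 0 := hu.sub_const
  have hwe : ∀ᵐ x, ∀ n, w n x = u n x - u₀ x := ae_all_iff.2 fun n => W.coe_sub _ _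
  have hwae : ∀ᵐ x, Tendsto (fun n => w n x) atTop (𝓝 0) := by
    filter_upwards [hae, hwe] with x hx he
    simp only [he]
    simpa using hx.sub_const (u₀ x)
  choose t ht htg htq htn using fun n => W.exists_comp hθ hθ'c hθ'abs hθ0 (w n)
  have htC : ∀ n, ‖t n‖ ≤ C + ‖u₀‖ := fun n => (htn n).trans (hwC n)
  have htae : ∀ᵐ x, Tendsto (fun n => t n x) atTop (𝓝 0) := by
    filter_upwards [hwae, ae_all_iff.2 ht] with x hx he
    simp only [he]
    rw [← hθ0]
    exact (hθc.tendsto 0).comp hx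
  set v : ℕ → W P := fun n => mul hφ hc (t n) with hv
  have hvC := W.norm_mul_le hφ hc htC
  have hvae := W.tendsto_mul_ae hφ hc htae
  have hvk : ∀ n, ∀ᵐ x, |v n x| ≤ 2 * k * |φ x| := fun n => by
    filter_upwards [coe_mul hφ hc (t n), ht n] with x h1 h2
    rw [h1, h2, abs_mul, mul_comm]
    exact mul_le_mul_of_nonneg_right (hθk _) (abs_nonneg _)
  have htgrad : ∀ G : P.E → P.E, MemLp G P.pconjE →
      Tendsto (fun n => ∫ x, inner ℝ (G x) (grad (t n) x)) atTop (𝓝 0) := fun G hG =>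
    (tendsto_integral_inner_grad_truncated hθ'c hθ' hθ'0 hwC hw0 hwae hG).congr fun n =>
      integral_congr_ae (by filter_upwards [htg n] with x hx; rw [hx])
  obtain ⟨b, -, hb⟩ := exists_abs_le hφ hc
  have hvgrad : ∀ G : P.E → P.E, MemLp G P.pconjE →
      Tendsto (fun n => ∫ x, inner ℝ (G x) (grad (v n) x)) atTop (𝓝 0) := fun G hG => by
    have h1 := tendsto_integral_inner_grad_mul_sub hφ hc htC htae (Φ := fun _ => G) (fun _ => hG)
      (fun _ => le_rfl)
    have h2 := htgrad _ (memLp_smooth_smul hG hφ.continuous.aestronglyMeasurable hb)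
    simp only [real_inner_smul_left] at h2
    simpa using h1.add h2
  have hfv := tendsto_functional_zero hA hA0 hvC hvae hvgrad
  have hAv := tendsto_apply_zero hA0 hvC
  have hp := P.holderConjugate_pconj
  have hFg : ∀ n, MemLp (fun x => flux P.p (grad (u n) x)) P.pconjE := fun n =>
    memLp_flux hp (memLp_grad (u n))
  have hFq : ∀ n, MemLp (fun z => flux P.p (quot (u n) z)) P.pconjE
      ((volume : Measure P.E).prod volume) := fun n => memLp_flux hp (memLp_quot (u n))
  have hFg₀ : MemLp (fun x => flux P.p (grad u₀ x)) P.pconjE := memLp_flux hp (memLp_grad u₀)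
  have hFq₀ : MemLp (fun z => flux P.p (quot u₀ z)) P.pconjE
      ((volume : Measure P.E).prod volume) := memLp_flux hp (memLp_quot u₀)
  have hX₀ := hvgrad _ hFg₀
  have hY₀ := tendsto_integral_inner_quot_zero hvC hvae hFq₀
  have hX := tendsto_integral_inner_grad_mul_sub hφ hc htC htae
    (Φ := fun n x => flux P.p (grad (u n) x) - flux P.p (grad u₀ x))
    (fun n => (hFg n).sub hFg₀) (fun n => (integral_flux_sub_rpow_le hp (memLp_grad (u n))
      (memLp_grad u₀)).trans (mul_le_mul_of_nonneg_left
        (add_le_add (integral_grad_rpow_le hC n) le_rfl) (by positivity)))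
  have hY := tendsto_integral_inner_quot_mul_sub hφ hc htC htae
    (Φ := fun n z => flux P.p (quot (u n) z) - flux P.p (quot u₀ z))
    (fun n => (hFq n).sub hFq₀) (fun n => (integral_flux_sub_rpow_le hp (memLp_quot (u n))
      (memLp_quot u₀)).trans (mul_le_mul_of_nonneg_left
        (add_le_add (integral_quot_rpow_le hC n) le_rfl) (by positivity)))
  have hnonneg : ∀ n, 0 ≤ ∫ z, φ z.1 * inner ℝ (flux P.p (quot (u n) z) - flux P.p (quot u₀ z))
      (quot (t n) z) ∂((volume : Measure P.E).prod volume) := fun n => by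
    have hθw : (fun x => θ (w n x)) =ᵐ[volume] fun x => θ (u n x - u₀ x) := by
      filter_upwards [hwe] with x hx
      rw [hx]
    refine integral_nonneg_of_ae ?_
    filter_upwards [htq n, diffQuot_congr hθw, quot_ae_eq (u n), quot_ae_eq u₀] with z h1 h2 h3 h4
    rw [h1, h2, h3, h4]
    exact mul_nonneg (h01 _).1 (inner_flux_quot_truncated_nonneg hmono _ _ z)
  have hdef : ∀ n, ∫ x, φ x * inner ℝ (flux P.p (grad (u n) x) - flux P.p (grad u₀ x))
      (grad (t n) x) = ∫ x, φ x * (θ' (w n x) * fluxDefect (u n) u₀ x) := fun n => by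
    refine integral_congr_ae ?_
    filter_upwards [htg n, grad_sub (u n) u₀] with x h1 h2
    rw [h1, h2, real_inner_smul_right, fluxDefect]
  have hsplitX : ∀ n, ∫ x, inner ℝ (flux P.p (grad (u n) x) - flux P.p (grad u₀ x)) (grad (v n) x) =
      (∫ x, inner ℝ (flux P.p (grad (u n) x)) (grad (v n) x)) -
        ∫ x, inner ℝ (flux P.p (grad u₀ x)) (grad (v n) x) := fun n => by
    rw [← integral_sub (integrable_inner_of_holder hp.symm (hFg n) (memLp_grad _))
      (integrable_inner_of_holder hp.symm hFg₀ (memLp_grad _))]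
    simp only [inner_sub_left]
  have hsplitY : ∀ n, ∫ z, inner ℝ (flux P.p (quot (u n) z) - flux P.p (quot u₀ z)) (quot (v n) z)
        ∂((volume : Measure P.E).prod volume) =
      (∫ z, inner ℝ (flux P.p (quot (u n) z)) (quot (v n) z)
        ∂((volume : Measure P.E).prod volume)) -
        ∫ z, inner ℝ (flux P.p (quot u₀ z)) (quot (v n) z)
          ∂((volume : Measure P.E).prod volume) := fun n => by
    rw [← integral_sub (integrable_inner_of_holder hp.symm (hFq n) (memLp_quot _))
      (integrable_inner_of_holder hp.symm hFq₀ (memLp_quot _))]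
    simp only [inner_sub_left]
  -- After subtracting the pairings with the fluxes of `u₀` and the commutators, what tends to zero
  -- is exactly the truncated defect, plus the nonlocal term, minus the critical term. The nonlocal
  -- term is dropped by its sign and the critical one is at most `K k`.
  have htot := ((((hAv.add hfv).sub hX₀).sub hY₀).sub hX).sub hY
  simp only [add_zero, sub_zero] at htot
  filter_upwards [htot.eventually (gt_mem_nhds hδ)] with n hn
  have e1 := energy_hasFDerivAt_apply (hA n) (v n)
  have e2 := (abs_le.1 (hK k hk n (v n) (hvk n))).2
  have e3 := hnonneg n
  rw [hdef n] at hn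
  have e4 := hsplitX n
  have e5 := hsplitY n
  simp only [hv] at e1 e2 e4 e5 hn
  linarith

end GradientConvergence

/-! ### Almost everywhere convergence of gradients and weak convergence of fluxes. -/

section GradientConvergence

open Params W

variable {P : Params} {u : ℕ → W P} {u₀ : W P} {f : W P →L[ℝ] ℝ} {A : ℕ → W P →L[ℝ] ℝ} {C : ℝ}

/-- The truncated estimate controls the defect only where `|u_n - u₀| < k`; the remaining set has
small measure because `u_n - u₀` tends to zero in measure on balls. -/
lemma tendsto_measure_fluxDefect (hA : ∀ n, HasFDerivAt (energy f) (A n) (u n))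
    (hA0 : Tendsto A atTop (𝓝 0)) (hC : ∀ n, ‖u n‖ ≤ C) (hu : WeaklyConverges u u₀)
    (hae : ∀ᵐ x, Tendsto (fun n => u n x) atTop (𝓝 (u₀ x))) (R : ℝ) {ε : ℝ} (hε : 0 < ε) :
    Tendsto (fun n => volume (Metric.ball (0 : P.E) R ∩ {x | ε ≤ fluxDefect (u n) u₀ x}))
      atTop (𝓝 0) := by
  obtain ⟨m, hm⟩ := exists_nat_ge R
  have hφ := contDiff_cutoff (P := P) m
  have hc := hasCompactSupport_cutoff (P := P) m
  obtain ⟨K, hK⟩ := exists_integral_fluxDefect_le hA hA0 hC hu hae hφ hc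
    fun x => ⟨cutoff_nonneg m x, cutoff_le_one m x⟩
  have hwC : ∀ n, ‖u n - u₀‖ ≤ C + ‖u₀‖ := fun n =>
    (norm_sub_le _ _).trans (add_le_add (hC n) le_rfl)
  have hsplit : ∀ k : ℝ, 0 < k → ∀ δ : ℝ, 0 < δ → ∀ᶠ n in atTop,
      volume (Metric.ball (0 : P.E) R ∩ {x | ε ≤ fluxDefect (u n) u₀ x}) ≤
        ENNReal.ofReal (2 / ε * (K * k + δ)) +
          volume (Metric.ball (0 : P.E) R ∩ {x | k ≤ |(u n - u₀ : W P) x|}) := by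
    intro k hk δ hδ
    obtain ⟨θ, θ', hθ, hθ'c, hθ', hθ0, hθ'0, hθk, hθ'k⟩ := exists_truncation hk
    filter_upwards [hK k hk θ θ' hθ hθ'c hθ' hθ0 hθ'0 hθk δ hδ] with n hn
    set F : P.E → ℝ := fun x => cutoff P m x * (θ' ((u n - u₀ : W P) x) * fluxDefect (u n) u₀ x)
      with hF
    have hF0 : ∀ x, 0 ≤ F x := fun x => mul_nonneg (cutoff_nonneg m x)
      (mul_nonneg (hθ' _).1 (fluxDefect_nonneg _ _ _))
    have hFi : Integrable F := by
      refine (integrable_fluxDefect (u n) u₀).mono (hφ.continuous.aestronglyMeasurable.mul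
        ((hθ'c.comp_aestronglyMeasurable (memLp_coe (u n - u₀)).1).mul
          (integrable_fluxDefect (u n) u₀).1)) (Eventually.of_forall fun x => ?_)
      rw [Real.norm_of_nonneg (hF0 x), Real.norm_of_nonneg (fluxDefect_nonneg _ _ _), hF]
      have h1 := fluxDefect_nonneg (u n) u₀ x
      exact (mul_le_of_le_one_left (mul_nonneg (hθ' _).1 h1) (cutoff_le_one m x)).trans
        (mul_le_of_le_one_left h1 (hθ' _).2)
    have hmarkov := mul_meas_ge_le_integral_of_nonneg (μ := volume) (Eventually.of_forall hF0) hFi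
      (ε / 2)
    -- Where `|u_n - u₀| < k` one has `θ' ≥ 1/2`, and the cutoff equals one on the ball, so a defect
    -- of size `ε` forces `F ≥ ε / 2`.
    have hsub : Metric.ball (0 : P.E) R ∩ {x | ε ≤ fluxDefect (u n) u₀ x} ⊆
        {x | ε / 2 ≤ F x} ∪ (Metric.ball (0 : P.E) R ∩ {x | k ≤ |(u n - u₀ : W P) x|}) := by
      rintro x ⟨hxR, hx⟩
      by_cases hxk : k ≤ |(u n - u₀ : W P) x|
      · exact Or.inr ⟨hxR, hxk⟩
      · left
        simp only [Set.mem_ofPred_eq, hF] at hx ⊢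
        have h1 : cutoff P m x = 1 := cutoff_eq_one (by
          rw [mem_ball_zero_iff] at hxR; linarith)
        rw [h1, one_mul]
        have := hθ'k _ (not_le.1 hxk)
        nlinarith [(hθ' ((u n - u₀ : W P) x)).1]
    refine (measure_mono hsub).trans ((measure_union_le _ _).trans (add_le_add ?_ le_rfl))
    have hfin : volume {x | ε / 2 ≤ F x} ≠ ⊤ := (hFi.measure_ge_lt_top (half_pos hε)).ne
    rw [← ENNReal.ofReal_toReal hfin]
    refine ENNReal.ofReal_le_ofReal ?_
    have h2 := hmarkov.trans hn
    rw [measureReal_def] at h2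
    rw [div_mul_eq_mul_div, le_div_iff₀ hε]
    linarith
  rw [ENNReal.tendsto_nhds_zero]
  intro η hη
  -- The tolerance `δ` is taken equal to `k`; `k` is fixed first, then `n` is taken large.
  have hlim : Tendsto (fun k : ℝ => ENNReal.ofReal (2 / ε * (K * k + k))) (𝓝[>] 0) (𝓝 0) := by
    have : Continuous fun k : ℝ => ENNReal.ofReal (2 / ε * (K * k + k)) :=
      ENNReal.continuous_ofReal.comp (by fun_prop)
    have h := (this.tendsto 0).mono_left (nhdsWithin_le_nhds (s := Set.Ioi 0))
    simpa using h
  obtain ⟨k, hkη, hk⟩ := ((hlim.eventually (ge_mem_nhds (ENNReal.half_pos hη.ne'))).and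
    self_mem_nhdsWithin).exists
  filter_upwards [hsplit k hk k hk, (hu.sub_const.tendsto_measure_ball hwC R hk).eventually
    (ge_mem_nhds (ENNReal.half_pos hη.ne'))] with n h1 h2
  exact h1.trans ((add_le_add hkη h2).trans (ENNReal.add_halves η).le)

/-- Bounded weakly convergent Palais–Smale sequences converge almost everywhere together with their
gradients, along a subsequence. -/
lemma exists_subseq_tendsto_grad_ae (hA : ∀ n, HasFDerivAt (energy f) (A n) (u n))
    (hA0 : Tendsto A atTop (𝓝 0)) (hC : ∀ n, ‖u n‖ ≤ C) (hu : WeaklyConverges u u₀) :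
    ∃ k : ℕ → ℕ, StrictMono k ∧ (∀ᵐ x, Tendsto (fun n => u (k n) x) atTop (𝓝 (u₀ x))) ∧
      ∀ᵐ x, Tendsto (fun n => grad (u (k n)) x) atTop (𝓝 (grad u₀ x)) := by
  obtain ⟨k, hk, hkae⟩ := hu.exists_subseq_tendsto_ae hC
  obtain ⟨j, hj, hjae⟩ := exists_strictMono_tendsto_ae_of_tendsto_measure_ball (m := volume)
    (0 : P.E) (f := fun n => fluxDefect (u (k n)) u₀) (f₀ := fun _ => 0) fun R ε hε => by
      have h := tendsto_measure_fluxDefect (fun n => hA (k n)) (hA0.comp hk.tendsto_atTop)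
        (fun n => hC (k n)) (hu.comp hk) hkae R hε
      simpa only [Real.dist_eq, sub_zero, abs_of_nonneg (fluxDefect_nonneg _ _ _)] using h
  refine ⟨k ∘ j, hk.comp hj, ?_, ?_⟩
  · filter_upwards [hkae] with x hx
    exact hx.comp hj.tendsto_atTop
  · filter_upwards [hjae] with x hx
    exact tendsto_of_inner_flux_sub P.one_lt_p hx

/-- The limit does not depend on the subsequence, so it is enough that every subsequence has a
further one with almost everywhere convergent gradients; there the fluxes are bounded in `L^{p'}`
and converge weakly. -/
lemma fluxWeaklyConverges_pFlux (hA : ∀ n, HasFDerivAt (energy f) (A n) (u n))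
    (hA0 : Tendsto A atTop (𝓝 0)) (hC : ∀ n, ‖u n‖ ≤ C) (hu : WeaklyConverges u u₀) :
    FluxWeaklyConverges (fun n => pFlux (u n)) (pFlux u₀) := by
  have hp := P.holderConjugate_pconj
  have hm : ∀ w : W P, MemLp (pFlux w) P.pconjE := fun w => memLp_flux hp (memLp_grad w)
  refine ⟨fun n => hm _, hm _, fun G => tendsto_of_subseq_tendsto fun ns hns => ?_⟩
  obtain ⟨l, hl, hnl⟩ := strictMono_subseq_of_tendsto_atTop hns
  obtain ⟨k, hk, -, hkae⟩ := exists_subseq_tendsto_grad_ae (fun n => hA (ns (l n)))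
    (hA0.comp hnl.tendsto_atTop) (fun n => hC (ns (l n))) (hu.comp hnl)
  refine ⟨l ∘ k, tendsto_integral_inner_of_ae hp.symm (fun n => hm _) (hm u₀) (Lp.memLp G)
    (C := C ^ P.p) (fun n => ?_) ?_⟩
  · exact (integral_congr_ae (Eventually.of_forall fun x => norm_flux_rpow hp _)).trans_le
      (integral_grad_rpow_le hC _)
  · filter_upwards [hkae] with x hx
    exact ((continuous_flux P.one_lt_p).tendsto _).comp hx

end GradientConvergence

/-! ### Integrals against the energy and critical measures. -/

section EnergyMeasures

open Params W

variable {P : Params} {φ : P.E → ℝ} {B : ℝ}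

lemma W.measurable (u : W P) : Measurable (u : P.E → ℝ) := (W.stronglyMeasurable u).measurable

lemma measurable_energyDensity (u : W P) :
    Measurable fun x => ENNReal.ofReal (‖grad u x‖ ^ P.p) + fracDerivPow (u : P.E → ℝ) x :=
  ((Lp.stronglyMeasurable (grad u)).measurable.norm.pow_const _).ennreal_ofReal.add
    (measurable_fracDerivPow (W.measurable u))

lemma lintegral_fracDerivPow_ne_top (u : W P) : ∫⁻ x, fracDerivPow (u : P.E → ℝ) x ≠ ⊤ := by
  rw [lintegral_fracDerivPow]
  exact (gagliardoPow_lt_top u).ne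

lemma lintegral_ofReal_grad_ne_top (u : W P) : ∫⁻ x, ENNReal.ofReal (‖grad u x‖ ^ P.p) ≠ ⊤ :=
  (integrable_norm_rpow P.p_pos (memLp_grad u)).lintegral_lt_top.ne

instance isFiniteMeasure_energyMeasure (u : W P) : IsFiniteMeasure (energyMeasure u) := by
  refine isFiniteMeasure_withDensity ?_
  rw [lintegral_add_right _ (measurable_fracDerivPow (W.measurable u))]
  exact ENNReal.add_ne_top.2 ⟨lintegral_ofReal_grad_ne_top u, lintegral_fracDerivPow_ne_top u⟩

instance isFiniteMeasure_critMeasure (u : W P) : IsFiniteMeasure (critMeasure u) :=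
  isFiniteMeasure_withDensity (integrable_norm_rpow P.pstar_pos (memLp_coe u)).lintegral_lt_top.ne

variable (P) in
lemma Params.nontrivial_E : Nontrivial P.E :=
  Module.nontrivial_of_finrank_pos (R := ℝ) (by simpa using P.N_pos)

lemma energyMeasure_singleton (u : W P) (x : P.E) : energyMeasure u {x} = 0 := by
  have := P.nontrivial_E
  exact withDensity_absolutelyContinuous _ _ (measure_singleton x)

lemma critMeasure_singleton (u : W P) (x : P.E) : critMeasure u {x} = 0 := by
  have := P.nontrivial_E
  exact withDensity_absolutelyContinuous _ _ (measure_singleton x)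

lemma integral_critMeasure (u : W P) (φ : P.E → ℝ) :
    ∫ x, φ x ∂(critMeasure u) = ∫ x, φ x * ‖u x‖ ^ P.pstar := by
  rw [critMeasure, integral_withDensity_eq_integral_toReal_smul
    ((W.measurable u).abs.pow_const _).ennreal_ofReal
    (Eventually.of_forall fun x => ENNReal.ofReal_lt_top)]
  refine integral_congr_ae (Eventually.of_forall fun x => ?_)
  simp only
  rw [ENNReal.toReal_ofReal (Real.rpow_nonneg (abs_nonneg _) _), smul_eq_mul, mul_comm,
    Real.norm_eq_abs]

lemma integrable_mul_quot_rpow (u : W P) (hφ : Measurable φ) (hB : ∀ x, |φ x| ≤ B) :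
    Integrable (fun z : P.E × P.E => φ z.1 * ‖quot u z‖ ^ P.p)
      ((volume : Measure P.E).prod volume) :=
  (integrable_norm_rpow P.p_pos (memLp_quot u)).bdd_mul
    (hφ.comp measurable_fst).aestronglyMeasurable (Eventually.of_forall fun z => hB z.1)

lemma integrable_mul_grad_rpow (u : W P) (hφ : Measurable φ) (hB : ∀ x, |φ x| ≤ B) :
    Integrable (fun x => φ x * ‖grad u x‖ ^ P.p) :=
  (integrable_norm_rpow P.p_pos (memLp_grad u)).bdd_mul hφ.aestronglyMeasurable
    (Eventually.of_forall hB)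

lemma toReal_fracDerivPow (u : W P) (x : P.E) :
    (fracDerivPow (u : P.E → ℝ) x).toReal = ∫ y, ‖diffQuot (u : P.E → ℝ) (x, y)‖ ^ P.p := by
  have hm : Measurable fun y => ‖diffQuot (u : P.E → ℝ) (x, y)‖ ^ P.p :=
    ((measurable_diffQuot (W.measurable u)).comp (measurable_const.prodMk measurable_id)).norm.pow_const
      _
  rw [integral_eq_lintegral_of_nonneg_ae
    (Eventually.of_forall fun y => Real.rpow_nonneg (norm_nonneg _) _) hm.aestronglyMeasurable,
    fracDerivPow_eq_lintegral_diffQuot]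
  refine congrArg _ (lintegral_congr fun y => ?_)
  rw [← ofReal_norm, ENNReal.ofReal_rpow_of_nonneg (norm_nonneg _) P.p_pos.le]

/-- Fubini turns the nonlocal density into an integral of `‖quot u‖ᵖ` over the product space with
weight `φ z.1`, where the Brezis–Lieb lemma applies just as for gradients. -/
lemma integral_energyMeasure (u : W P) (hφ : Measurable φ) (hB : ∀ x, |φ x| ≤ B) :
    ∫ x, φ x ∂(energyMeasure u) = (∫ x, φ x * ‖grad u x‖ ^ P.p) +
      ∫ z, φ z.1 * ‖quot u z‖ ^ P.p ∂((volume : Measure P.E).prod volume) := by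
  have hfin : ∀ᵐ x, fracDerivPow (u : P.E → ℝ) x < ⊤ :=
    ae_lt_top (measurable_fracDerivPow (W.measurable u)) (lintegral_fracDerivPow_ne_top u)
  have hq := integrable_mul_quot_rpow u hφ hB
  have hae : (fun z : P.E × P.E => φ z.1 * ‖quot u z‖ ^ P.p)
      =ᵐ[(volume : Measure P.E).prod volume] fun z => φ z.1 * ‖diffQuot (u : P.E → ℝ) z‖ ^ P.p := by
    filter_upwards [quot_ae_eq u] with z hz
    rw [hz]
  have hprod := integral_prod _ (hq.congr hae)
  have hi := (hq.congr hae).integral_prod_left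
  simp only [integral_const_mul, ← toReal_fracDerivPow] at hprod hi
  rw [integral_congr_ae hae, hprod, ← integral_add (integrable_mul_grad_rpow u hφ hB) hi,
    energyMeasure, integral_withDensity_eq_integral_toReal_smul (measurable_energyDensity u)]
  · refine integral_congr_ae ?_
    filter_upwards [hfin] with x hx
    rw [ENNReal.toReal_add ENNReal.ofReal_ne_top hx.ne,
      ENNReal.toReal_ofReal (Real.rpow_nonneg (norm_nonneg _) _), smul_eq_mul]
    ring
  · filter_upwards [hfin] with x hx
    exact ENNReal.add_lt_top.2 ⟨ENNReal.ofReal_lt_top, hx⟩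

end EnergyMeasures

/-! ### Energy balance and Brezis–Lieb splitting against cutoffs. -/

section LocalizedEnergy

open Params W

/-- Expanding the inner product gives `‖f n‖ ^ p` minus the pairing of the flux of `f n` with `f₀`;
these fluxes converge weakly to the flux of `f₀`, whose pairing with `f₀` is `‖f₀‖ ^ p`. -/
lemma tendsto_integral_mul_inner_flux_sub {α H : Type*} [MeasurableSpace α] {m : Measure α}
    [NormedAddCommGroup H] [InnerProductSpace ℝ H] {p q : ℝ} (hpq : p.HolderConjugate q)
    {f : ℕ → α → H} {f₀ : α → H} (hf : ∀ n, MemLp (f n) (ENNReal.ofReal p) m)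
    (hf₀ : MemLp f₀ (ENNReal.ofReal p) m) {C : ℝ} (hC : ∀ n, ∫ x, ‖f n x‖ ^ p ∂m ≤ C)
    (hae : ∀ᵐ x ∂m, Tendsto (fun n => f n x) atTop (𝓝 (f₀ x))) {φ : α → ℝ}
    (hφ : AEStronglyMeasurable φ m) {B : ℝ} (hB : ∀ x, |φ x| ≤ B) :
    Tendsto (fun n => ∫ x, φ x * inner ℝ (flux p (f n x)) (f n x - f₀ x) ∂m -
      (∫ x, φ x * ‖f n x‖ ^ p ∂m - ∫ x, φ x * ‖f₀ x‖ ^ p ∂m)) atTop (𝓝 0) := by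
  have h := tendsto_integral_inner_of_ae hpq.symm (fun n => memLp_flux hpq (hf n))
    (memLp_flux hpq hf₀) (memLp_smooth_smul hf₀ hφ hB) (C := C)
    (fun n => by simpa only [norm_flux_rpow hpq] using hC n)
    (by filter_upwards [hae] with x hx; exact ((continuous_flux hpq.lt).tendsto _).comp hx)
  simp only [real_inner_smul_right, inner_flux_self hpq.pos] at h
  have h2 := (tendsto_const_nhds (x := ∫ x, φ x * ‖f₀ x‖ ^ p ∂m)).sub h
  rw [sub_self] at h2
  refine h2.congr fun n => ?_
  have i1 := integrable_inner_of_holder hpq.symm (memLp_flux hpq (hf n))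
    (memLp_smooth_smul (hf n) hφ hB)
  have i2 := integrable_inner_of_holder hpq.symm (memLp_flux hpq (hf n))
    (memLp_smooth_smul hf₀ hφ hB)
  simp only [real_inner_smul_right, inner_flux_self hpq.pos] at i1 i2
  simp only [inner_sub_right, mul_sub, inner_flux_self hpq.pos]
  rw [integral_sub i1 i2]
  ring

variable {P : Params} {u : ℕ → W P} {u₀ : W P} {f : W P →L[ℝ] ℝ} {A : ℕ → W P →L[ℝ] ℝ} {C : ℝ}
  {φ : P.E → ℝ}

lemma tendsto_quot_ae_of_tendsto_ae (hae : ∀ᵐ x, Tendsto (fun n => u n x) atTop (𝓝 (u₀ x))) :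
    ∀ᵐ z ∂((volume : Measure P.E).prod volume),
      Tendsto (fun n => quot (u n) z) atTop (𝓝 (quot u₀ z)) := by
  filter_upwards [W.tendsto_quot_ae hae, quot_ae_eq u₀] with z h1 h2
  rwa [h2]

/-- The energy that is lost in the limit equals the critical mass that is lost. -/
lemma tendsto_integral_energyMeasure_sub_critMeasure
    (hA : ∀ n, HasFDerivAt (energy f) (A n) (u n)) (hA0 : Tendsto A atTop (𝓝 0))
    (hC : ∀ n, ‖u n‖ ≤ C) (hu : WeaklyConverges u u₀)
    (hae : ∀ᵐ x, Tendsto (fun n => u n x) atTop (𝓝 (u₀ x)))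
    (hgae : ∀ᵐ x, Tendsto (fun n => grad (u n) x) atTop (𝓝 (grad u₀ x)))
    (hφ : ContDiff ℝ ∞ φ) (hc : HasCompactSupport φ) :
    Tendsto (fun n => ∫ x, φ x ∂(energyMeasure (u n)) - ∫ x, φ x ∂(critMeasure (u n))) atTop
      (𝓝 (∫ x, φ x ∂(energyMeasure u₀) - ∫ x, φ x ∂(critMeasure u₀))) := by
  obtain ⟨b, -, hb⟩ := exists_abs_le hφ hc
  have hφm := hφ.continuous.measurable
  have hp := P.holderConjugate_pconj
  have hwC : ∀ n, ‖u n - u₀‖ ≤ C + ‖u₀‖ := fun n =>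
    (norm_sub_le _ _).trans (add_le_add (hC n) le_rfl)
  have hwae : ∀ᵐ x, Tendsto (fun n => (u n - u₀ : W P) x) atTop (𝓝 0) := by
    filter_upwards [hae, ae_all_iff.2 fun n => W.coe_sub (u n) u₀] with x hx he
    simp only [he]
    simpa using hx.sub_const (u₀ x)
  have hAv := tendsto_apply_zero hA0 (W.norm_mul_le hφ hc hwC)
  -- Without truncation the test function depends linearly on `u_n - u₀`, so weak convergence
  -- applies directly to `f` composed with multiplication by `φ`.
  have hfv : Tendsto (fun n => f (mul hφ hc (u n - u₀))) atTop (𝓝 0) := by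
    have := hu.sub_const (f.comp (mulL hφ hc))
    rwa [map_zero] at this
  obtain ⟨K, hK⟩ := exists_integral_val_rpow_le hC
  have hX := tendsto_integral_inner_grad_mul_sub hφ hc hwC hwae
    (Φ := fun n x => flux P.p (grad (u n) x)) (fun n => memLp_flux hp (memLp_grad (u n)))
    (B := C ^ P.p) (fun n => by
      simpa only [norm_flux_rpow hp] using integral_grad_rpow_le hC n)
  have hY := tendsto_integral_inner_quot_mul_sub hφ hc hwC hwae
    (Φ := fun n z => flux P.p (quot (u n) z)) (fun n => memLp_flux hp (memLp_quot (u n)))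
    (B := C ^ P.p) (fun n => by
      simpa only [norm_flux_rpow hp] using integral_quot_rpow_le hC n)
  have hX' := tendsto_integral_mul_inner_flux_sub hp (fun n => memLp_grad (u n)) (memLp_grad u₀)
    (integral_grad_rpow_le hC) hgae hφm.aestronglyMeasurable hb
  have hY' := tendsto_integral_mul_inner_flux_sub hp (fun n => memLp_quot (u n)) (memLp_quot u₀)
    (integral_quot_rpow_le hC) (tendsto_quot_ae_of_tendsto_ae hae) (φ := fun z => φ z.1)
    (hφm.comp measurable_fst).aestronglyMeasurable (fun z => hb z.1)
  have hZ' := tendsto_integral_mul_inner_flux_sub P.holderConjugate_pstar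
    (fun n => memLp_coe (u n)) (memLp_coe u₀) hK hae hφm.aestronglyMeasurable hb
  have eX : ∀ n, ∫ x, φ x * inner ℝ (flux P.p (grad (u n) x)) (grad (u n - u₀) x) =
      ∫ x, φ x * inner ℝ (flux P.p (grad (u n) x)) (grad (u n) x - grad u₀ x) := fun n =>
    integral_congr_ae (by filter_upwards [grad_sub (u n) u₀] with x hx; rw [hx])
  have eY : ∀ n, ∫ z, φ z.1 * inner ℝ (flux P.p (quot (u n) z)) (quot (u n - u₀) z)
        ∂((volume : Measure P.E).prod volume) =
      ∫ z, φ z.1 * inner ℝ (flux P.p (quot (u n) z)) (quot (u n) z - quot u₀ z)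
        ∂((volume : Measure P.E).prod volume) := fun n =>
    integral_congr_ae (by filter_upwards [quot_sub (u n) u₀] with z hz; rw [hz])
  have eZ : ∀ n, ∫ x, inner ℝ (flux P.pstar (u n x)) (mul hφ hc (u n - u₀) x) =
      ∫ x, φ x * inner ℝ (flux P.pstar (u n x)) (u n x - u₀ x) := fun n =>
    integral_congr_ae (by
      filter_upwards [coe_mul hφ hc (u n - u₀), W.coe_sub (u n) u₀] with x h1 h2
      rw [h1, h2, ← smul_eq_mul, real_inner_smul_right])
  -- The derivative at `u_n` tested with `φ (u_n - u₀)`. Once commutators are removed, each flux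
  -- pairing is replaced by its difference of powers, which leaves the energy balance.
  have htot := (((((hAv.add hfv).sub hX).sub hY).sub hX').sub hY').add hZ'
  rw [← tendsto_sub_nhds_zero_iff]
  simp only [add_zero, sub_zero] at htot
  refine htot.congr fun n => ?_
  rw [integral_energyMeasure _ hφm hb, integral_energyMeasure _ hφm hb, integral_critMeasure,
    integral_critMeasure, energy_hasFDerivAt_apply (hA n), eX, eY, eZ]
  ring

/-- The Brezis–Lieb splitting of the energy measures. -/
lemma tendsto_integral_energyMeasure_sub (hC : ∀ n, ‖u n‖ ≤ C)
    (hae : ∀ᵐ x, Tendsto (fun n => u n x) atTop (𝓝 (u₀ x)))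
    (hgae : ∀ᵐ x, Tendsto (fun n => grad (u n) x) atTop (𝓝 (grad u₀ x)))
    (hφ : Measurable φ) {B : ℝ} (hB : ∀ x, |φ x| ≤ B) :
    Tendsto (fun n => ∫ x, φ x ∂(energyMeasure (u n - u₀)) -
      (∫ x, φ x ∂(energyMeasure (u n)) - ∫ x, φ x ∂(energyMeasure u₀))) atTop (𝓝 0) := by
  have h1 := tendsto_integral_mul_norm_sub_rpow P.p_pos (fun n => memLp_grad (u n)) (memLp_grad u₀)
    (integral_grad_rpow_le hC) hgae hφ.aestronglyMeasurable hB
  have h2 := tendsto_integral_mul_norm_sub_rpow P.p_pos (fun n => memLp_quot (u n)) (memLp_quot u₀)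
    (integral_quot_rpow_le hC) (tendsto_quot_ae_of_tendsto_ae hae) (φ := fun z => φ z.1)
    (hφ.comp measurable_fst).aestronglyMeasurable (fun z => hB z.1)
  have h3 := h1.add h2
  rw [add_zero] at h3
  refine h3.congr fun n => ?_
  have e1 : ∫ x, φ x * ‖grad (u n - u₀) x‖ ^ P.p =
      ∫ x, φ x * ‖grad (u n) x - grad u₀ x‖ ^ P.p :=
    integral_congr_ae (by filter_upwards [grad_sub (u n) u₀] with x hx; rw [hx])
  have e2 : ∫ z, φ z.1 * ‖quot (u n - u₀) z‖ ^ P.p ∂((volume : Measure P.E).prod volume) =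
      ∫ z, φ z.1 * ‖quot (u n) z - quot u₀ z‖ ^ P.p ∂((volume : Measure P.E).prod volume) :=
    integral_congr_ae (by filter_upwards [quot_sub (u n) u₀] with z hz; rw [hz])
  rw [integral_energyMeasure _ hφ hB, integral_energyMeasure _ hφ hB, integral_energyMeasure _ hφ hB,
    e1, e2]
  ring

/-- The Brezis–Lieb splitting of the critical measures. -/
lemma tendsto_integral_critMeasure_sub (hC : ∀ n, ‖u n‖ ≤ C)
    (hae : ∀ᵐ x, Tendsto (fun n => u n x) atTop (𝓝 (u₀ x)))
    (hφ : Measurable φ) {B : ℝ} (hB : ∀ x, |φ x| ≤ B) :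
    Tendsto (fun n => ∫ x, φ x ∂(critMeasure (u n - u₀)) -
      (∫ x, φ x ∂(critMeasure (u n)) - ∫ x, φ x ∂(critMeasure u₀))) atTop (𝓝 0) := by
  obtain ⟨K, hK⟩ := exists_integral_val_rpow_le hC
  refine (tendsto_integral_mul_norm_sub_rpow P.pstar_pos (fun n => memLp_coe (u n)) (memLp_coe u₀)
    hK hae hφ.aestronglyMeasurable hB).congr fun n => ?_
  rw [integral_critMeasure, integral_critMeasure, integral_critMeasure]
  congr 1
  exact integral_congr_ae (by filter_upwards [W.coe_sub (u n) u₀] with x hx; rw [hx])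

end LocalizedEnergy

/-! ### Finite measures satisfying a reverse Hölder inequality. -/

section Measures

open Metric

variable {X : Type*} [MeasurableSpace X] {α : Measure X} [IsFiniteMeasure α] {φ : X → ℝ}

lemma measureReal_le_integral_of_one_on {K : Set X} (hK : MeasurableSet K) (hi : Integrable φ α)
    (h0 : ∀ x, 0 ≤ φ x) (h1 : ∀ x ∈ K, φ x = 1) : α.real K ≤ ∫ x, φ x ∂α := by
  rw [← integral_indicator_one hK]
  refine integral_mono ((integrable_const (1 : ℝ)).indicator hK) hi fun x => ?_
  by_cases hx : x ∈ K
  · simp [hx, h1 x hx]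
  · simp [hx, h0 x]

lemma integral_le_measureReal_of_zero_off {T : Set X} (hT : MeasurableSet T) (hi : Integrable φ α)
    (h1 : ∀ x, φ x ≤ 1) (h0 : ∀ x, x ∉ T → φ x = 0) : ∫ x, φ x ∂α ≤ α.real T := by
  rw [← integral_indicator_one hT]
  refine integral_mono hi ((integrable_const (1 : ℝ)).indicator hT) fun x => ?_
  by_cases hx : x ∈ T
  · simp [hx, h1 x]
  · simp [hx, h0 x hx]

/-- The gap that forces concentration: dividing by `t ^ a` with `a < 1` leaves a positive lower
bound for every nonzero mass. -/
lemma eq_zero_or_le_of_mul_rpow_le {S a t : ℝ} (hS : 0 < S) (ha : a < 1) (ht : 0 ≤ t)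
    (h : S * t ^ a ≤ t) : t = 0 ∨ S ^ (1 / (1 - a)) ≤ t := by
  rcases ht.eq_or_lt with h0 | h0
  · exact Or.inl h0.symm
  · right
    have h1 : 0 < 1 - a := by linarith
    have h2 : S ≤ t ^ (1 - a) := by
      rw [Real.rpow_sub h0, Real.rpow_one, le_div_iff₀ (Real.rpow_pos_of_pos h0 _)]
      exact h
    calc S ^ (1 / (1 - a)) ≤ (t ^ (1 - a)) ^ (1 / (1 - a)) :=
          Real.rpow_le_rpow hS.le h2 (by positivity)
      _ = t := by rw [← Real.rpow_mul h0.le, mul_one_div_cancel h1.ne', Real.rpow_one]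

variable {E : Type*} [NormedAddCommGroup E] [MeasurableSpace E] [BorelSpace E] {m : Measure E}
  [IsFiniteMeasure m]

lemma tendsto_measureReal_cthickening {K : Set E} (hK : IsClosed K) :
    Tendsto (fun n : ℕ => m.real (cthickening (1 / ((n : ℝ) + 1)) K)) atTop (𝓝 (m.real K)) :=
  (ENNReal.tendsto_toReal (measure_ne_top _ _)).comp
    ((tendsto_measure_cthickening_of_isClosed ⟨1, one_pos, measure_ne_top _ _⟩ hK).comp
      tendsto_one_div_add_atTop_nhds_zero_nat)

/-- A finite measure that satisfies a reverse Hölder inequality on compact sets has finitely many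
atoms. -/
lemma finite_atoms {S a : ℝ} (hS : 0 < S) (ha : a < 1)
    (h : ∀ K : Set E, IsCompact K → S * m.real K ^ a ≤ m.real K) : {x | m {x} ≠ 0}.Finite := by
  have hτ : 0 < ENNReal.ofReal (S ^ (1 / (1 - a))) :=
    ENNReal.ofReal_pos.2 (Real.rpow_pos_of_pos hS _)
  refine (Measure.finite_const_le_meas_of_disjoint_iUnion m hτ
    (As := fun x : E => {x}) (fun x => measurableSet_singleton x) (fun x y hxy => by
      simpa using hxy) (measure_ne_top _ _)).subset fun x hx => ?_
  rcases eq_zero_or_le_of_mul_rpow_le hS ha measureReal_nonneg (h {x} isCompact_singleton)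
    with h0 | h0
  · exact absurd ((measureReal_eq_zero_iff).1 h0) hx
  · exact (ENNReal.ofReal_le_ofReal h0).trans (by rw [ofReal_measureReal])

/-- A finite measure that satisfies a reverse Hölder inequality on compact sets is atomic. -/
lemma eq_sum_dirac_of_reverse_holder [ProperSpace E] {S a : ℝ} (hS : 0 < S) (ha : a < 1)
    (h : ∀ K : Set E, IsCompact K → S * m.real K ^ a ≤ m.real K) :
    m = Measure.sum fun x : {x | m {x} ≠ 0} => m {(x : E)} • Measure.dirac (x : E) := by
  have hfin := finite_atoms hS ha h
  have : Countable {x | m {x} ≠ 0} := hfin.countable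
  -- Around a point that is not an atom the masses of closed balls shrink to zero. As soon as one
  -- falls below the gap it must vanish, so the complement of the atoms is locally null.
  have hnull : m {x | m {x} ≠ 0}ᶜ = 0 := by
    refine measure_null_of_locally_null _ fun x hx => ?_
    have hx0 : m.real {x} = 0 := by
      rw [measureReal_eq_zero_iff]; simpa using hx
    have hlim := tendsto_measureReal_cthickening (m := m) (isClosed_singleton (x := x))
    rw [hx0] at hlim
    obtain ⟨n, hn⟩ := (hlim.eventually (gt_mem_nhds
      (Real.rpow_pos_of_pos hS (1 / (1 - a))))).exists
    have hr : (0 : ℝ) < 1 / ((n : ℝ) + 1) := by positivity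
    rw [cthickening_singleton _ hr.le] at hn
    refine ⟨closedBall x (1 / ((n : ℝ) + 1)), mem_nhdsWithin_of_mem_nhds (closedBall_mem_nhds _ hr),
      ?_⟩
    rcases eq_zero_or_le_of_mul_rpow_le hS ha measureReal_nonneg
      (h _ (isCompact_closedBall x (1 / ((n : ℝ) + 1)))) with h0 | h0
    · exact (measureReal_eq_zero_iff).1 h0
    · exact absurd hn (not_lt.2 h0)
  have hU : (⋃ x : {x | m {x} ≠ 0}, {(x : E)}) = {x | m {x} ≠ 0} := Set.iUnion_of_singleton_coe _
  calc m = m.restrict {x | m {x} ≠ 0} :=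
        (Measure.restrict_eq_self_of_ae_mem (by rwa [← mem_ae_iff] at hnull)).symm
    _ = m.restrict (⋃ x : {x | m {x} ≠ 0}, {(x : E)}) := by rw [hU]
    _ = Measure.sum fun x : {x | m {x} ≠ 0} => m.restrict {(x : E)} :=
        Measure.restrict_iUnion (fun x y hxy => by
          simpa [Function.onFun, Subtype.ext_iff] using hxy) fun x => measurableSet_singleton _
    _ = _ := by simp only [Measure.restrict_singleton]

variable [NormedSpace ℝ E] [FiniteDimensional ℝ E]

omit [MeasurableSpace E] [BorelSpace E] in
lemma exists_contDiff_one_on_compact {K : Set E} (hK : IsCompact K) {δ : ℝ} (hδ : 0 < δ) :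
    ∃ φ : E → ℝ, ContDiff ℝ ∞ φ ∧ HasCompactSupport φ ∧ (∀ x, 0 ≤ φ x ∧ φ x ≤ 1) ∧
      (∀ x ∈ K, φ x = 1) ∧ ∀ x, x ∉ cthickening δ K → φ x = 0 := by
  obtain ⟨φ, hφ, hr, hs, h1⟩ := exists_contMDiff_support_eq_eq_one_iff (n := ((⊤ : ℕ∞) : ℕ∞))
    (modelWithCornersSelf ℝ E)
    (isOpen_thickening (δ := δ) (E := K)) hK.isClosed (self_subset_thickening hδ K)
  have h0 : ∀ x, x ∉ cthickening δ K → φ x = 0 := fun x hx => by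
    by_contra h
    have : x ∈ Function.support φ := h
    rw [hs] at this
    exact hx (thickening_subset_cthickening _ _ this)
  exact ⟨φ, hφ.contDiff, HasCompactSupport.intro hK.cthickening h0,
    fun x => hr (Set.mem_range_self x), fun x hx => (h1 x).1 hx, h0⟩

/-- Finite measures are ordered by their values on test functions. -/
lemma measure_le_of_integral_le {α β : Measure E} [IsFiniteMeasure α] [IsFiniteMeasure β]
    (h : ∀ φ : E → ℝ, ContDiff ℝ ∞ φ → HasCompactSupport φ →
    (∀ x, 0 ≤ φ x ∧ φ x ≤ 1) → ∫ x, φ x ∂α ≤ ∫ x, φ x ∂β) :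
    α ≤ β := by
  have hK : ∀ K : Set E, IsCompact K → α K ≤ β K := by
    intro K hK
    rw [← ENNReal.toReal_le_toReal (measure_ne_top _ _) (measure_ne_top _ _)]
    refine ge_of_tendsto' (tendsto_measureReal_cthickening (m := β) hK.isClosed) fun n => ?_
    obtain ⟨φ, hφ, hc, h01, h1, h0⟩ := exists_contDiff_one_on_compact hK
      (δ := 1 / ((n : ℝ) + 1)) (by positivity)
    exact (measureReal_le_integral_of_one_on hK.measurableSet
      (hφ.continuous.integrable_of_hasCompactSupport hc) (fun x => (h01 x).1) h1).trans
      ((h φ hφ hc h01).trans (integral_le_measureReal_of_zero_off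
        isClosed_cthickening.measurableSet (hφ.continuous.integrable_of_hasCompactSupport hc)
        (fun x => (h01 x).2) h0))
  refine Measure.le_iff.2 fun s hs => ?_
  rw [hs.measure_eq_iSup_isCompact α]
  exact iSup₂_le fun K hKs => iSup_le fun hKc => (hK K hKc).trans (measure_mono hKs)

/-- A reverse Hölder inequality for test functions bounds the measures of compact sets. -/
lemma reverse_holder_compact {S a p r : ℝ} (hS : 0 ≤ S) (ha : 0 ≤ a) (hp : 0 < p) (hr : 0 < r)
    (h : ∀ φ : E → ℝ, ContDiff ℝ ∞ φ → HasCompactSupport φ → (∀ x, 0 ≤ φ x ∧ φ x ≤ 1) →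
      S * (∫ x, φ x ^ r ∂m) ^ a ≤ ∫ x, φ x ^ p ∂m) {K : Set E} (hK : IsCompact K) :
    S * m.real K ^ a ≤ m.real K := by
  refine ge_of_tendsto' (tendsto_measureReal_cthickening (m := m) hK.isClosed) fun n => ?_
  obtain ⟨φ, hφ, hc, h01, h1, h0⟩ := exists_contDiff_one_on_compact hK
    (δ := 1 / ((n : ℝ) + 1)) (by positivity)
  have hint : ∀ e : ℝ, 0 < e → Integrable (fun x => φ x ^ e) m := fun e he =>
    (hφ.continuous.rpow_const fun x => Or.inr he.le).integrable_of_hasCompactSupport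
      (hc.comp_left (g := fun t : ℝ => t ^ e) (Real.zero_rpow he.ne'))
  refine le_trans ?_ ((h φ hφ hc h01).trans (integral_le_measureReal_of_zero_off
    isClosed_cthickening.measurableSet (hint p hp)
    (fun x => Real.rpow_le_one (h01 x).1 (h01 x).2 hp.le)
    (fun x hx => by rw [h0 x hx, Real.zero_rpow hp.ne'])))
  gcongr
  exact measureReal_le_integral_of_one_on hK.measurableSet (hint r hr)
    (fun x => Real.rpow_nonneg (h01 x).1 _) (fun x hx => by rw [h1 x hx, Real.one_rpow])

end Measures

/-! ### The Sobolev constant and its localized inequality. -/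

section SobolevConstant

open Params W

variable {P : Params} {φ : P.E → ℝ} {C : ℝ}

lemma Params.p_lt_pstar (P : Params) : P.p < P.pstar := by
  have h1 := P.p_lt_N
  have h0 := P.p_pos
  rw [pstar, lt_div_iff₀ (by linarith)]
  nlinarith

lemma isWeakGradient_gradient (hφ : ContDiff ℝ ∞ φ) (hc : HasCompactSupport φ) :
    IsWeakGradient φ (gradient φ) := by
  intro ψ hψ hcψ v
  have cont : ∀ {η : P.E → ℝ}, ContDiff ℝ ∞ η → Continuous fun x => fderiv ℝ η x v := fun hη =>
    (hη.continuous_fderiv (by simp)).clm_apply continuous_const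
  rw [integral_mul_fderiv_eq_neg_fderiv_mul_of_integrable
    (((cont hφ).mul hψ.continuous).integrable_of_hasCompactSupport hcψ.mul_left)
    ((hφ.continuous.mul (cont hψ)).integrable_of_hasCompactSupport hc.mul_right)
    ((hφ.continuous.mul hψ.continuous).integrable_of_hasCompactSupport hc.mul_right)
    (fun x _ => hφ.differentiable (by simp) x) (fun x _ => hψ.differentiable (by simp) x)]
  simp only [inner_gradient_eq_fderiv]

lemma W.exists_of_contDiff (hφ : ContDiff ℝ ∞ φ) (hc : HasCompactSupport φ) :
    ∃ v : W P, (v : P.E → ℝ) =ᵐ[volume] φ := by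
  have hcs : HasCompactSupport (gradient φ) := by
    refine (hc.fderiv ℝ).mono fun x hx => ?_
    contrapose! hx
    simp only [Function.mem_support, ne_eq, not_not] at hx ⊢
    rw [← norm_eq_zero, norm_gradient, hx, norm_zero]
  obtain ⟨v, hv, -⟩ := exists_of_memLp (hφ.continuous.memLp_of_hasCompactSupport hc)
    ((continuous_gradient hφ).memLp_of_hasCompactSupport hcs) (isWeakGradient_gradient hφ hc)
    (gagliardoPow_lt_top_of_contDiff hφ hc)
  exact ⟨v, hv⟩

variable (P) in
-- Needed so that the set defining `sobolevConst` is bounded above, since the real `sSup` of an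
-- unbounded set is zero.
lemma W.exists_val_ne_zero : ∃ v : W P, val v ≠ 0 := by
  obtain ⟨v, hv⟩ := W.exists_of_contDiff (contDiff_cutoff (P := P) 0) (hasCompactSupport_cutoff 0)
  refine ⟨v, fun h0 => ?_⟩
  have h1 : (v : P.E → ℝ) =ᵐ[volume] 0 := by rw [h0]; exact Lp.coeFn_zero ..
  have h2 := (contDiff_cutoff (P := P) 0).continuous.ae_eq_iff_eq volume continuous_zero |>.1
    (hv.symm.trans h1)
  have h3 := congrFun h2 0
  rw [cutoff_eq_one (by simp)] at h3
  simp at h3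

lemma exists_pos_mem_sobolevSet : ∃ c : ℝ, 0 < c ∧
    ∀ u : W P, c * ‖val u‖ ^ P.p ≤ ‖grad u‖ ^ P.p + gagliardo u ^ P.p := by
  have hp := P.p_pos
  obtain ⟨C, hC, h⟩ := exists_norm_val_le P
  refine ⟨(C ^ P.p)⁻¹, by positivity, fun u => ?_⟩
  refine le_add_of_le_of_nonneg ?_ (Real.rpow_nonneg (gagliardo_nonneg u) _)
  rw [inv_mul_le_iff₀ (by positivity), ← Real.mul_rpow hC.le (norm_nonneg _)]
  exact Real.rpow_le_rpow (norm_nonneg _) (h u) hp.le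

/-- The supremum is attained: for `val u ≠ 0` every admissible constant is at most the Sobolev
quotient of `u`, hence so is their supremum. -/
lemma sobolevConst_mul_le (u : W P) :
    sobolevConst P * ‖val u‖ ^ P.p ≤ ‖grad u‖ ^ P.p + gagliardo u ^ P.p := by
  have hp := P.p_pos
  rcases eq_or_ne (val u) 0 with h0 | h0
  · rw [h0, norm_zero, Real.zero_rpow hp.ne', mul_zero]
    exact add_nonneg (Real.rpow_nonneg (norm_nonneg _) _) (Real.rpow_nonneg (gagliardo_nonneg u) _)
  · have hpos : 0 < ‖val u‖ ^ P.p := Real.rpow_pos_of_pos (norm_pos_iff.2 h0) _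
    obtain ⟨c, -, hc⟩ := exists_pos_mem_sobolevSet (P := P)
    rw [← le_div_iff₀ hpos]
    exact csSup_le ⟨c, hc⟩ fun b hb => (le_div_iff₀ hpos).2 (hb u)

variable (P) in
lemma sobolevConst_pos : 0 < sobolevConst P := by
  obtain ⟨c, hc0, hc⟩ := exists_pos_mem_sobolevSet (P := P)
  obtain ⟨v, hv⟩ := W.exists_val_ne_zero P
  have hpos : 0 < ‖val v‖ ^ P.p := Real.rpow_pos_of_pos (norm_pos_iff.2 hv) _
  exact hc0.trans_le (le_csSup ⟨_, fun b hb => (le_div_iff₀ hpos).2 (hb v)⟩ hc)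

lemma integral_norm_rpow_le_of_ae_eq_add {α H : Type*} [MeasurableSpace α] {m : Measure α}
    [NormedAddCommGroup H] [NormedSpace ℝ H] {r ε c : ℝ} (hr : 0 < r)
    (hle : ∀ a b : ℝ, 0 ≤ a → 0 ≤ b → (a + b) ^ r ≤ (1 + ε) * a ^ r + c * b ^ r) {F f g : α → H}
    (hf : MemLp f (ENNReal.ofReal r) m) (hg : MemLp g (ENNReal.ofReal r) m) {η : α → ℝ}
    (hη : AEStronglyMeasurable η m) (h01 : ∀ x, 0 ≤ η x ∧ η x ≤ 1)
    (hF : F =ᵐ[m] fun x => η x • f x + g x) :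
    ∫ x, ‖F x‖ ^ r ∂m ≤ (1 + ε) * ∫ x, η x ^ r * ‖f x‖ ^ r ∂m + c * ∫ x, ‖g x‖ ^ r ∂m := by
  have hηf := memLp_smooth_smul hf hη (B := 1) fun x => by
    rw [abs_of_nonneg (h01 x).1]; exact (h01 x).2
  have hnorm : ∀ x, ‖η x • f x‖ ^ r = η x ^ r * ‖f x‖ ^ r := fun x => by
    rw [norm_smul, Real.norm_of_nonneg (h01 x).1, Real.mul_rpow (h01 x).1 (norm_nonneg _)]
  have i1 := integrable_norm_rpow hr hηf
  have i2 := integrable_norm_rpow hr hg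
  simp only [← hnorm]
  rw [← integral_const_mul, ← integral_const_mul, ← integral_add (i1.const_mul _) (i2.const_mul _)]
  refine integral_mono_of_nonneg (Eventually.of_forall fun x => Real.rpow_nonneg (norm_nonneg _) _)
    ((i1.const_mul _).add (i2.const_mul _)) ?_
  filter_upwards [hF] with x hx
  rw [hx]
  exact (Real.rpow_le_rpow (norm_nonneg _) (norm_add_le _ _) hr.le).trans
    (hle _ _ (norm_nonneg _) (norm_nonneg _))

variable {w : ℕ → W P}

/-- The Sobolev inequality, localized along a bounded sequence that tends to zero. -/
lemma sobolevConst_mul_rpow_le_of_tendsto (hφ : ContDiff ℝ ∞ φ) (hc : HasCompactSupport φ)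
    (h01 : ∀ x, 0 ≤ φ x ∧ φ x ≤ 1) (hC : ∀ n, ‖w n‖ ≤ C)
    (hae : ∀ᵐ x, Tendsto (fun n => w n x) atTop (𝓝 0)) {a b : ℝ}
    (ha : Tendsto (fun n => ∫ x, φ x ^ P.pstar ∂(critMeasure (w n))) atTop (𝓝 a))
    (hb : Tendsto (fun n => ∫ x, φ x ^ P.p ∂(energyMeasure (w n))) atTop (𝓝 b)) :
    sobolevConst P * a ^ (P.p / P.pstar) ≤ b := by
  have hp := P.p_pos
  have hps := P.pstar_pos
  -- The factor `1 + ε` pays for separating the commutators, which then vanish in the limit. Letting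
  -- `ε → 0` afterwards loses nothing, so the sharp constant `sobolevConst P` survives.
  have key : ∀ ε : ℝ, 0 < ε → sobolevConst P * a ^ (P.p / P.pstar) ≤ (1 + ε) * b := by
    intro ε hε
    obtain ⟨c, hc0, hle⟩ := exists_add_rpow_le hp hε
    have hR := ((tendsto_integral_smul_gradient hφ hc hC hae).add
      (tendsto_integral_crossTerm hφ hc hC hae)).const_mul c
    have hlim := (hb.const_mul (1 + ε)).add hR
    rw [add_zero, mul_zero, add_zero] at hlim
    refine le_of_tendsto_of_tendsto'
      ((ha.rpow_const (p := P.p / P.pstar) (Or.inr (by positivity))).const_mul _) hlim fun n => ?_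
    have h1 := sobolevConst_mul_le (mul hφ hc (w n))
    have e1 : ‖val (mul hφ hc (w n))‖ ^ P.p =
        (∫ x, φ x ^ P.pstar ∂(critMeasure (w n))) ^ (P.p / P.pstar) := by
      have : ∫ x, φ x ^ P.pstar ∂(critMeasure (w n)) = ‖val (mul hφ hc (w n))‖ ^ P.pstar := by
        rw [Lp_norm_rpow hps, integral_critMeasure]
        refine integral_congr_ae ?_
        filter_upwards [coe_mul hφ hc (w n)] with x hx
        rw [hx, norm_mul, Real.norm_of_nonneg (h01 x).1, Real.mul_rpow (h01 x).1 (norm_nonneg _)]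
      rw [this, ← Real.rpow_mul (norm_nonneg _), mul_div_cancel₀ _ hps.ne']
    have hφ1 : ∀ x, |φ x ^ P.p| ≤ 1 := fun x => by
      rw [abs_of_nonneg (Real.rpow_nonneg (h01 x).1 _)]
      exact Real.rpow_le_one (h01 x).1 (h01 x).2 hp.le
    rw [e1, Lp_norm_rpow hp, ← norm_quot, Lp_norm_rpow hp] at h1
    rw [integral_energyMeasure (w n) (hφ.continuous.measurable.pow_const _) hφ1]
    have h2 := integral_norm_rpow_le_of_ae_eq_add hp hle (memLp_grad (w n))
      (memLp_smul_gradient hφ hc (w n)) hφ.continuous.aestronglyMeasurable h01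
      (grad_mul hφ hc (w n))
    have h3 := integral_norm_rpow_le_of_ae_eq_add hp hle (memLp_quot (w n))
      (memLp_crossTerm hφ hc (w n)) (η := fun z => φ z.1)
      (hφ.continuous.comp continuous_fst).aestronglyMeasurable (fun z => h01 z.1)
      (quot_mul hφ hc (w n))
    linarith
  have hlim : Tendsto (fun ε : ℝ => (1 + ε) * b) (𝓝[>] 0) (𝓝 b) := by
    have hcont : Continuous fun ε : ℝ => (1 + ε) * b := by fun_prop
    simpa using (hcont.tendsto 0).mono_left (nhdsWithin_le_nhds (s := Set.Ioi 0))
  exact ge_of_tendsto hlim (by filter_upwards [self_mem_nhdsWithin] with ε hε using key ε hε)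

end SobolevConstant

/-! ### The defect measure and the concentration families. -/

section Concentration

open Params W

variable {P : Params} {u : ℕ → W P} {u₀ : W P} {f : W P →L[ℝ] ℝ} {A : ℕ → W P →L[ℝ] ℝ} {C : ℝ}
  {μ₀ ν₀ : Measure P.E} [IsFiniteMeasure μ₀] [IsFiniteMeasure ν₀]

/-- The energy and the critical mass that are lost in the limit are the same measure, and it
satisfies a reverse Hölder inequality. -/
lemma exists_defect_measure (hA : ∀ n, HasFDerivAt (energy f) (A n) (u n))
    (hA0 : Tendsto A atTop (𝓝 0)) (hC : ∀ n, ‖u n‖ ≤ C) (hu : WeaklyConverges u u₀)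
    (hae : ∀ᵐ x, Tendsto (fun n => u n x) atTop (𝓝 (u₀ x)))
    (hgae : ∀ᵐ x, Tendsto (fun n => grad (u n) x) atTop (𝓝 (grad u₀ x)))
    (hμ : VaguelyConverges (fun n => energyMeasure (u n)) μ₀)
    (hν : VaguelyConverges (fun n => critMeasure (u n)) ν₀) :
    ∃ m : Measure P.E, IsFiniteMeasure m ∧ ν₀ = critMeasure u₀ + m ∧ μ₀ = energyMeasure u₀ + m ∧
      ∀ K : Set P.E, IsCompact K → sobolevConst P * m.real K ^ (P.p / P.pstar) ≤ m.real K := by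
  have hp := P.p_pos
  have hps := P.pstar_pos
  have hlimE : ∀ ψ : P.E → ℝ, Continuous ψ → HasCompactSupport ψ →
      Tendsto (fun n => ∫ x, ψ x ∂(energyMeasure (u n - u₀))) atTop
        (𝓝 (∫ x, ψ x ∂μ₀ - ∫ x, ψ x ∂(energyMeasure u₀))) := by
    intro ψ hψ hc
    obtain ⟨B, hB⟩ := hc.exists_bound_of_continuous hψ
    simpa using (tendsto_integral_energyMeasure_sub hC hae hgae hψ.measurable hB).add
      ((hμ ψ hψ hc).sub_const (∫ x, ψ x ∂(energyMeasure u₀)))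
  have hlimC : ∀ ψ : P.E → ℝ, Continuous ψ → HasCompactSupport ψ →
      Tendsto (fun n => ∫ x, ψ x ∂(critMeasure (u n - u₀))) atTop
        (𝓝 (∫ x, ψ x ∂ν₀ - ∫ x, ψ x ∂(critMeasure u₀))) := by
    intro ψ hψ hc
    obtain ⟨B, hB⟩ := hc.exists_bound_of_continuous hψ
    simpa using (tendsto_integral_critMeasure_sub hC hae hψ.measurable hB).add
      ((hν ψ hψ hc).sub_const (∫ x, ψ x ∂(critMeasure u₀)))
  -- By Brezis–Lieb the difference is a vague limit of the nonnegative measures of `u_n - u₀`; this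
  -- makes the subtraction defining `m` exact.
  have hle : critMeasure u₀ ≤ ν₀ := measure_le_of_integral_le fun φ hφ hc h01 =>
    sub_nonneg.1 (ge_of_tendsto' (hlimC φ hφ.continuous hc) fun n =>
      integral_nonneg fun x => (h01 x).1)
  obtain ⟨m, hm⟩ : ∃ m : Measure P.E, ν₀ = critMeasure u₀ + m :=
    ⟨ν₀ - critMeasure u₀, by rw [add_comm, Measure.sub_add_cancel_of_le hle]⟩
  have hmf : IsFiniteMeasure m :=
    isFiniteMeasure_of_le ν₀ (by rw [hm]; exact Measure.le_add_left le_rfl)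
  have hint : ∀ (n : Measure P.E) [IsFiniteMeasure n] {ψ : P.E → ℝ}, Continuous ψ →
      HasCompactSupport ψ → Integrable ψ n := fun n _ ψ hψ hc =>
    hψ.integrable_of_hasCompactSupport hc
  have hνm : ∀ ψ : P.E → ℝ, Continuous ψ → HasCompactSupport ψ →
      ∫ x, ψ x ∂ν₀ = ∫ x, ψ x ∂(critMeasure u₀) + ∫ x, ψ x ∂m := fun ψ hψ hc => by
    rw [hm, integral_add_measure (hint _ hψ hc) (hint _ hψ hc)]
  -- The energy balance and the vague limits compute the same limit twice, so `μ₀` and `ν₀` have the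
  -- same excess over the measures of `u₀`.
  have heq : ∀ φ : P.E → ℝ, ContDiff ℝ ∞ φ → HasCompactSupport φ →
      ∫ x, φ x ∂μ₀ = ∫ x, φ x ∂(energyMeasure u₀ + m) := fun φ hφ hc => by
    have h1 := tendsto_nhds_unique ((hμ φ hφ.continuous hc).sub (hν φ hφ.continuous hc))
      (tendsto_integral_energyMeasure_sub_critMeasure hA hA0 hC hu hae hgae hφ hc)
    rw [integral_add_measure (hint _ hφ.continuous hc) (hint _ hφ.continuous hc)]
    linarith [hνm φ hφ.continuous hc]
  have hμm : μ₀ = energyMeasure u₀ + m := le_antisymm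
    (measure_le_of_integral_le fun φ hφ hc _ => (heq φ hφ hc).le)
    (measure_le_of_integral_le fun φ hφ hc _ => (heq φ hφ hc).ge)
  refine ⟨m, hmf, hm, hμm, fun K hK => reverse_holder_compact (sobolevConst_pos P).le
    (by positivity) hp hps (fun φ hφ hc h01 => ?_) hK⟩
  -- The powers of `φ` need not be smooth. They are continuous with compact support, which is why
  -- `hlimE` and `hlimC` are stated for such functions.
  have hpow : ∀ e : ℝ, 0 < e →
      (Continuous fun x => φ x ^ e) ∧ HasCompactSupport fun x => φ x ^ e := fun e he =>
    ⟨hφ.continuous.rpow_const fun x => Or.inr he.le,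
      hc.comp_left (g := fun t : ℝ => t ^ e) (Real.zero_rpow he.ne')⟩
  have h1 := hlimE _ (hpow _ hp).1 (hpow _ hp).2
  have h2 := hlimC _ (hpow _ hps).1 (hpow _ hps).2
  rw [hνm _ (hpow _ hps).1 (hpow _ hps).2, add_sub_cancel_left] at h2
  rw [hμm, integral_add_measure (hint _ (hpow _ hp).1 (hpow _ hp).2)
    (hint _ (hpow _ hp).1 (hpow _ hp).2), add_sub_cancel_left] at h1
  refine sobolevConst_mul_rpow_le_of_tendsto hφ hc h01 (C := C + ‖u₀‖)
    (fun n => (norm_sub_le _ _).trans (add_le_add (hC n) le_rfl)) ?_ h2 h1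
  filter_upwards [hae, ae_all_iff.2 fun n => W.coe_sub (u n) u₀] with x hx he
  simp only [he]
  simpa using hx.sub_const (u₀ x)

lemma VaguelyConverges.comp {m : ℕ → Measure P.E} {m₀ : Measure P.E} (h : VaguelyConverges m m₀)
    {k : ℕ → ℕ} (hk : StrictMono k) : VaguelyConverges (fun n => m (k n)) m₀ :=
  fun φ hφ hc => (h φ hφ hc).comp hk.tendsto_atTop

/-- Concentration at finitely many points. -/
lemma exists_isConcentrationFamily (hA : ∀ n, HasFDerivAt (energy f) (A n) (u n))
    (hA0 : Tendsto A atTop (𝓝 0)) (hC : ∀ n, ‖u n‖ ≤ C) (hu : WeaklyConverges u u₀)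
    (hμ : VaguelyConverges (fun n => energyMeasure (u n)) μ₀)
    (hν : VaguelyConverges (fun n => critMeasure (u n)) ν₀) :
    (∃ (J : Type) (x : J → P.E) (μ ν : J → ℝ), IsConcentrationFamily u₀ μ₀ ν₀ J x μ ν) ∧
      ∀ (J : Type) (x : J → P.E) (μ ν : J → ℝ), IsConcentrationFamily u₀ μ₀ ν₀ J x μ ν →
        Finite J := by
  obtain ⟨k, hk, hae, hgae⟩ := exists_subseq_tendsto_grad_ae hA hA0 hC hu
  obtain ⟨m, hmf, hνm, hμm, hm⟩ := exists_defect_measure (fun n => hA (k n))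
    (hA0.comp hk.tendsto_atTop) (fun n => hC (k n)) (hu.comp hk) hae hgae (hμ.comp hk) (hν.comp hk)
  have hlt : P.p / P.pstar < 1 := (div_lt_one P.pstar_pos).2 P.p_lt_pstar
  have hfin := finite_atoms (sobolevConst_pos P) hlt hm
  have hsum := eq_sum_dirac_of_reverse_holder (sobolevConst_pos P) hlt hm
  have hν1 : ∀ x, ν₀ {x} = m {x} := fun x => by
    rw [hνm, Measure.add_apply, critMeasure_singleton, zero_add]
  have hμ1 : ∀ x, μ₀ {x} = m {x} := fun x => by
    rw [hμm, Measure.add_apply, energyMeasure_singleton, zero_add]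
  have hpos : ∀ x : {x | m {x} ≠ 0}, 0 < m.real {(x : P.E)} := fun x =>
    measureReal_nonneg.lt_of_ne' fun h => x.2 ((measureReal_eq_zero_iff).1 h)
  have hof : ∀ x, ENNReal.ofReal (m.real {x}) = m {x} := fun x => ofReal_measureReal
  -- Both families of masses are the atoms of the single defect measure `m`, so the Sobolev relation
  -- is the reverse Hölder inequality on a singleton.
  refine ⟨⟨{x | m {x} ≠ 0}, Subtype.val, fun x => m.real {(x : P.E)}, fun x => m.real {(x : P.E)},
    { countable := hfin.countable
      injective := Subtype.val_injective
      μ_pos := hpos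
      ν_pos := hpos
      μ_atom := fun x => by rw [hμ1, hof]
      ν_atom := fun x => by rw [hν1, hof]
      μ_ge := by simp only [hof]; rw [← hsum, hμm]
      ν_eq := by simp only [hof]; rw [← hsum, hνm]
      sobolev_le := fun x => hm _ isCompact_singleton }⟩, fun J x μ ν hJ => ?_⟩
  -- Each point of an arbitrary family is an atom of `ν₀`, hence of `m`, because the critical
  -- measure of `u₀` has none; the index set thus injects into a finite set.
  have : Finite {x | m {x} ≠ 0} := hfin
  refine Finite.of_injective (β := {x | m {x} ≠ 0}) (fun j => ⟨x j, ?_⟩) fun i j hij =>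
    hJ.injective (congrArg Subtype.val hij)
  rw [Set.mem_ofPred_eq, ← hν1, hJ.ν_atom j]
  exact (ENNReal.ofReal_pos.2 (hJ.ν_pos j)).ne'

end Concentration

end MixedPLaplace

end

theorem mainTheorem5 (P : MixedPLaplace.Params) (f : MixedPLaplace.W P →L[ℝ] ℝ) (c : ℝ)
    (u : ℕ → MixedPLaplace.W P) (u₀ : MixedPLaplace.W P)
    (hbdd : ∃ C : ℝ, ∀ n, ‖u n‖ ≤ C)
    (hPS : MixedPLaplace.IsPalaisSmale f c u)
    (hweak : MixedPLaplace.WeaklyConverges u u₀) :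
    (∀ (k : ℕ → ℕ) (_ : StrictMono k)
        (μ₀ ν₀ : MeasureTheory.Measure P.E)
        (_ : MeasureTheory.IsFiniteMeasure μ₀) (_ : MeasureTheory.IsFiniteMeasure ν₀)
        (_ : MixedPLaplace.VaguelyConverges
          (fun n => MixedPLaplace.energyMeasure (u (k n))) μ₀)
        (_ : MixedPLaplace.VaguelyConverges
          (fun n => MixedPLaplace.critMeasure (u (k n))) ν₀),
      (∃ (J : Type) (x : J → P.E) (μ ν : J → ℝ),
        MixedPLaplace.IsConcentrationFamily u₀ μ₀ ν₀ J x μ ν) ∧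
      ∀ (J : Type) (x : J → P.E) (μ ν : J → ℝ),
        MixedPLaplace.IsConcentrationFamily u₀ μ₀ ν₀ J x μ ν → Finite J) ∧
    (∃ k : ℕ → ℕ, StrictMono k ∧
      ∀ᵐ x : P.E, Tendsto (fun n => MixedPLaplace.W.grad (u (k n)) x) atTop
        (𝓝 (MixedPLaplace.W.grad u₀ x))) ∧
    MixedPLaplace.FluxWeaklyConverges
      (fun n => MixedPLaplace.pFlux (u n)) (MixedPLaplace.pFlux u₀) := by
  obtain ⟨C, hC⟩ := hbdd
  obtain ⟨-, A, hA, hA0⟩ := hPS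
  refine ⟨fun k hk μ₀ ν₀ _ _ hμ hν => MixedPLaplace.exists_isConcentrationFamily
    (fun n => hA (k n)) (hA0.comp hk.tendsto_atTop) (fun n => hC (k n)) (hweak.comp hk) hμ hν, ?_,
    MixedPLaplace.fluxWeaklyConverges_pFlux hA hA0 hC hweak⟩
  obtain ⟨k, hk, -, hkae⟩ := MixedPLaplace.exists_subseq_tendsto_grad_ae hA hA0 hC hweak
  exact ⟨k, hk, hkae⟩
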